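/- Let $N\ge 1$, $0<\alpha<2$, $H=(H_1,\dots,H_N)\in(0,1)^N$. Let $\widetilde M_\alpha$ be a complex-valued rotationally invariant $\alpha$-stable random measure on $\mathbb R^N$ with Lebesgue control measure: an independently scattered, $\sigma$-additive family of complex random variables $\widetilde M_\alpha(A)$, indexed by the Borel sets $A$ of finite Lebesgue measure $|A|$, with $\mathbb E\exp\big(i\,\mathrm{Re}(\overline{\theta}\,\widetilde M_\alpha(A))\big)=\exp(-|\theta|^\alpha|A|)$ for all $\theta\in\mathbb C$. For $f\in L^\alpha(\mathbb R^N)$ the integral $\int f\,d\widetilde M_\alpha$ is the limit in probability of the integrals of simple functions converging to $f$ in $L^\alpha(\mathbb R^N)$. The harmonizable fractional stable sheet (HFSS) with index $H$ is $$Z^H(t)=\mathrm{Re}\int_{\mathbb R^N}\prod_{l=1}^N\frac{e^{it_l\lambda_l}-1}{|\lambda_l|^{H_l+1/\alpha}}\,\widetilde M_\alpha(d\lambda),\qquad t\in\mathbb R^N.$$ Let $\psi$ be a Lemarié–Meyer mother wavelet: a real-valued Schwartz function on $\mathbb R$ whose Fourier transform $\widehat\psi(\xi)=(2\pi)^{-1/2}\int_{\mathbb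 R} e^{-is\xi}\psi(s)\,ds$ is supported in $\{\frac{2\pi}3\le|\xi|\le\frac{8\pi}3\}$ and for which the functions $2^{j/2}\psi(2^jx-k)$, $(j,k)\in\mathbb Z^2$, form an orthonormal basis of $L^2(\mathbb R)$. For $v\in(0,1)$ and $y\in\mathbb R$ put $$\psi^v(y)=\int_{\mathbb R}e^{iy\eta}\,\frac{\widehat\psi(\eta)}{|\eta|^{v+1/\alpha}}\,d\eta ,$$ and for $J=(j_1,\dots,j_N)$, $K=(k_1,\dots,k_N)\in\mathbb Z^N$ put $$\epsilon_{J,K}=\int_{\mathbb R^N}\overline{\prod_{l=1}^N 2^{-j_l/\alpha}e^{-ik_l2^{-j_l}\lambda_l}\,\widehat\psi(2^{-j_l}\lambda_l)}\;\widetilde M_\alpha(d\lambda).$$ Let $M>0$ and, for $n\in\mathbb N$, let $D^N_{n,M}$ be the set of all $(J,K)\in\mathbb Z^N\times\mathbb Z^N$ such that $|j_l|\le n$ and $|k_l|\le M2^{n+1}$ for $l=1,\dots,N$. Define, for $t\in\mathbb R^N$, $$U_n^*(t)=\mathrm{Re}\sum_{(J,K)\in D^N_{n,M}}2^{-\langle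 J,H\rangle}\,\epsilon_{J,K}\prod_{l=1}^N\big\{\psi^{H_l}(2^{j_l}t_l-k_l)-\psi^{H_l}(-k_l)\big\}.$$ Then: (i) with probability $1$, $(U_n^*)_{n\in\mathbb N}$ is a Cauchy sequence in the Hölder space $C^\gamma([-M,M]^N)$, with norm $\sup_t|f(t)|+\sup_{s\ne t}|f(s)-f(t)|/|s-t|^\gamma$, simultaneously for all $\gamma\in(0,\min\{H_1,\dots,H_N\})$; denote its limit by $U^*$; (ii) the random field $\{U^*(t)\}_{t\in[-M,M]^N}$ is a version of $\{Z^H(t)\}_{t\in[-M,M]^N}$, that is, $\mathbb P(U^*(t)=Z^H(t))=1$ for every $t\in[-M,M]^N$. -/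

import Mathlib

open MeasureTheory ProbabilityTheory Filter Topology
open scoped NNReal ENNReal

namespace HFSS

noncomputable section

/-- Euclidean space `ℝ^N`, with the Euclidean norm and Lebesgue measure `volume`. -/
abbrev E (N : ℕ) : Type := EuclideanSpace ℝ (Fin N)

section RandomMeasure

variable {N : ℕ} {Ω : Type*} [MeasurableSpace Ω]

/-- `M` is a complex-valued rotationally invariant `α`-stable random measure on `ℝ^N` with Lebesgue
control measure: a family of complex random variables indexed by the Borel sets of finite Lebesgue
measure (the values of `M` at other sets play no role) that is independently scattered and
`σ`-additive, where `M A` is an isotropic stable variable of scale `volume A ^ (1 / α)`.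
In `ae_tendsto_sum` the partial sums are taken in the given order, as the series need not converge
unconditionally at a given `ω`. -/
structure IsIsotropicStableMeasure (α : ℝ) (P : Measure Ω) (M : Set (E N) → Ω → ℂ) : Prop where
  measurable : ∀ A : Set (E N), MeasurableSet A → volume A < ∞ → Measurable (M A)
  indep : ∀ A : ℕ → Set (E N), (∀ i, MeasurableSet (A i)) → (∀ i, volume (A i) < ∞) →
    Pairwise (fun i j => Disjoint (A i) (A j)) → iIndepFun (fun i => M (A i)) P
  ae_tendsto_sum : ∀ A : ℕ → Set (E N), (∀ i, MeasurableSet (A i)) →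
    Pairwise (fun i j => Disjoint (A i) (A j)) → volume (⋃ i, A i) < ∞ →
    ∀ᵐ ω ∂P, Tendsto (fun n => ∑ i ∈ Finset.range n, M (A i) ω) atTop (𝓝 (M (⋃ i, A i) ω))
  charFun_eq : ∀ A : Set (E N), MeasurableSet A → volume A < ∞ → ∀ θ : ℂ,
    ∫ ω, Complex.exp (Complex.I * ((starRingEnd ℂ θ * M A ω).re : ℂ)) ∂P
      = (Real.exp (-(‖θ‖ ^ α * (volume A).toReal)) : ℂ)

/-- The stochastic integral of a simple function (the value `0` contributes nothing). -/
def simpleIntegral (M : Set (E N) → Ω → ℂ) (g : SimpleFunc (E N) ℂ) (ω : Ω) : ℂ :=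
  ∑ c ∈ g.range, c * M (g ⁻¹' {c}) ω

/-- The random variable `X` is (a version of) the stochastic integral `∫ f dM` of
`f ∈ L^α(ℝ^N)`: it is the limit in probability of the integrals of simple functions that
converge to `f` in `L^α(ℝ^N)`. -/
def IsStableIntegral (α : ℝ) (P : Measure Ω) (M : Set (E N) → Ω → ℂ) (f : E N → ℂ)
    (X : Ω → ℂ) : Prop :=
  MemLp f (ENNReal.ofReal α) volume ∧ Measurable X ∧
    ∃ g : ℕ → SimpleFunc (E N) ℂ,
      (∀ n, MemLp (g n) (ENNReal.ofReal α) volume) ∧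
      Tendsto (fun n => eLpNorm (fun x => g n x - f x) (ENNReal.ofReal α) volume) atTop (𝓝 0) ∧
      TendstoInMeasure P (fun n => simpleIntegral M (g n)) atTop X

open Classical in
/-- The stochastic integral `∫ f dM`, well defined up to almost sure equality. -/
def stableIntegral (α : ℝ) (P : Measure Ω) (M : Set (E N) → Ω → ℂ) (f : E N → ℂ) : Ω → ℂ :=
  if h : ∃ X, IsStableIntegral α P M f X then h.choose else 0

/-- The harmonizable fractional stable sheet
`Z^H(t) = Re ∫ ∏_l (exp(i t_l λ_l) - 1) / |λ_l|^(H_l + 1/α) M(dλ)`. -/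
def sheet (α : ℝ) (H : Fin N → ℝ) (P : Measure Ω) (M : Set (E N) → Ω → ℂ) (t : E N) (ω : Ω) : ℝ :=
  (stableIntegral α P M (fun x => ∏ l, (Complex.exp (Complex.I * (t l * x l : ℝ)) - 1) /
    ((|x l| ^ (H l + 1 / α) : ℝ) : ℂ)) ω).re

end RandomMeasure

section Wavelet

/-- The Fourier transform `(2π)^(-1/2) ∫ exp(-i s ξ) ψ(s) ds`. -/
def hat (ψ : SchwartzMap ℝ ℝ) (ξ : ℝ) : ℂ :=
  ((Real.sqrt (2 * Real.pi))⁻¹ : ℂ) * ∫ s : ℝ, Complex.exp (-(Complex.I * (s * ξ : ℝ))) * (ψ s : ℂ)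

/-- A Lemarié–Meyer mother wavelet: a real-valued Schwartz function whose Fourier transform is
supported in the ring `2π/3 ≤ |ξ| ≤ 8π/3` and whose dilated translates
`2^(j/2) ψ(2^j x - k)` form an orthonormal basis of `L²(ℝ)`. -/
structure IsLemarieMeyer (ψ : SchwartzMap ℝ ℝ) : Prop where
  support_hat : ∀ ξ : ℝ, hat ψ ξ ≠ 0 → 2 * Real.pi / 3 ≤ |ξ| ∧ |ξ| ≤ 8 * Real.pi / 3
  hilbertBasis : ∃ b : HilbertBasis (ℤ × ℤ) ℂ (Lp ℂ 2 (volume : Measure ℝ)),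
    ∀ j k : ℤ, (b (j, k) : ℝ → ℂ) =ᵐ[volume]
      fun x => (((2 : ℝ) ^ ((j : ℝ) / 2) * ψ ((2 : ℝ) ^ j * x - k) : ℝ) : ℂ)

/-- `ψ^v(y) = ∫ exp(i y η) ψ^(η) / |η|^(v + 1/α) dη`. -/
def fracPrim (α : ℝ) (ψ : SchwartzMap ℝ ℝ) (v y : ℝ) : ℂ :=
  ∫ η : ℝ, Complex.exp (Complex.I * (y * η : ℝ)) * (hat ψ η / ((|η| ^ (v + 1 / α) : ℝ) : ℂ))

/-- The Fourier transform of `ψ_{j,k}`, normalized in `L^α`: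
`2^(-j/α) exp(-i k 2^(-j) ξ) ψ^(2^(-j) ξ)`. -/
def hatNormalized (α : ℝ) (ψ : SchwartzMap ℝ ℝ) (j k : ℤ) (ξ : ℝ) : ℂ :=
  (((2 : ℝ) ^ (-((j : ℝ) / α)) : ℝ) : ℂ) *
    Complex.exp (-(Complex.I * ((k : ℝ) * (2 : ℝ) ^ (-j) * ξ : ℝ))) * hat ψ ((2 : ℝ) ^ (-j) * ξ)

variable {N : ℕ} {Ω : Type*} [MeasurableSpace Ω]

/-- The coefficient `ε_{J,K} = ∫ conj (∏_l ψ^_{α,j_l,k_l}(λ_l)) M(dλ)`. -/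
def coeff (α : ℝ) (ψ : SchwartzMap ℝ ℝ) (P : Measure Ω) (M : Set (E N) → Ω → ℂ)
    (J K : Fin N → ℤ) : Ω → ℂ :=
  stableIntegral α P M
    (fun x => starRingEnd ℂ (∏ l, hatNormalized α ψ (J l) (K l) (x l)))

/-- The set of all `(J, K)` with `|j_l| ≤ n` and `|k_l| ≤ R 2^(n+1)` for every `l`;
see `mem_indexSet`. -/
def indexSet (N n : ℕ) (R : ℝ) : Finset ((Fin N → ℤ) × (Fin N → ℤ)) :=
  Fintype.piFinset (fun _ => Finset.Icc (-(n : ℤ)) n) ×ˢ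
    Fintype.piFinset (fun _ => Finset.Icc (-⌊R * 2 ^ (n + 1)⌋) ⌊R * 2 ^ (n + 1)⌋)

theorem mem_indexSet (N n : ℕ) (R : ℝ) (p : (Fin N → ℤ) × (Fin N → ℤ)) :
    p ∈ indexSet N n R ↔ ∀ l, |p.1 l| ≤ n ∧ |(p.2 l : ℝ)| ≤ R * 2 ^ (n + 1) := by
  have h : ∀ (k : ℤ) (x : ℝ), (-⌊x⌋ ≤ k ∧ k ≤ ⌊x⌋) ↔ |(k : ℝ)| ≤ x := fun k x => by
    rw [← abs_le, Int.le_floor, Int.cast_abs]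
  simp only [indexSet, Finset.mem_product, Fintype.mem_piFinset, Finset.mem_Icc, h, ← abs_le,
    ← forall_and]

/-- The truncated random wavelet series `U*_n`. -/
def partialSeries (α : ℝ) (H : Fin N → ℝ) (ψ : SchwartzMap ℝ ℝ) (P : Measure Ω)
    (M : Set (E N) → Ω → ℂ) (R : ℝ) (n : ℕ) (t : E N) (ω : Ω) : ℝ :=
  (∑ p ∈ indexSet N n R, (((2 : ℝ) ^ (-(∑ l, (p.1 l : ℝ) * H l)) : ℝ) : ℂ) *
    coeff α ψ P M p.1 p.2 ω *
      ∏ l, (fracPrim α ψ (H l) ((2 : ℝ) ^ (p.1 l) * t l - p.2 l) -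
        fracPrim α ψ (H l) (-(p.2 l : ℝ)))).re

end Wavelet

/-- The cube `[-R, R]^N`. -/
def cube (N : ℕ) (R : ℝ) : Set (E N) := {t | ∀ l, |t l| ≤ R}

/-- The norm of the Hölder space `C^γ(S)`: the supremum of `|f|` on `S` plus the least `γ`-Hölder
constant of `f` on `S`; it is finite if and only if `f ∈ C^γ(S)`. -/
def holderNorm {N : ℕ} (γ : ℝ≥0) (S : Set (E N)) (f : E N → ℝ) : ℝ≥0∞ :=
  (⨆ t ∈ S, ‖f t‖ₑ) + eHolderNorm γ (fun t : S => f t)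

end

end HFSS

/-! The series is controlled pathwise, the sheet is reached in probability, and the two limits are
matched at each fixed `t`.

The stochastic side rests on tail bounds. If the characteristic function is exp(-a‖θ‖^α), then P(‖X‖
> u) ≤ 64 a u^(-α). Hence the integral of simple functions is continuous from L^α to convergence in
probability, which gives existence, linearity and continuity of the stochastic integral. For the
wavelet coefficients this tail alone is too weak: a union bound over the translates K would cost a
power of 2^m that u^(-α) cannot pay for. But all integrands with the same J live on one frequency
box. In `measureReal_exists_isStableIntegral_gt_le` the event that some cell of the random measure
exceeds a level τ does not depend on K and is paid for once. Off that event the integrals are sums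
of independent, bounded, symmetric variables with exponential tails, so the number of K costs
little. Borel-Cantelli then bounds the coefficients almost surely by C ∏ 2^(η|j_l|) (1 + |k_l|)^η
for any η > 0 (`ae_exists_coeff_bound`).

The analytic side uses that ψ^v is a Schwartz function, because the Fourier transform of ψ vanishes
near 0. Its increments at scale j carry a factor min(1, 2^j |x - y|). Against the prefactor 2^(-jH),
the scales j → +∞ converge because γ < H, and the scales j → -∞ because H < 1. With η small there is
still a summable majorant times |x - y|^γ, whose tail outside the index set vanishes uniformly
(`exists_majorant`). The index set is a product, so sums of products factor, and telescoping carries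
the estimate to N variables (`exists_waveSum_bounds`). This gives the Cauchy property and the Hölder
limit.

To identify the limit, the one-dimensional kernel is expanded in the Fourier transforms of the
wavelet basis. Plancherel produces exactly the coefficients of the series, once the kernel is cut to
a ring where it is square integrable; compact frequency supports make the cut invisible inside the
ring. The partial sums are dominated by a multiple of min(1,|ξ|) |ξ|^(-v-1/α), which lies in L^α
because 0 < v < 1. Dominated convergence and continuity of the integral show that the truncated
series tends to the sheet in probability (`limitField_ae_eq_sheet`). -/

namespace HFSS
noncomputable section

variable {N : ℕ} {Ω : Type*} [MeasurableSpace Ω] {α : ℝ} {P : Measure Ω}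
  {M : Set (E N) → Ω → ℂ}

/-! ### Isotropic stable random variables -/

/-- `X` is an isotropic complex `α`-stable random variable whose characteristic function is
`exp (-a ‖θ‖ ^ α)`. -/
def HasStableCharFun (α : ℝ) (P : Measure Ω) (X : Ω → ℂ) (a : ℝ) : Prop :=
  ∀ θ : ℂ, charFun (P.map X) θ = (Real.exp (-(‖θ‖ ^ α * a)) : ℂ)

/-- The tail at r is controlled by the mean of 1 - φ over |t| ≤ 2/r, and 1 - exp(-y) ≤ y turns this
into 2a(2/r)^α. The constant 8 comes from 2^α ≤ 4. -/
theorem HasStableCharFun.measureReal_inner_gt_le [IsProbabilityMeasure P] (hα0 : 0 < α)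
    (hα2 : α < 2) {X : Ω → ℂ} {a : ℝ} (ha : 0 ≤ a) (hX : Measurable X)
    (h : HasStableCharFun α P X a) (e : ℂ) (he : ‖e‖ = 1) {r : ℝ} (hr : 0 < r) :
    P.real {ω | r < |inner ℝ e (X ω)|} ≤ 8 * a * r ^ (-α) := by
  have : IsProbabilityMeasure (P.map X) := Measure.isProbabilityMeasure_map hX.aemeasurable
  have h1 := measureReal_abs_inner_gt_le_integral_charFun (μ := P.map X) (a := e) hr
  rw [map_measureReal_apply hX (measurableSet_lt measurable_const (by fun_prop))] at h1
  refine h1.trans ?_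
  have h2 : ‖∫ t in (-2 * r⁻¹)..(2 * r⁻¹), 1 - charFun (P.map X) (t • e)‖ ≤
      ((2 * r⁻¹) ^ α * a) * |2 * r⁻¹ - (-2 * r⁻¹)| := by
    refine intervalIntegral.norm_integral_le_of_norm_le_const fun t ht => ?_
    have hr' : 0 < r⁻¹ := inv_pos.2 hr
    rw [Set.uIoc_of_le (by linarith)] at ht
    have ht' : |t| ≤ 2 * r⁻¹ := abs_le.2 ⟨by linarith [ht.1], ht.2⟩
    rw [h, norm_smul, he, mul_one, Real.norm_eq_abs, ← Complex.ofReal_one, ← Complex.ofReal_sub,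
      Complex.norm_real, Real.norm_eq_abs]
    have h3 : 0 ≤ |t| ^ α * a := by positivity
    have h4 : |t| ^ α * a ≤ (2 * r⁻¹) ^ α * a := by gcongr
    rw [abs_of_nonneg (by linarith [Real.exp_le_one_iff.2 (neg_nonpos.2 h3)])]
    linarith [Real.add_one_le_exp (-(|t| ^ α * a))]
  have h3 : |2 * r⁻¹ - (-2 * r⁻¹)| = 4 * r⁻¹ := by
    rw [abs_of_pos (by have := inv_pos.2 hr; linarith)]; ring
  rw [h3] at h2
  have h5 : (2 * r⁻¹) ^ α ≤ 4 * r ^ (-α) := by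
    rw [Real.mul_rpow (by norm_num) (by positivity), Real.inv_rpow hr.le, Real.rpow_neg hr.le]
    gcongr
    calc (2 : ℝ) ^ α ≤ 2 ^ (2 : ℝ) := Real.rpow_le_rpow_of_exponent_le (by norm_num) hα2.le
      _ = 4 := by norm_num
  calc _ ≤ 2⁻¹ * r * (((2 * r⁻¹) ^ α * a) * (4 * r⁻¹)) := by gcongr
    _ = 2 * a * (2 * r⁻¹) ^ α := by field_simp; ring
    _ ≤ 2 * a * (4 * r ^ (-α)) := by gcongr
    _ = _ := by ring

/-- If ‖X‖ > u, then the real or the imaginary part exceeds u/2 in modulus. Two coordinates, the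
factor 8 and (u/2)^(-α) ≤ 4u^(-α) make 64. -/
theorem HasStableCharFun.measureReal_gt_le [IsProbabilityMeasure P] (hα0 : 0 < α)
    (hα2 : α < 2) {X : Ω → ℂ} {a : ℝ} (ha : 0 ≤ a) (hX : Measurable X)
    (h : HasStableCharFun α P X a) {u : ℝ} (hu : 0 < u) :
    P.real {ω | u < ‖X ω‖} ≤ 64 * a * u ^ (-α) := by
  have hsub : {ω | u < ‖X ω‖} ⊆ {ω | u / 2 < |inner ℝ (1 : ℂ) (X ω)|} ∪
      {ω | u / 2 < |inner ℝ Complex.I (X ω)|} := by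
    intro ω hω
    simp only [Set.mem_ofPred_eq, Set.mem_union] at hω ⊢
    by_contra! hc
    have h1 := Complex.norm_le_abs_re_add_abs_im (X ω)
    simp [Complex.inner] at hc
    linarith [hc.1, hc.2]
  have h5 : (u / 2) ^ (-α) ≤ 4 * u ^ (-α) := by
    rw [Real.div_rpow hu.le (by norm_num), Real.rpow_neg (by norm_num : (0:ℝ) ≤ 2), div_inv_eq_mul,
      mul_comm]
    gcongr
    calc (2 : ℝ) ^ α ≤ 2 ^ (2 : ℝ) := Real.rpow_le_rpow_of_exponent_le (by norm_num) hα2.le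
      _ = 4 := by norm_num
  calc _ ≤ _ := measureReal_mono hsub
    _ ≤ _ := measureReal_union_le _ _
    _ ≤ 8 * a * (u / 2) ^ (-α) + 8 * a * (u / 2) ^ (-α) :=
      add_le_add (h.measureReal_inner_gt_le hα0 hα2 ha hX _ (by simp) (by linarith))
        (h.measureReal_inner_gt_le hα0 hα2 ha hX _ (by simp) (by linarith))
    _ = 16 * a * (u / 2) ^ (-α) := by ring
    _ ≤ 16 * a * (4 * u ^ (-α)) := by gcongr
    _ = _ := by ring

theorem HasStableCharFun.ae_eq_zero [IsProbabilityMeasure P] (hα0 : 0 < α)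
    (hα2 : α < 2) {X : Ω → ℂ} (hX : Measurable X) (h : HasStableCharFun α P X 0) :
    ∀ᵐ ω ∂P, X ω = 0 := by
  have h1 : ∀ n : ℕ, ∀ᵐ ω ∂P, ‖X ω‖ ≤ 1 / ((n : ℝ) + 1) := fun n => by
    have := h.measureReal_gt_le hα0 hα2 le_rfl hX (u := 1 / ((n : ℝ) + 1)) (by positivity)
    rw [mul_zero, zero_mul] at this
    have h0 := (measureReal_eq_zero_iff).1 (le_antisymm this measureReal_nonneg)
    rw [ae_iff]
    simpa only [not_le] using h0
  filter_upwards [ae_all_iff.2 h1] with ω hω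
  refine norm_le_zero_iff.1 (le_of_forall_pos_le_add fun ε hε => ?_)
  obtain ⟨n, hn⟩ := exists_nat_one_div_lt hε
  linarith [hω n]

/-- The characteristic function depends on ‖θ‖ only. The symmetry is what centres the truncated
variables later on. -/
theorem HasStableCharFun.map_neg [IsProbabilityMeasure P] {X : Ω → ℂ} {a : ℝ}
    (hX : Measurable X) (h : HasStableCharFun α P X a) :
    P.map (fun ω => -X ω) = P.map X := by
  have : IsProbabilityMeasure (P.map X) := Measure.isProbabilityMeasure_map hX.aemeasurable
  have : IsProbabilityMeasure (P.map (fun ω => -X ω)) :=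
    Measure.isProbabilityMeasure_map hX.neg.aemeasurable
  refine Measure.ext_of_charFun (funext fun θ => ?_)
  have h1 : charFun (P.map (fun ω => -X ω)) θ = charFun (P.map X) (-θ) := by
    rw [charFun_apply, charFun_apply, integral_map (φ := fun ω => -X ω) hX.neg.aemeasurable (by fun_prop),
      integral_map hX.aemeasurable (by fun_prop)]
    simp
  rw [h1, h, h, norm_neg]

theorem HasStableCharFun.const_mul {X : Ω → ℂ} {a : ℝ} (hX : Measurable X)
    (h : HasStableCharFun α P X a) (c : ℂ) :
    HasStableCharFun α P (fun ω => c * X ω) (‖c‖ ^ α * a) := by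
  intro θ
  have h1 : charFun (P.map (fun ω => c * X ω)) θ = charFun (P.map X) (starRingEnd ℂ c * θ) := by
    rw [charFun_apply, charFun_apply, integral_map (hX.const_mul c).aemeasurable (by fun_prop),
      integral_map hX.aemeasurable (by fun_prop)]
    refine integral_congr_ae (Eventually.of_forall fun ω => ?_)
    simp only [Complex.inner, map_mul]
    rw [mul_comm (starRingEnd ℂ c), ← mul_assoc, mul_comm _ (starRingEnd ℂ c), ← mul_assoc]
  rw [h1, h, norm_mul, Complex.norm_conj, Real.mul_rpow (norm_nonneg _) (norm_nonneg _)]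
  congr 3
  ring

theorem HasStableCharFun.sum {ι : Type*} [Fintype ι] {X : ι → Ω → ℂ} {a : ι → ℝ}
    [IsProbabilityMeasure P]
    (hX : ∀ i, Measurable (X i)) (hi : iIndepFun X P) (h : ∀ i, HasStableCharFun α P (X i) (a i)) :
    HasStableCharFun α P (fun ω => ∑ i, X i ω) (∑ i, a i) := by
  intro θ
  rw [hi.charFun_map_fun_sum_eq_prod (fun i => (hX i).aemeasurable), Finset.prod_apply]
  simp_rw [fun i => h i θ]
  rw [Finset.mul_sum, ← Finset.sum_neg_distrib, Real.exp_sum, Complex.ofReal_prod]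

/-! ### Finite additivity and integrals of simple functions -/

theorem IsIsotropicStableMeasure.hasStableCharFun (hM : IsIsotropicStableMeasure α P M)
    {A : Set (E N)} (hA : MeasurableSet A) (hA' : volume A < ∞) :
    HasStableCharFun α P (M A) (volume A).toReal := by
  intro θ
  rw [charFun_apply, integral_map (hM.measurable A hA hA').aemeasurable (by fun_prop),
    ← hM.charFun_eq A hA hA' θ]
  refine integral_congr_ae (Eventually.of_forall fun ω => ?_)
  simp only [real_inner_comm]
  rw [mul_comm, Complex.inner, mul_comm (M A ω)]

/-- Independence is postulated for sequences of sets, so the finite family of fibres is enumerated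
and padded with empty sets. -/
theorem IsIsotropicStableMeasure.iIndepFun_fiber (hM : IsIsotropicStableMeasure α P M)
    {β : Type*} (g : SimpleFunc (E N) β) (s : Finset β)
    (hs : ∀ b ∈ s, volume (g ⁻¹' {b}) < ∞) :
    iIndepFun (fun b : s => M (g ⁻¹' {(b : β)})) P := by
  classical
  let e := s.equivFin
  let A : ℕ → Set (E N) := fun n =>
    if h : n < s.card then g ⁻¹' {((e.symm ⟨n, h⟩ : s) : β)} else ∅
  have hA := hM.indep A (fun i => by
      simp only [A]; split_ifs
      · exact g.measurableSet_fiber _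
      · exact MeasurableSet.empty)
    (fun i => by
      simp only [A]; split_ifs
      · exact hs _ (Subtype.coe_prop _)
      · simp)
    (fun i j hij => by
      simp only [A]
      split_ifs with h1 h2
      · refine Disjoint.preimage _ ?_
        rw [Set.disjoint_singleton]
        intro h
        have := e.symm.injective (Subtype.ext h)
        exact hij (by simpa using this)
      all_goals simp)
  have h := hA.precomp (g := fun b : s => ((e b : Fin _) : ℕ))
    (fun b b' h => e.injective (Fin.ext h))
  convert h using 2 with b
  simp [A]

theorem volume_fiber_lt_top (hα0 : 0 < α) {g : SimpleFunc (E N) ℂ}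
    (hg : MemLp g (ENNReal.ofReal α) volume) {c : ℂ} (hc : c ≠ 0) :
    volume (g ⁻¹' {c}) < ∞ :=
  SimpleFunc.measure_preimage_lt_top_of_memLp (by simpa) (by simp) g hg c hc

/-- On a fibre of infinite measure `M` is an arbitrary function; such a fibre may occur only with
coefficient 0, which kills it. -/
theorem measurable_simpleIntegral_sum (hM : IsIsotropicStableMeasure α P M) {β : Type*}
    (g : SimpleFunc (E N) β) (s : Finset β) (φ : β → ℂ)
    (hs : ∀ b ∈ s, φ b ≠ 0 → volume (g ⁻¹' {b}) < ∞) :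
    Measurable fun ω => ∑ b ∈ s, φ b * M (g ⁻¹' {b}) ω := by
  refine Finset.measurable_sum _ fun b hb => ?_
  rcases eq_or_ne (φ b) 0 with h | h
  · simp [h]
  · exact (hM.measurable _ (g.measurableSet_fiber b) (hs b hb h)).const_mul _

theorem measurable_simpleIntegral (hM : IsIsotropicStableMeasure α P M) (hα0 : 0 < α)
    {g : SimpleFunc (E N) ℂ} (hg : MemLp g (ENNReal.ofReal α) volume) :
    Measurable (simpleIntegral M g) :=
  measurable_simpleIntegral_sum hM g g.range id fun _ _ h => volume_fiber_lt_top hα0 hg h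

variable [IsProbabilityMeasure P]

theorem IsIsotropicStableMeasure.empty (hM : IsIsotropicStableMeasure α P M) (hα0 : 0 < α)
    (hα2 : α < 2) : ∀ᵐ ω ∂P, M ∅ ω = 0 := by
  have h := hM.hasStableCharFun (A := ∅) MeasurableSet.empty (by simp)
  simp only [measure_empty, ENNReal.toReal_zero] at h
  exact h.ae_eq_zero hα0 hα2 (hM.measurable ∅ MeasurableSet.empty (by simp))

/-- This is σ-additivity for the sequence A, B, ∅, ∅, …, whose partial sums are constant from index
2 on since `M ∅` vanishes almost surely. -/
theorem IsIsotropicStableMeasure.union (hM : IsIsotropicStableMeasure α P M) (hα0 : 0 < α)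
    (hα2 : α < 2) {A B : Set (E N)} (hA : MeasurableSet A) (hB : MeasurableSet B)
    (hA' : volume A < ∞) (hB' : volume B < ∞) (hAB : Disjoint A B) :
    ∀ᵐ ω ∂P, M (A ∪ B) ω = M A ω + M B ω := by
  let C : ℕ → Set (E N) := fun n => if n = 0 then A else if n = 1 then B else ∅
  have hU : (⋃ i, C i) = A ∪ B := by
    ext x
    simp only [Set.mem_iUnion, Set.mem_union, C]
    constructor
    · rintro ⟨i, hi⟩
      split_ifs at hi <;> simp_all
    · rintro (h | h)
      · exact ⟨0, by simpa⟩
      · exact ⟨1, by simpa⟩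
  have h := hM.ae_tendsto_sum C (fun i => by simp only [C]; split_ifs <;> simp [*])
    (fun i j hij => by
      simp only [C]
      split_ifs <;> simp_all [disjoint_comm]) (by
        rw [hU]; exact measure_union_lt_top hA' hB')
  rw [hU] at h
  filter_upwards [h, hM.empty hα0 hα2] with ω h1 h2
  refine tendsto_nhds_unique h1 (tendsto_const_nhds.congr' ?_)
  filter_upwards [eventually_ge_atTop 2] with n hn
  rw [← Finset.sum_subset (Finset.range_subset_range.2 hn)]
  · simp [Finset.sum_range_succ, C]
  · intro i _ hi
    have : i ≠ 0 ∧ i ≠ 1 := by simp at hi; omega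
    simp [C, this, h2]

theorem IsIsotropicStableMeasure.biUnion (hM : IsIsotropicStableMeasure α P M) (hα0 : 0 < α)
    (hα2 : α < 2) {ι : Type*} (s : Finset ι) (A : ι → Set (E N)) (hA : ∀ i ∈ s, MeasurableSet (A i))
    (hA' : ∀ i ∈ s, volume (A i) < ∞) (hd : (s : Set ι).PairwiseDisjoint A) :
    ∀ᵐ ω ∂P, M (⋃ i ∈ s, A i) ω = ∑ i ∈ s, M (A i) ω := by
  classical
  induction s using Finset.induction_on with
  | empty => simpa using hM.empty hα0 hα2
  | insert i s hi ih =>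
    have h1 := ih (fun j hj => hA j (Finset.mem_insert_of_mem hj))
      (fun j hj => hA' j (Finset.mem_insert_of_mem hj))
      (hd.subset (by simp))
    have h2 := hM.union hα0 hα2 (hA i (Finset.mem_insert_self _ _))
      (Finset.measurableSet_biUnion s fun j hj => hA j (Finset.mem_insert_of_mem hj))
      (hA' i (Finset.mem_insert_self _ _))
      ((measure_biUnion_lt_top s.finite_toSet fun j hj => hA' j (Finset.mem_insert_of_mem hj)))
      (by
        rw [Set.disjoint_iUnion₂_right]
        intro j hj
        exact hd (by simp) (by simp [hj]) (by rintro rfl; exact hi hj))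
    filter_upwards [h1, h2] with ω h1 h2
    rw [Finset.sum_insert hi, ← h1, ← h2, Finset.set_biUnion_insert]

/-- Fibres of `g` on which `φ` takes the same value are merged by finite additivity. This lets
several simple functions be integrated over one common partition. -/
theorem simpleIntegral_map (hM : IsIsotropicStableMeasure α P M) (hα0 : 0 < α)
    (hα2 : α < 2) {β : Type*} (g : SimpleFunc (E N) β) (φ : β → ℂ)
    (hg : ∀ b ∈ g.range, φ b ≠ 0 → volume (g ⁻¹' {b}) < ∞) :
    ∀ᵐ ω ∂P, simpleIntegral M (g.map φ) ω = ∑ b ∈ g.range, φ b * M (g ⁻¹' {b}) ω := by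
  classical
  have h1 : ∀ c ∈ (g.map φ).range, ∀ᵐ ω ∂P,
      c * M ((g.map φ) ⁻¹' {c}) ω = ∑ b ∈ g.range with φ b = c, φ b * M (g ⁻¹' {b}) ω := by
    intro c _
    rcases eq_or_ne c 0 with rfl | hc
    · refine Eventually.of_forall fun ω => ?_
      rw [zero_mul, Finset.sum_eq_zero]
      intro b hb
      rw [(Finset.mem_filter.1 hb).2, zero_mul]
    · have h := hM.biUnion hα0 hα2 {b ∈ g.range | φ b = c} (fun b => g ⁻¹' {b})
        (fun b _ => g.measurableSet_fiber b)
        (fun b hb => hg b (Finset.mem_filter.1 hb).1 (by rw [(Finset.mem_filter.1 hb).2]; exact hc))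
        (fun b _ b' _ hbb' => Disjoint.preimage _ (by simpa using hbb'))
      filter_upwards [h] with ω hω
      have h2 : (g.map φ) ⁻¹' {c} = ⋃ b ∈ ({b ∈ g.range | φ b = c} : Finset β), g ⁻¹' {b} := by
        rw [SimpleFunc.map_preimage_singleton]
        ext x
        simp
      rw [h2, hω, Finset.mul_sum]
      exact Finset.sum_congr rfl fun b hb => by rw [(Finset.mem_filter.1 hb).2]
  have h2 := (ae_ball_iff (μ := P) ((g.map φ).range.countable_toSet)).2 h1
  filter_upwards [h2] with ω hω
  rw [simpleIntegral, Finset.sum_congr rfl hω]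
  refine Finset.sum_fiberwise_of_maps_to (fun b hb => ?_) _
  rw [SimpleFunc.range_map]
  exact Finset.mem_image_of_mem _ hb

/-- The `α`-th power of the `L^α` norm of a simple function, as a finite sum. -/
def simpleScale (α : ℝ) (g : SimpleFunc (E N) ℂ) : ℝ :=
  ∑ c ∈ g.range with c ≠ 0, ‖c‖ ^ α * (volume (g ⁻¹' {c})).toReal

theorem ofReal_simpleScale (hα0 : 0 < α) {g : SimpleFunc (E N) ℂ}
    (hg : MemLp g (ENNReal.ofReal α) volume) :
    ENNReal.ofReal (simpleScale α g) = eLpNorm g (ENNReal.ofReal α) volume ^ α := by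
  have h0 : ENNReal.ofReal α ≠ 0 := by simpa
  rw [eLpNorm_eq_lintegral_rpow_enorm_toReal h0 (by simp), ENNReal.toReal_ofReal hα0.le,
    ← ENNReal.rpow_mul, one_div, inv_mul_cancel₀ hα0.ne', ENNReal.rpow_one]
  have h1 : ∀ x, ‖g x‖ₑ ^ α = (g.map fun c => ‖c‖ₑ ^ α) x := fun x => rfl
  simp_rw [h1]
  rw [SimpleFunc.lintegral_eq_lintegral, SimpleFunc.map_lintegral, simpleScale,
    ENNReal.ofReal_sum_of_nonneg (fun c _ => by positivity)]
  rw [Finset.sum_filter]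
  refine Finset.sum_congr rfl fun c _ => ?_
  split_ifs with hc
  · rw [ENNReal.ofReal_mul (by positivity), ENNReal.ofReal_toReal (volume_fiber_lt_top hα0 hg hc).ne,
      ← ENNReal.ofReal_rpow_of_nonneg (norm_nonneg _) hα0.le, ofReal_norm]
  · rw [not_not] at hc
    simp [hc, hα0]

/-- The integral is a sum of independent stable variables over the fibres of nonzero values. The
value 0 is left out because its fibre may have infinite measure. -/
theorem hasStableCharFun_simpleIntegral (hM : IsIsotropicStableMeasure α P M) (hα0 : 0 < α)
    {g : SimpleFunc (E N) ℂ} (hg : MemLp g (ENNReal.ofReal α) volume) :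
    HasStableCharFun α P (simpleIntegral M g) (simpleScale α g) := by
  classical
  set s : Finset ℂ := {c ∈ g.range | c ≠ 0}
  have hs : ∀ b ∈ s, volume (g ⁻¹' {b}) < ∞ := fun b hb =>
    volume_fiber_lt_top hα0 hg (Finset.mem_filter.1 hb).2
  have h1 := hM.iIndepFun_fiber g s hs
  have hm : ∀ b : s, Measurable (M (g ⁻¹' {(b : ℂ)})) := fun b =>
    hM.measurable _ (g.measurableSet_fiber _) (hs b b.2)
  have h2 := HasStableCharFun.sum (fun b => (hm b).const_mul (b : ℂ))
    (h1.comp (fun b : s => fun z => (b : ℂ) * z) (fun b => by fun_prop))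
    (fun b => (hM.hasStableCharFun (g.measurableSet_fiber _) (hs b b.2)).const_mul (hm b) (b : ℂ))
  convert h2 using 1
  · funext ω
    rw [simpleIntegral, Finset.sum_coe_sort s (fun b => b * M (g ⁻¹' {b}) ω), Finset.sum_filter]
    refine Finset.sum_congr rfl fun c _ => ?_
    split_ifs with h <;> simp_all
  · rw [simpleScale, Finset.sum_coe_sort s (fun b => ‖b‖ ^ α * (volume (g ⁻¹' {b})).toReal)]

theorem measure_simpleIntegral_gt_le (hM : IsIsotropicStableMeasure α P M) (hα0 : 0 < α)
    (hα2 : α < 2) {g : SimpleFunc (E N) ℂ} (hg : MemLp g (ENNReal.ofReal α) volume)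
    {u : ℝ} (hu : 0 < u) :
    P {ω | u < ‖simpleIntegral M g ω‖} ≤
      ENNReal.ofReal (64 * u ^ (-α)) * eLpNorm g (ENNReal.ofReal α) volume ^ α := by
  have h0 : 0 ≤ simpleScale α g := Finset.sum_nonneg fun c _ => by positivity
  have h := (hasStableCharFun_simpleIntegral hM hα0 hg).measureReal_gt_le hα0 hα2 h0
    (measurable_simpleIntegral hM hα0 hg) hu
  rw [← ofReal_simpleScale hα0 hg, ← ENNReal.ofReal_mul (by positivity),
    ← ENNReal.ofReal_toReal (measure_ne_top P _)]
  refine ENNReal.ofReal_le_ofReal (h.trans_eq (by ring))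

/-- All three integrals are computed on the fibres of the pair (g, h). A fibre over a nonzero pair
lies in a fibre of `g` or `h` over a nonzero value, hence has finite measure. -/
theorem simpleIntegral_linear (hM : IsIsotropicStableMeasure α P M) (hα0 : 0 < α)
    (hα2 : α < 2) {g h : SimpleFunc (E N) ℂ} (hg : MemLp g (ENNReal.ofReal α) volume)
    (hh : MemLp h (ENNReal.ofReal α) volume) (a b : ℂ) :
    ∀ᵐ ω ∂P, simpleIntegral M ((g.pair h).map fun z => a * z.1 + b * z.2) ω =
      a * simpleIntegral M g ω + b * simpleIntegral M h ω := by
  have hp : ∀ z : ℂ × ℂ, z ≠ 0 → volume ((g.pair h) ⁻¹' {z}) < ∞ := by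
    rintro ⟨z, w⟩ hz
    rw [SimpleFunc.pair_preimage_singleton]
    rcases eq_or_ne z 0 with h0 | h0
    · have hw : w ≠ 0 := fun hw => hz (by simp [h0, hw])
      exact (measure_mono Set.inter_subset_right).trans_lt (volume_fiber_lt_top hα0 hh hw)
    · exact (measure_mono Set.inter_subset_left).trans_lt (volume_fiber_lt_top hα0 hg h0)
  have key : ∀ φ : ℂ × ℂ → ℂ, φ 0 = 0 → ∀ᵐ ω ∂P, simpleIntegral M ((g.pair h).map φ) ω =
      ∑ z ∈ (g.pair h).range, φ z * M ((g.pair h) ⁻¹' {z}) ω := fun φ hφ =>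
    simpleIntegral_map hM hα0 hα2 (g.pair h) φ fun z _ hz => hp z fun h0 => hz (by rw [h0, hφ])
  have h1 := key Prod.fst rfl
  have h2 := key Prod.snd rfl
  rw [SimpleFunc.map_fst_pair] at h1
  rw [SimpleFunc.map_snd_pair] at h2
  filter_upwards [h1, h2, key (fun z => a * z.1 + b * z.2) (by simp)] with ω h1 h2 h3
  rw [h1, h2, h3, Finset.mul_sum, Finset.mul_sum, ← Finset.sum_add_distrib]
  exact Finset.sum_congr rfl fun z _ => by ring

end
end HFSS

namespace HFSS
noncomputable section

variable {N : ℕ} {Ω : Type*} [MeasurableSpace Ω] {α : ℝ} {P : Measure Ω}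
  {M : Set (E N) → Ω → ℂ}

/-! ### The stochastic integral -/

theorem tendstoInMeasure_linear {f g : ℕ → Ω → ℂ} {f' g' : Ω → ℂ}
    (hf : TendstoInMeasure P f atTop f') (hg : TendstoInMeasure P g atTop g') (a b : ℂ) :
    TendstoInMeasure P (fun n ω => a * f n ω + b * g n ω) atTop (fun ω => a * f' ω + b * g' ω) := by
  rw [tendstoInMeasure_iff_norm] at *
  intro ε hε
  -- The extra 1 keeps the denominator positive and makes (‖a‖ + ‖b‖)δ strictly smaller than ε.
  set δ := ε / (‖a‖ + ‖b‖ + 1)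
  have hδ : 0 < δ := by positivity
  have h0 := (hf δ hδ).add (hg δ hδ)
  rw [add_zero] at h0
  refine tendsto_of_tendsto_of_tendsto_of_le_of_le tendsto_const_nhds h0 (fun _ => zero_le)
    fun n => ?_
  refine (measure_mono fun ω hω => ?_).trans (measure_union_le _ _)
  by_contra hc
  simp only [Set.mem_union, Set.mem_ofPred_eq, not_or, not_le] at hc hω
  have h1 : a * f n ω + b * g n ω - (a * f' ω + b * g' ω) =
      a * (f n ω - f' ω) + b * (g n ω - g' ω) := by ring
  rw [h1] at hω
  have h2 : ‖a * (f n ω - f' ω) + b * (g n ω - g' ω)‖ ≤ ‖a‖ * δ + ‖b‖ * δ := by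
    refine (norm_add_le _ _).trans ?_
    rw [norm_mul, norm_mul]
    gcongr
    · exact hc.1.le
    · exact hc.2.le
  have h3 : (‖a‖ + ‖b‖ + 1) * δ = ε := by
    simp only [δ]; field_simp
  nlinarith

theorem IsStableIntegral.linear [IsProbabilityMeasure P] (hM : IsIsotropicStableMeasure α P M)
    (hα0 : 0 < α) (hα2 : α < 2) {f g : E N → ℂ} {X Y : Ω → ℂ} (hX : IsStableIntegral α P M f X)
    (hY : IsStableIntegral α P M g Y) (a b : ℂ) :
    IsStableIntegral α P M (fun x => a * f x + b * g x) (fun ω => a * X ω + b * Y ω) := by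
  obtain ⟨hf, hXm, u, hu, huf, huX⟩ := hX
  obtain ⟨hg, hYm, v, hv, hvg, hvY⟩ := hY
  refine ⟨(hf.const_mul a).add (hg.const_mul b), (hXm.const_mul a).add (hYm.const_mul b),
    fun n => ((u n).pair (v n)).map fun z : ℂ × ℂ => a * z.1 + b * z.2,
    fun n => ((hu n).const_mul a).add ((hv n).const_mul b), ?_, ?_⟩
  -- For α < 1 the L^α functional is only a quasi-norm; `LpAddConst` is the constant in its triangle
  -- inequality.
  · have h0 : Tendsto (fun n => ENNReal.LpAddConst (ENNReal.ofReal α) *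
        (‖a‖ₑ * eLpNorm (fun x => u n x - f x) (ENNReal.ofReal α) volume +
          ‖b‖ₑ * eLpNorm (fun x => v n x - g x) (ENNReal.ofReal α) volume)) atTop (𝓝 0) := by
      have h1 := (ENNReal.Tendsto.const_mul (a := ‖a‖ₑ) huf (Or.inr (by simp))).add
        (ENNReal.Tendsto.const_mul (a := ‖b‖ₑ) hvg (Or.inr (by simp)))
      have h2 := ENNReal.Tendsto.const_mul (a := ENNReal.LpAddConst (ENNReal.ofReal α)) h1
        (Or.inr (ENNReal.LpAddConst_lt_top _).ne)
      simpa using h2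
    refine tendsto_of_tendsto_of_tendsto_of_le_of_le tendsto_const_nhds h0 (fun _ => zero_le)
      fun n => ?_
    have h3 : (fun x => ((u n).pair (v n)).map (fun z => a * z.1 + b * z.2) x -
        (a * f x + b * g x)) = (fun x => a • (u n x - f x)) + fun x => b • (v n x - g x) := by
      funext x
      simp only [SimpleFunc.map_apply, SimpleFunc.pair_apply, Pi.add_apply, smul_eq_mul]
      ring
    simp only [h3]
    have hu' := (hu n).1.sub hf.1
    have hv' := (hv n).1.sub hg.1
    refine (eLpNorm_add_le' (hu'.const_smul a) (hv'.const_smul b) _).trans ?_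
    gcongr
    · exact eLpNorm_const_smul_le
    · exact eLpNorm_const_smul_le
  · refine (tendstoInMeasure_linear huX hvY a b).congr_left fun n => ?_
    filter_upwards [simpleIntegral_linear hM hα0 hα2 (hu n) (hv n) a b] with ω hω
    exact hω.symm

theorem measurable_stableIntegral (f : E N → ℂ) : Measurable (stableIntegral α P M f) := by
  rw [stableIntegral]
  split_ifs with h
  · exact h.choose_spec.2.1
  · exact measurable_const

variable [IsProbabilityMeasure P]

/-- The tail bound for simple functions passes to the limit: if ‖X‖ ≥ u, then either the
approximating integral exceeds u/3 or it is at distance at least u/3 from X, and the latter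
probability tends to 0. -/
theorem IsStableIntegral.measure_ge_le (hM : IsIsotropicStableMeasure α P M)
    (hα0 : 0 < α) (hα2 : α < 2) {f : E N → ℂ} {X : Ω → ℂ} (hX : IsStableIntegral α P M f X)
    {u : ℝ} (hu : 0 < u) :
    P {ω | u ≤ ‖X ω‖} ≤ ENNReal.ofReal (64 * (u / 3) ^ (-α)) *
      (ENNReal.LpAddConst (ENNReal.ofReal α) * eLpNorm f (ENNReal.ofReal α) volume) ^ α := by
  obtain ⟨hf, hXm, g, hg, hgf, hgX⟩ := hX
  have h0 : Tendsto (fun n => ENNReal.ofReal (64 * (u / 3) ^ (-α)) *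
      (ENNReal.LpAddConst (ENNReal.ofReal α) * (eLpNorm (fun x => g n x - f x) (ENNReal.ofReal α) volume +
        eLpNorm f (ENNReal.ofReal α) volume)) ^ α +
        P {ω | u / 3 ≤ ‖simpleIntegral M (g n) ω - X ω‖}) atTop
      (𝓝 (ENNReal.ofReal (64 * (u / 3) ^ (-α)) *
        (ENNReal.LpAddConst (ENNReal.ofReal α) * (0 + eLpNorm f (ENNReal.ofReal α) volume)) ^ α + 0)) := by
    refine Tendsto.add ?_ (tendstoInMeasure_iff_norm.1 hgX (u / 3) (by positivity))
    refine ENNReal.Tendsto.const_mul ?_ (Or.inr ENNReal.ofReal_ne_top)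
    refine (ENNReal.continuous_rpow_const.tendsto _).comp ?_
    exact ENNReal.Tendsto.const_mul (hgf.add tendsto_const_nhds)
      (Or.inr (ENNReal.LpAddConst_lt_top _).ne)
  rw [zero_add, add_zero] at h0
  refine ge_of_tendsto' h0 fun n => ?_
  have h1 : {ω | u ≤ ‖X ω‖} ⊆ {ω | u / 3 < ‖simpleIntegral M (g n) ω‖} ∪
      {ω | u / 3 ≤ ‖simpleIntegral M (g n) ω - X ω‖} := by
    intro ω hω
    by_contra hc
    simp only [Set.mem_union, Set.mem_ofPred_eq, not_or, not_le, not_lt] at hc hω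
    have := norm_sub_le (simpleIntegral M (g n) ω) (simpleIntegral M (g n) ω - X ω)
    rw [sub_sub_cancel] at this
    linarith [hc.1, hc.2]
  refine (measure_mono h1).trans ((measure_union_le _ _).trans ?_)
  gcongr
  refine (measure_simpleIntegral_gt_le hM hα0 hα2 (hg n) (by positivity)).trans ?_
  gcongr
  have h2 := eLpNorm_add_le' ((hg n).1.sub hf.1) hf.1 (ENNReal.ofReal α)
  rwa [sub_add_cancel] at h2

/-- By linearity the tail bound applies to the differences. In particular, the limit does not depend
on the approximating simple functions or on the chosen version of the integral. -/
theorem IsStableIntegral.tendstoInMeasure (hM : IsIsotropicStableMeasure α P M)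
    (hα0 : 0 < α) (hα2 : α < 2) {f : ℕ → E N → ℂ} {f' : E N → ℂ} {X : ℕ → Ω → ℂ} {X' : Ω → ℂ}
    (hX : ∀ n, IsStableIntegral α P M (f n) (X n)) (hX' : IsStableIntegral α P M f' X')
    (h : Tendsto (fun n => eLpNorm (fun x => f n x - f' x) (ENNReal.ofReal α) volume) atTop (𝓝 0)) :
    TendstoInMeasure P X atTop X' := by
  rw [tendstoInMeasure_iff_norm]
  intro ε hε
  have h0 : Tendsto (fun n => ENNReal.ofReal (64 * (ε / 3) ^ (-α)) *
      (ENNReal.LpAddConst (ENNReal.ofReal α) *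
        eLpNorm (fun x => f n x - f' x) (ENNReal.ofReal α) volume) ^ α) atTop
      (𝓝 (ENNReal.ofReal (64 * (ε / 3) ^ (-α)) *
        (ENNReal.LpAddConst (ENNReal.ofReal α) * 0) ^ α)) := by
    refine ENNReal.Tendsto.const_mul ?_ (Or.inr ENNReal.ofReal_ne_top)
    refine (ENNReal.continuous_rpow_const.tendsto _).comp ?_
    exact ENNReal.Tendsto.const_mul h (Or.inr (ENNReal.LpAddConst_lt_top _).ne)
  rw [mul_zero, ENNReal.zero_rpow_of_pos hα0, mul_zero] at h0
  refine tendsto_of_tendsto_of_tendsto_of_le_of_le tendsto_const_nhds h0 (fun _ => zero_le)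
    fun n => ?_
  have h1 := ((hX n).linear hM hα0 hα2 hX' 1 (-1)).measure_ge_le hM hα0 hα2 hε
  simpa [← sub_eq_add_neg] using h1

theorem exists_tendsto_of_eventually_norm_sub_le {z : ℕ → ℂ}
    (h : ∀ᶠ n in atTop, ‖z (n + 1) - z n‖ ≤ (1 / 2) ^ n) : ∃ w, Tendsto z atTop (𝓝 w) := by
  obtain ⟨n₀, hn₀⟩ := eventually_atTop.1 h
  have hc : CauchySeq fun n => z (n + n₀) := by
    refine cauchySeq_of_le_geometric (1 / 2) 1 (by norm_num) fun n => ?_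
    rw [dist_comm, dist_eq_norm, one_mul, show n + 1 + n₀ = n + n₀ + 1 by ring]
    exact (hn₀ (n + n₀) (by omega)).trans
      (pow_le_pow_of_le_one (by norm_num) (by norm_num) (by omega))
  obtain ⟨w, hw⟩ := cauchySeq_tendsto_of_complete hc
  exact ⟨w, (tendsto_add_atTop_iff_nat n₀).1 hw⟩

/-- Approximate f within 4^(-n) in L^α. Consecutive integrals differ by more than 2^(-n) with
probability O(2^(αn) 4^(-αn)) = O(2^(-αn)), which is summable, so Borel-Cantelli yields an almost
sure limit. -/
theorem exists_isStableIntegral (hM : IsIsotropicStableMeasure α P M)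
    (hα0 : 0 < α) (hα2 : α < 2) {f : E N → ℂ} (hf : MemLp f (ENNReal.ofReal α) volume) :
    ∃ X, IsStableIntegral α P M f X := by
  have h1 : ∀ n : ℕ, ∃ g : SimpleFunc (E N) ℂ,
      eLpNorm (f - ⇑g) (ENNReal.ofReal α) volume < ENNReal.ofReal ((1 / 4) ^ n) ∧
        MemLp g (ENNReal.ofReal α) volume := fun n =>
    hf.exists_simpleFunc_eLpNorm_sub_lt (by simp)
      (by rw [Ne, ENNReal.ofReal_eq_zero, not_le]; positivity)
  choose g hg1 hg2 using h1
  have hg1' : ∀ n, eLpNorm (fun x => g n x - f x) (ENNReal.ofReal α) volume <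
      ENNReal.ofReal ((1 / 4) ^ n) := fun n => by
    have := hg1 n
    rwa [eLpNorm_sub_comm] at this
  set K := ENNReal.LpAddConst (ENNReal.ofReal α)
  have hK : K ≠ ∞ := (ENNReal.LpAddConst_lt_top _).ne
  have hdiff : ∀ n, P {ω | (1 / 2) ^ n < ‖simpleIntegral M (g (n + 1)) ω -
      simpleIntegral M (g n) ω‖} ≤
      ENNReal.ofReal (64 * (2 * K.toReal) ^ α * ((2 : ℝ) ^ (-α)) ^ n) := by
    intro n
    have hmem : MemLp (((g (n + 1)).pair (g n)).map fun z => 1 * z.1 + (-1) * z.2)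
        (ENNReal.ofReal α) volume := ((hg2 (n + 1)).const_mul 1).add ((hg2 n).const_mul (-1))
    have h2 := measure_simpleIntegral_gt_le hM hα0 hα2 hmem (u := (1 / 2) ^ n) (by positivity)
    have h3 : P {ω | (1 / 2) ^ n < ‖simpleIntegral M (g (n + 1)) ω - simpleIntegral M (g n) ω‖} =
        P {ω | (1 / 2) ^ n < ‖simpleIntegral M
          (((g (n + 1)).pair (g n)).map fun z => 1 * z.1 + (-1) * z.2) ω‖} := by
      refine measure_congr ?_
      filter_upwards [simpleIntegral_linear hM hα0 hα2 (hg2 (n + 1)) (hg2 n) 1 (-1)] with ω hω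
      change (_ < _) = (_ < _)
      rw [hω, one_mul, neg_one_mul, sub_eq_add_neg]
    rw [h3]
    refine h2.trans ?_
    have h4 : (⇑(((g (n + 1)).pair (g n)).map fun z => 1 * z.1 + (-1) * z.2) : E N → ℂ) =
        (⇑(g (n + 1)) - f) + (f - ⇑(g n)) := by
      funext x
      simp [sub_eq_add_neg]
    have h5 : eLpNorm (⇑(((g (n + 1)).pair (g n)).map fun z => 1 * z.1 + (-1) * z.2))
        (ENNReal.ofReal α) volume ≤ ENNReal.ofReal (2 * K.toReal * (1 / 4) ^ n) := by
      rw [h4]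
      refine (eLpNorm_add_le' ((hg2 _).1.sub hf.1) (hf.1.sub (hg2 _).1) _).trans ?_
      rw [show 2 * K.toReal * (1 / 4) ^ n = K.toReal * ((1 / 4) ^ n + (1 / 4) ^ n) by ring,
        ENNReal.ofReal_mul (by positivity), ENNReal.ofReal_toReal hK,
        ENNReal.ofReal_add (by positivity) (by positivity)]
      gcongr
      · refine (hg1' (n + 1)).le.trans (ENNReal.ofReal_le_ofReal ?_)
        exact pow_le_pow_of_le_one (by norm_num) (by norm_num) (by omega)
      · exact (hg1 n).le
    calc _ ≤ ENNReal.ofReal (64 * ((1 / 2) ^ n) ^ (-α)) *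
          ENNReal.ofReal (2 * K.toReal * (1 / 4) ^ n) ^ α := by gcongr
      _ = _ := by
        rw [ENNReal.ofReal_rpow_of_nonneg (by positivity) hα0.le,
          ← ENNReal.ofReal_mul (by positivity)]
        congr 1
        rw [Real.mul_rpow (by positivity) (by positivity), ← Real.rpow_natCast,
          ← Real.rpow_natCast, ← Real.rpow_natCast, ← Real.rpow_mul (by norm_num),
          ← Real.rpow_mul (by norm_num), ← Real.rpow_mul (by norm_num),
          show (1 / 4 : ℝ) = 2 ^ (-2 : ℝ) by norm_num [Real.rpow_neg],
          show (1 / 2 : ℝ) = 2 ^ (-1 : ℝ) by norm_num [Real.rpow_neg],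
          ← Real.rpow_mul (by norm_num), ← Real.rpow_mul (by norm_num)]
        rw [mul_mul_mul_comm, mul_assoc, mul_assoc]
        congr 2
        rw [← Real.rpow_add (by norm_num)]
        congr 1
        ring
  have hsum : ∑' n, P {ω | (1 / 2) ^ n < ‖simpleIntegral M (g (n + 1)) ω -
      simpleIntegral M (g n) ω‖} ≠ ∞ := by
    have hs : Summable fun n : ℕ => 64 * (2 * K.toReal) ^ α * ((2 : ℝ) ^ (-α)) ^ n :=
      (summable_geometric_of_lt_one (by positivity)
        (Real.rpow_lt_one_of_one_lt_of_neg (by norm_num) (by linarith))).mul_left _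
    exact ne_top_of_le_ne_top hs.tsum_ofReal_ne_top (ENNReal.tsum_le_tsum hdiff)
  have hae : ∀ᵐ ω ∂P, ∃ w, Tendsto (fun n => simpleIntegral M (g n) ω) atTop (𝓝 w) := by
    filter_upwards [ae_eventually_notMem hsum] with ω hω
    exact exists_tendsto_of_eventually_norm_sub_le (hω.mono fun n hn => not_lt.1 hn)
  have hmeas : ∀ n, Measurable (simpleIntegral M (g n)) := fun n =>
    measurable_simpleIntegral hM hα0 (hg2 n)
  obtain ⟨X, hXm, hX⟩ := measurable_limit_of_tendsto_metrizable_ae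
    (fun n => (hmeas n).aemeasurable) hae
  refine ⟨X, hf, hXm, g, hg2, ?_, tendstoInMeasure_of_tendsto_ae
    (fun n => (hmeas n).aestronglyMeasurable) hX⟩
  have h0 : Tendsto (fun n : ℕ => ENNReal.ofReal ((1 / 4) ^ n)) atTop (𝓝 0) := by
    rw [← ENNReal.ofReal_zero]
    exact ENNReal.tendsto_ofReal
      (tendsto_pow_atTop_nhds_zero_of_lt_one (by norm_num) (by norm_num))
  exact tendsto_of_tendsto_of_tendsto_of_le_of_le tendsto_const_nhds h0 (fun _ => zero_le)
    fun n => (hg1' n).le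

theorem isStableIntegral_stableIntegral (hM : IsIsotropicStableMeasure α P M)
    (hα0 : 0 < α) (hα2 : α < 2) {f : E N → ℂ} (hf : MemLp f (ENNReal.ofReal α) volume) :
    IsStableIntegral α P M f (stableIntegral α P M f) := by
  have h := exists_isStableIntegral hM hα0 hα2 hf
  rw [stableIntegral, dif_pos h]
  exact h.choose_spec

theorem isStableIntegral_zero : IsStableIntegral α P M (fun _ => 0) (fun _ => 0) := by
  refine ⟨MemLp.zero, measurable_const, fun _ => 0, fun _ => MemLp.zero, by simp, ?_⟩
  refine tendstoInMeasure_of_tendsto_ae (fun n => ?_) (Eventually.of_forall fun ω => ?_)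
  · have : simpleIntegral M (0 : SimpleFunc (E N) ℂ) = fun _ => 0 := by
      funext ω
      refine Finset.sum_eq_zero fun c hc => ?_
      obtain ⟨x, rfl⟩ := SimpleFunc.mem_range.1 hc
      simp
    rw [this]
    exact aestronglyMeasurable_const
  · have : simpleIntegral M (0 : SimpleFunc (E N) ℂ) ω = 0 := by
      refine Finset.sum_eq_zero fun c hc => ?_
      obtain ⟨x, rfl⟩ := SimpleFunc.mem_range.1 hc
      simp
    simp only [this]
    exact tendsto_const_nhds

theorem IsStableIntegral.sum (hM : IsIsotropicStableMeasure α P M)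
    (hα0 : 0 < α) (hα2 : α < 2) {ι : Type*} (s : Finset ι) (c : ι → ℂ) {f : ι → E N → ℂ}
    {X : ι → Ω → ℂ} (h : ∀ i ∈ s, IsStableIntegral α P M (f i) (X i)) :
    IsStableIntegral α P M (fun x => ∑ i ∈ s, c i * f i x) (fun ω => ∑ i ∈ s, c i * X i ω) := by
  classical
  induction s using Finset.induction_on with
  | empty => simpa using isStableIntegral_zero
  | insert i s hi ih =>
    have h1 := (h i (Finset.mem_insert_self _ _)).linear hM hα0 hα2
      (ih fun j hj => h j (Finset.mem_insert_of_mem hj)) (c i) 1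
    simpa [Finset.sum_insert hi] using h1

end
end HFSS

namespace HFSS
noncomputable section

variable {N : ℕ} {Ω : Type*} [MeasurableSpace Ω] {α : ℝ} {P : Measure Ω}
  {M : Set (E N) → Ω → ℂ}

/-! ### A maximal inequality for bounded integrands -/

/-- Truncation at level `τ`. -/
def trunc (τ : ℝ) (z : ℂ) : ℂ := if ‖z‖ ≤ τ then z else 0

theorem norm_trunc_le {τ : ℝ} (hτ : 0 ≤ τ) (z : ℂ) : ‖trunc τ z‖ ≤ τ := by
  unfold trunc; split_ifs with h
  · exact h
  · simpa

theorem norm_trunc_le_norm (τ : ℝ) (z : ℂ) : ‖trunc τ z‖ ≤ ‖z‖ := by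
  unfold trunc; split_ifs with h <;> simp

theorem trunc_neg (τ : ℝ) (z : ℂ) : trunc τ (-z) = -trunc τ z := by
  unfold trunc; rw [norm_neg]; split_ifs <;> simp

theorem measurable_trunc (τ : ℝ) : Measurable (trunc τ) :=
  Measurable.ite (measurableSet_le measurable_norm measurable_const) measurable_id measurable_const

variable [IsProbabilityMeasure P]

/-- By the layer-cake formula the second moment is at most 2 ∫_0^τ 64 a t^(1-α) dt, which converges
at 0 because α < 2. -/
theorem integral_norm_trunc_sq_le (hα2 : α < 2) {X : Ω → ℂ} (hX : Measurable X)
    {a : ℝ} (ha : 0 ≤ a) (htail : ∀ u : ℝ, 0 < u → P.real {ω | u < ‖X ω‖} ≤ 64 * a * u ^ (-α))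
    {τ : ℝ} (hτ : 0 < τ) :
    ∫ ω, ‖trunc τ (X ω)‖ ^ 2 ∂P ≤ 128 / (2 - α) * a * τ ^ (2 - α) := by
  have hm : Measurable fun ω => ‖trunc τ (X ω)‖ := ((measurable_trunc τ).comp hX).norm
  have hα' : 0 < 2 - α := by linarith
  rw [integral_eq_lintegral_of_nonneg_ae (Eventually.of_forall fun ω => by positivity)
    (hm.pow_const 2).aestronglyMeasurable]
  refine ENNReal.toReal_le_of_le_ofReal (by positivity) ?_
  have h1 := lintegral_rpow_eq_lintegral_meas_lt_mul P (f := fun ω => ‖trunc τ (X ω)‖)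
    (Eventually.of_forall fun ω => norm_nonneg _) hm.aemeasurable (p := 2) (by norm_num)
  simp only [Real.rpow_two] at h1
  rw [h1]
  have hInt : IntegrableOn (fun t : ℝ => 64 * a * t ^ (1 - α)) (Set.Ioc 0 τ) := by
    rw [← intervalIntegrable_iff_integrableOn_Ioc_of_le hτ.le]
    exact (intervalIntegral.intervalIntegrable_rpow' (by linarith)).const_mul _
  have h2 : ∫⁻ t in Set.Ioi (0 : ℝ), P {ω | t < ‖trunc τ (X ω)‖} * ENNReal.ofReal (t ^ ((2:ℝ) - 1)) ≤
      ∫⁻ t in Set.Ioc (0 : ℝ) τ, ENNReal.ofReal (64 * a * t ^ (1 - α)) := by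
    rw [← lintegral_indicator measurableSet_Ioi, ← lintegral_indicator measurableSet_Ioc]
    refine lintegral_mono fun t => ?_
    by_cases ht0 : 0 < t
    · rw [Set.indicator_of_mem (Set.mem_Ioi.2 ht0)]
      by_cases htτ : t ≤ τ
      · rw [Set.indicator_of_mem (Set.mem_Ioc.2 ⟨ht0, htτ⟩)]
        have h3 : P {ω | t < ‖trunc τ (X ω)‖} ≤ ENNReal.ofReal (64 * a * t ^ (-α)) := by
          rw [← ENNReal.ofReal_toReal (measure_ne_top P _)]
          refine ENNReal.ofReal_le_ofReal (le_trans ?_ (htail t ht0))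
          exact measureReal_mono fun ω hω => lt_of_lt_of_le hω (norm_trunc_le_norm τ _)
        calc _ ≤ ENNReal.ofReal (64 * a * t ^ (-α)) * ENNReal.ofReal (t ^ ((2:ℝ) - 1)) := by gcongr
          _ = _ := by
            rw [← ENNReal.ofReal_mul (by positivity), mul_assoc, ← Real.rpow_add ht0]
            congr 3
            ring
      · have h3 : {ω | t < ‖trunc τ (X ω)‖} = ∅ := by
          ext ω
          simp only [Set.mem_ofPred_eq, Set.mem_empty_iff_false, iff_false, not_lt]
          exact (norm_trunc_le hτ.le _).trans (not_le.1 htτ).le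
        rw [h3]
        simp
    · rw [Set.indicator_of_notMem (by simpa using ht0)]
      exact zero_le
  refine (mul_le_mul_right h2 _).trans ?_
  rw [← ofReal_integral_eq_lintegral_ofReal hInt
    ((ae_restrict_iff' measurableSet_Ioc).2 (Eventually.of_forall fun t ht => by
      have := ht.1; positivity)), ← intervalIntegral.integral_of_le hτ.le,
      ← ENNReal.ofReal_mul (by norm_num)]
  refine ENNReal.ofReal_le_ofReal (le_of_eq ?_)
  rw [intervalIntegral.integral_const_mul, integral_rpow (Or.inl (by linarith)),
    show 1 - α + 1 = 2 - α by ring, Real.zero_rpow hα'.ne']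
  field_simp
  ring

/-- For |z| ≤ 1 one has exp z ≤ 1 + z + z². The linear term integrates to 0, and 1 + y ≤ exp y
finishes. -/
theorem integral_exp_le_exp_integral_sq {Z : Ω → ℝ} (hZ : Measurable Z) (hb : ∀ ω, |Z ω| ≤ 1)
    (h0 : ∫ ω, Z ω ∂P = 0) : ∫ ω, Real.exp (Z ω) ∂P ≤ Real.exp (∫ ω, Z ω ^ 2 ∂P) := by
  have hi : Integrable Z P := Integrable.of_bound hZ.aestronglyMeasurable 1
    (Eventually.of_forall hb)
  have hi2 : Integrable (fun ω => Z ω ^ 2) P := Integrable.of_bound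
    (hZ.pow_const 2).aestronglyMeasurable 1 (Eventually.of_forall fun ω => by
      rw [norm_pow]; exact pow_le_one₀ (norm_nonneg _) (hb ω))
  have hie : Integrable (fun ω => Real.exp (Z ω)) P := Integrable.of_bound
    hZ.exp.aestronglyMeasurable (Real.exp 1) (Eventually.of_forall fun ω => by
      rw [Real.norm_eq_abs, Real.abs_exp]; exact Real.exp_le_exp.2 (abs_le.1 (hb ω)).2)
  calc ∫ ω, Real.exp (Z ω) ∂P ≤ ∫ ω, (1 + Z ω + Z ω ^ 2) ∂P := by
        refine integral_mono hie (((integrable_const 1).add hi).add hi2) fun ω => ?_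
        have := (abs_le.1 (Real.abs_exp_sub_one_sub_id_le (hb ω))).2
        simp only
        linarith
    _ = 1 + ∫ ω, Z ω ^ 2 ∂P := by
        rw [integral_add (by exact (integrable_const 1).add hi) hi2,
          integral_add (integrable_const 1) hi, h0]
        simp
    _ ≤ _ := by rw [add_comm]; exact Real.add_one_le_exp _

theorem measureReal_sum_ge_le {ι : Type*} [Fintype ι] {Z : ι → Ω → ℝ} (hZ : ∀ i, Measurable (Z i))
    (hind : iIndepFun Z P) (hb : ∀ i ω, |Z i ω| ≤ 1) (h0 : ∀ i, ∫ ω, Z i ω ∂P = 0) (x : ℝ) :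
    P.real {ω | x ≤ ∑ i, Z i ω} ≤ Real.exp (-x + ∑ i, ∫ ω, Z i ω ^ 2 ∂P) := by
  have hm : Measurable fun ω => ∑ i, Z i ω := Finset.measurable_sum _ fun i _ => hZ i
  have hie : Integrable (fun ω => Real.exp (1 * (∑ i, Z i) ω)) P := by
    refine Integrable.of_bound ?_ (Real.exp (Fintype.card ι)) (Eventually.of_forall fun ω => ?_)
    · simp only [Finset.sum_apply, one_mul]
      exact hm.exp.aestronglyMeasurable
    · rw [Real.norm_eq_abs, Real.abs_exp, one_mul, Finset.sum_apply]
      refine Real.exp_le_exp.2 ((Finset.sum_le_sum fun i _ => (abs_le.1 (hb i ω)).2).trans ?_)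
      simp
  have h1 := measure_ge_le_exp_mul_mgf (μ := P) (X := ∑ i, Z i) x (t := 1) zero_le_one hie
  rw [hind.mgf_sum hZ] at h1
  simp only [Finset.sum_apply] at h1
  refine h1.trans ?_
  rw [Real.exp_add, Real.exp_sum, neg_one_mul]
  gcongr with i _
  · exact fun i _ => mgf_nonneg
  · simp only [mgf, one_mul]
    exact integral_exp_le_exp_integral_sq (hZ i) (hb i) (h0 i)

/-- If the norm exceeds x, then the real part of the sum rotated by one of 1, -1, i, -i is at least
x/2; hence the factor 4. Dividing by bτ makes the summands bounded by 1, symmetry makes them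
centred, and the Chernoff bound with parameter 1 applies. -/
theorem measureReal_norm_sum_trunc_gt_le (hα2 : α < 2) {ι : Type*} [Fintype ι]
    {X : ι → Ω → ℂ} (hX : ∀ i, Measurable (X i)) (hind : iIndepFun X P)
    (hsymm : ∀ i, P.map (fun ω => -X i ω) = P.map (X i)) {a : ι → ℝ} (ha : ∀ i, 0 ≤ a i)
    (htail : ∀ i, ∀ u : ℝ, 0 < u → P.real {ω | u < ‖X i ω‖} ≤ 64 * a i * u ^ (-α))
    {c : ι → ℂ} {b τ : ℝ} (hb : 0 < b) (hτ : 0 < τ) (hc : ∀ i, ‖c i‖ ≤ b) (x : ℝ) :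
    P.real {ω | x < ‖∑ i, c i * trunc τ (X i ω)‖} ≤
      4 * Real.exp (-(x / (2 * b * τ)) + 128 / (2 - α) * (∑ i, a i) * τ ^ (-α)) := by
  have hα' : 0 < 2 - α := by linarith
  have key : ∀ u : ℂ, ‖u‖ = 1 → P.real {ω | x / 2 ≤ (u * ∑ i, c i * trunc τ (X i ω)).re} ≤
      Real.exp (-(x / (2 * b * τ)) + 128 / (2 - α) * (∑ i, a i) * τ ^ (-α)) := by
    intro u hu
    have hφ : ∀ i, Measurable fun z : ℂ => (u * (c i * trunc τ z)).re / (b * τ) := fun i =>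
      (Complex.measurable_re.comp (((measurable_trunc τ).const_mul _).const_mul _)).div_const _
    have hφb : ∀ i z, |(u * (c i * trunc τ z)).re / (b * τ)| ≤ ‖trunc τ z‖ / τ := by
      intro i z
      rw [abs_div, abs_of_pos (mul_pos hb hτ)]
      calc _ ≤ ‖u * (c i * trunc τ z)‖ / (b * τ) := by gcongr; exact Complex.abs_re_le_norm _
        _ ≤ b * ‖trunc τ z‖ / (b * τ) := by
          rw [norm_mul, norm_mul, hu, one_mul]; gcongr; exact hc i
        _ = _ := by field_simp
    have h1 := measureReal_sum_ge_le (P := P)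
      (Z := fun i ω => (u * (c i * trunc τ (X i ω))).re / (b * τ)) (fun i => (hφ i).comp (hX i))
      (hind.comp _ hφ)
      (fun i ω => (hφb i _).trans (by
        rw [div_le_one hτ]; exact norm_trunc_le hτ.le _))
      (fun i => ?_) (x / (2 * b * τ))
    · refine le_trans (le_of_eq ?_) (h1.trans ?_)
      · congr 1
        ext ω
        simp only [Set.mem_ofPred_eq]
        rw [← Finset.sum_div, ← Complex.re_sum, ← Finset.mul_sum,
          show x / (2 * b * τ) = x / 2 / (b * τ) by field_simp,
          div_le_div_iff_of_pos_right (mul_pos hb hτ)]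
      · gcongr
        rw [Finset.mul_sum, Finset.sum_mul]
        refine Finset.sum_le_sum fun i _ => ?_
        have h2 := integral_norm_trunc_sq_le hα2 (hX i) (ha i) (htail i) hτ
        have hib : Integrable (fun ω => ‖trunc τ (X i ω)‖ ^ 2) P := by
          refine Integrable.of_bound
            (((measurable_trunc τ).comp (hX i)).norm.pow_const 2).aestronglyMeasurable (τ ^ 2)
            (Eventually.of_forall fun ω => ?_)
          rw [norm_pow, norm_norm]
          exact pow_le_pow_left₀ (norm_nonneg _) (norm_trunc_le hτ.le _) 2
        calc _ ≤ ∫ ω, ‖trunc τ (X i ω)‖ ^ 2 * (τ ^ 2)⁻¹ ∂P := by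
              refine integral_mono_of_nonneg (Eventually.of_forall fun ω => by positivity)
                (hib.mul_const _) (Eventually.of_forall fun ω => ?_)
              simp only
              rw [← div_eq_mul_inv, ← div_pow, ← sq_abs]
              exact pow_le_pow_left₀ (abs_nonneg _) (hφb i _) 2
          _ = (∫ ω, ‖trunc τ (X i ω)‖ ^ 2 ∂P) * (τ ^ 2)⁻¹ := integral_mul_const _ _
          _ ≤ (128 / (2 - α) * a i * τ ^ (2 - α)) * (τ ^ 2)⁻¹ := by gcongr
          _ = _ := by
            rw [mul_assoc]
            congr 1
            rw [← Real.rpow_two, ← Real.rpow_neg hτ.le, ← Real.rpow_add hτ]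
            congr 1
            ring
    · have h2 : ∫ ω, (u * (c i * trunc τ (X i ω))).re / (b * τ) ∂P =
          ∫ ω, (u * (c i * trunc τ (-X i ω))).re / (b * τ) ∂P := by
        rw [← integral_map (f := fun z => (u * (c i * trunc τ z)).re / (b * τ))
          (hX i).aemeasurable (hφ i).aestronglyMeasurable, ← hsymm i,
          integral_map (φ := fun ω => -X i ω) (hX i).neg.aemeasurable
            (hφ i).aestronglyMeasurable]
      have h3 : ∫ ω, (u * (c i * trunc τ (-X i ω))).re / (b * τ) ∂P =
          -∫ ω, (u * (c i * trunc τ (X i ω))).re / (b * τ) ∂P := by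
        rw [← integral_neg]
        refine integral_congr_ae (Eventually.of_forall fun ω => ?_)
        simp only [trunc_neg, mul_neg, Complex.neg_re, neg_div]
      linarith
  have hsub : {ω | x < ‖∑ i, c i * trunc τ (X i ω)‖} ⊆
      (({ω | x / 2 ≤ ((1 : ℂ) * ∑ i, c i * trunc τ (X i ω)).re} ∪
        {ω | x / 2 ≤ ((-1 : ℂ) * ∑ i, c i * trunc τ (X i ω)).re}) ∪
        {ω | x / 2 ≤ (Complex.I * ∑ i, c i * trunc τ (X i ω)).re}) ∪
        {ω | x / 2 ≤ ((-Complex.I) * ∑ i, c i * trunc τ (X i ω)).re} := by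
    intro ω hω
    by_contra hcon
    simp only [Set.mem_union, Set.mem_ofPred_eq, not_or, not_le] at hcon hω
    generalize (∑ i, c i * trunc τ (X i ω)) = z at hcon hω
    simp at hcon
    have h2 := Complex.norm_le_abs_re_add_abs_im z
    have h3 : |z.re| < x / 2 := abs_lt.2 ⟨by linarith [hcon.1.1.2], hcon.1.1.1⟩
    have h4 : |z.im| < x / 2 := abs_lt.2 ⟨by linarith [hcon.1.2], hcon.2⟩
    linarith
  refine (measureReal_mono hsub).trans ?_
  refine (measureReal_union_le _ _).trans ?_
  refine (add_le_add_left (measureReal_union_le _ _) _).trans ?_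
  refine (add_le_add_left (add_le_add_left (measureReal_union_le _ _) _) _).trans ?_
  linarith [key 1 (by simp), key (-1) (by simp), key Complex.I (by simp), key (-Complex.I) (by simp)]

/-- Unless some ‖X i‖ exceeds τ, truncation changes nothing. That event does not involve k, so only
the exponentially small term is multiplied by the number of k. -/
theorem measureReal_exists_norm_sum_gt_le (hα2 : α < 2) {ι κ : Type*} [Fintype ι] [Fintype κ]
    {X : ι → Ω → ℂ} (hX : ∀ i, Measurable (X i)) (hind : iIndepFun X P)
    (hsymm : ∀ i, P.map (fun ω => -X i ω) = P.map (X i)) {a : ι → ℝ} (ha : ∀ i, 0 ≤ a i)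
    (htail : ∀ i, ∀ u : ℝ, 0 < u → P.real {ω | u < ‖X i ω‖} ≤ 64 * a i * u ^ (-α))
    {c : κ → ι → ℂ} {b τ : ℝ} (hb : 0 < b) (hτ : 0 < τ) (hc : ∀ k i, ‖c k i‖ ≤ b) (x : ℝ) :
    P.real {ω | ∃ k, x < ‖∑ i, c k i * X i ω‖} ≤ 64 * (∑ i, a i) * τ ^ (-α) + Fintype.card κ *
      (4 * Real.exp (-(x / (2 * b * τ)) + 128 / (2 - α) * (∑ i, a i) * τ ^ (-α))) := by
  have hsub : {ω | ∃ k, x < ‖∑ i, c k i * X i ω‖} ⊆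
      (⋃ i, {ω | τ < ‖X i ω‖}) ∪ ⋃ k, {ω | x < ‖∑ i, c k i * trunc τ (X i ω)‖} := by
    rintro ω ⟨k, hk⟩
    by_cases h : ∃ i, τ < ‖X i ω‖
    · exact Or.inl (Set.mem_iUnion.2 h)
    · push Not at h
      refine Or.inr (Set.mem_iUnion.2 ⟨k, ?_⟩)
      simpa only [Set.mem_ofPred_eq, trunc, h, if_true] using hk
  refine (measureReal_mono hsub).trans ((measureReal_union_le _ _).trans (add_le_add ?_ ?_))
  · refine (measureReal_iUnion_fintype_le _).trans ?_
    rw [Finset.mul_sum, Finset.sum_mul]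
    exact Finset.sum_le_sum fun i _ => htail i τ hτ
  · refine (measureReal_iUnion_fintype_le _).trans ?_
    refine (Finset.sum_le_sum fun k _ => measureReal_norm_sum_trunc_gt_le hα2 hX hind hsymm ha htail
      hb hτ (hc k) x).trans ?_
    simp

/-- Finitely many simple functions, as one simple function. -/
def simplePi {κ : Type*} [Finite κ] (g : κ → SimpleFunc (E N) ℂ) : SimpleFunc (E N) (κ → ℂ) where
  toFun x k := g k x
  measurableSet_fiber' v := by
    have : (fun x k => g k x) ⁻¹' {v} = ⋂ k, g k ⁻¹' {v k} := by
      ext x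
      simp [funext_iff]
    rw [this]
    exact MeasurableSet.iInter fun k => (g k).measurableSet_fiber _
  finite_range' := by
    refine (Set.Finite.pi' fun k => (g k).finite_range).subset ?_
    rintro _ ⟨x, rfl⟩ k
    exact ⟨x, rfl⟩

/-- All integrals are linear combinations of the same independent variables, the measures of the
fibres of the joint simple function. Fibres over nonzero vectors are disjoint and lie in S, so the
scales add up to at most the volume of S. -/
theorem measureReal_exists_simpleIntegral_gt_le (hM : IsIsotropicStableMeasure α P M)
    (hα0 : 0 < α) (hα2 : α < 2) {κ : Type*} [Fintype κ] {g : κ → SimpleFunc (E N) ℂ}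
    {b τ : ℝ} (hb : 0 < b) (hτ : 0 < τ) (hgb : ∀ k x, ‖g k x‖ ≤ b) {S : Set (E N)}
    (hS : volume S < ∞) (hgS : ∀ k, ∀ x ∉ S, g k x = 0) (x : ℝ) :
    P.real {ω | ∃ k, x < ‖simpleIntegral M (g k) ω‖} ≤
      64 * (volume S).toReal * τ ^ (-α) + Fintype.card κ *
      (4 * Real.exp (-(x / (2 * b * τ)) + 128 / (2 - α) * (volume S).toReal * τ ^ (-α))) := by
  classical
  have hα' : 0 < 2 - α := by linarith
  set G := simplePi g
  set s : Finset (κ → ℂ) := {v ∈ G.range | v ≠ 0}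
  have hsubS : ∀ v : κ → ℂ, v ≠ 0 → G ⁻¹' {v} ⊆ S := by
    intro v hv y hy
    by_contra hyS
    refine hv ?_
    rw [← (hy : G y = v)]
    funext k
    exact hgS k y hyS
  have hfin : ∀ v : κ → ℂ, v ≠ 0 → volume (G ⁻¹' {v}) < ∞ := fun v hv =>
    (measure_mono (hsubS v hv)).trans_lt hS
  have hs : ∀ v ∈ s, volume (G ⁻¹' {v}) < ∞ := fun v hv => hfin v (Finset.mem_filter.1 hv).2
  have hm : ∀ v : s, Measurable (M (G ⁻¹' {(v : κ → ℂ)})) := fun v =>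
    hM.measurable _ (G.measurableSet_fiber _) (hs v v.2)
  have hchar : ∀ v : s, HasStableCharFun α P (M (G ⁻¹' {(v : κ → ℂ)}))
      (volume (G ⁻¹' {(v : κ → ℂ)})).toReal := fun v =>
    hM.hasStableCharFun (G.measurableSet_fiber _) (hs v v.2)
  have h1 := measureReal_exists_norm_sum_gt_le hα2 (P := P) (κ := κ) hm (hM.iIndepFun_fiber G s hs)
    (fun v => (hchar v).map_neg (hm v)) (fun v => ENNReal.toReal_nonneg)
    (fun v u hu => (hchar v).measureReal_gt_le hα0 hα2 ENNReal.toReal_nonneg (hm v) hu)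
    (c := fun k v => (v : κ → ℂ) k) hb hτ (fun k v => by
      obtain ⟨y, hy⟩ := SimpleFunc.mem_range.1 (Finset.mem_filter.1 v.2).1
      rw [← hy]
      exact hgb k y) x
  have hV : ∑ v : s, (volume (G ⁻¹' {(v : κ → ℂ)})).toReal ≤ (volume S).toReal := by
    rw [Finset.sum_coe_sort s (fun v => (volume (G ⁻¹' {v})).toReal),
      ← ENNReal.toReal_sum (fun v hv => (hs v hv).ne)]
    refine ENNReal.toReal_mono hS.ne ?_
    rw [← measure_biUnion_finset (fun v _ w _ hvw => Disjoint.preimage _ (by simpa using hvw))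
      (fun v _ => G.measurableSet_fiber v)]
    exact measure_mono (Set.iUnion₂_subset fun v hv => hsubS v (Finset.mem_filter.1 hv).2)
  have hV0 : 0 ≤ ∑ v : s, (volume (G ⁻¹' {(v : κ → ℂ)})).toReal :=
    Finset.sum_nonneg fun v _ => ENNReal.toReal_nonneg
  have hI : ∀ k, ∀ᵐ ω ∂P, simpleIntegral M (g k) ω =
      ∑ v : s, (v : κ → ℂ) k * M (G ⁻¹' {(v : κ → ℂ)}) ω := by
    intro k
    have h2 := simpleIntegral_map hM hα0 hα2 G (fun v => v k) fun v _ hv =>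
      hfin v (by rintro rfl; exact hv rfl)
    filter_upwards [h2] with ω hω
    have h3 : G.map (fun v => v k) = g k := SimpleFunc.ext fun y => rfl
    rw [h3] at hω
    rw [hω, Finset.sum_coe_sort s (fun v => v k * M (G ⁻¹' {v}) ω), Finset.sum_filter]
    refine Finset.sum_congr rfl fun v _ => ?_
    split_ifs with h <;> simp_all
  refine le_trans (le_of_eq ?_) (h1.trans ?_)
  · refine measureReal_congr ?_
    filter_upwards [ae_all_iff.2 hI] with ω hω
    change (∃ k, _) = (∃ k, _)
    simp only [hω]
  · gcongr

theorem measureReal_exists_isStableIntegral_gt_le (hM : IsIsotropicStableMeasure α P M)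
    (hα0 : 0 < α) (hα2 : α < 2) {κ : Type*} [Fintype κ] {f : κ → E N → ℂ} {X : κ → Ω → ℂ}
    (hf : ∀ k, Measurable (f k)) (hX : ∀ k, IsStableIntegral α P M (f k) (X k))
    {b τ : ℝ} (hb : 0 < b) (hτ : 0 < τ) (hfb : ∀ k x, ‖f k x‖ ≤ b) {S : Set (E N)}
    (hS : volume S < ∞) (hfS : ∀ k, ∀ x ∉ S, f k x = 0) {x : ℝ} (hx : 0 < x) :
    P.real {ω | ∃ k, x < ‖X k ω‖} ≤
      64 * (volume S).toReal * τ ^ (-α) + Fintype.card κ *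
      (4 * Real.exp (-(x / (8 * b * τ)) + 128 / (2 - α) * (volume S).toReal * τ ^ (-α))) := by
  let g : κ → ℕ → SimpleFunc (E N) ℂ := fun k n =>
    SimpleFunc.approxOn (f k) (hf k) Set.univ 0 (Set.mem_univ _) n
  have hg : ∀ k n y, ‖g k n y‖ ≤ ‖f k y‖ + ‖f k y‖ := fun k n y =>
    SimpleFunc.norm_approxOn_zero_le (hf k) (Set.mem_univ _) y n
  have hgmem : ∀ k n, MemLp (g k n) (ENNReal.ofReal α) volume := fun k n =>
    SimpleFunc.memLp_approxOn (hf k) (hX k).1 (Set.mem_univ _) MemLp.zero n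
  have hlim : ∀ k, Tendsto (fun n => eLpNorm (fun y => g k n y - f k y) (ENNReal.ofReal α) volume)
      atTop (𝓝 0) := fun k => by
    have h := SimpleFunc.tendsto_approxOn_Lp_eLpNorm (hf k) (Set.mem_univ (0 : ℂ))
      (p := ENNReal.ofReal α) (by simp) (μ := volume) (Eventually.of_forall fun y => by simp)
      (by simpa using (hX k).1.2)
    exact h
  have hgint : ∀ k n, IsStableIntegral α P M (g k n) (simpleIntegral M (g k n)) := fun k n =>
    ⟨hgmem k n, measurable_simpleIntegral hM hα0 (hgmem k n), fun _ => g k n, fun _ => hgmem k n,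
      by simp, tendstoInMeasure_of_tendsto_ae
        (fun _ => (measurable_simpleIntegral hM hα0 (hgmem k n)).aestronglyMeasurable)
        (Eventually.of_forall fun ω => tendsto_const_nhds)⟩
  have hmeas : ∀ k, TendstoInMeasure P (fun n => simpleIntegral M (g k n)) atTop (X k) := fun k =>
    IsStableIntegral.tendstoInMeasure hM hα0 hα2 (hgint k) (hX k) (hlim k)
  have h0 : Tendsto (fun n => (64 * (volume S).toReal * τ ^ (-α) + Fintype.card κ *
      (4 * Real.exp (-(x / (8 * b * τ)) + 128 / (2 - α) * (volume S).toReal * τ ^ (-α)))) +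
      ∑ k, P.real {ω | x / 2 ≤ ‖simpleIntegral M (g k n) ω - X k ω‖}) atTop
      (𝓝 ((64 * (volume S).toReal * τ ^ (-α) + Fintype.card κ *
      (4 * Real.exp (-(x / (8 * b * τ)) + 128 / (2 - α) * (volume S).toReal * τ ^ (-α)))) +
      ∑ k : κ, 0)) :=
    tendsto_const_nhds.add (tendsto_finsetSum _ fun k _ =>
      tendstoInMeasure_iff_measureReal_norm.1 (hmeas k) (x / 2) (by positivity))
  rw [Finset.sum_const_zero, add_zero] at h0
  refine ge_of_tendsto' h0 fun n => ?_
  have hsub : {ω | ∃ k, x < ‖X k ω‖} ⊆ {ω | ∃ k, x / 2 < ‖simpleIntegral M (g k n) ω‖} ∪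
      ⋃ k, {ω | x / 2 ≤ ‖simpleIntegral M (g k n) ω - X k ω‖} := by
    rintro ω ⟨k, hk⟩
    by_contra hc
    simp only [Set.mem_union, Set.mem_iUnion, Set.mem_ofPred_eq, not_or, not_exists, not_le,
      not_lt] at hc
    have := norm_sub_le (simpleIntegral M (g k n) ω) (simpleIntegral M (g k n) ω - X k ω)
    rw [sub_sub_cancel] at this
    linarith [hc.1 k, hc.2 k]
  refine (measureReal_mono hsub).trans ((measureReal_union_le _ _).trans (add_le_add ?_ ?_))
  · have h1 := measureReal_exists_simpleIntegral_gt_le hM hα0 hα2 (g := fun k => g k n)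
      (b := 2 * b) (by positivity) hτ
      (fun k y => (hg k n y).trans (by linarith [hfb k y])) hS
      (fun k y hy => by
        have := hg k n y
        rw [hfS k y hy] at this
        simpa using this) (x / 2)
    -- The 8 replaces 2 because the approximating simple functions are bounded by 2b only, and half
    -- of x is spent on the approximation error.
    rwa [show x / 2 / (2 * (2 * b) * τ) = x / (8 * b * τ) by field_simp; norm_num] at h1
  · exact measureReal_iUnion_fintype_le _

end
end HFSS

namespace HFSS
noncomputable section

variable {N : ℕ} {Ω : Type*} [MeasurableSpace Ω] {α : ℝ} {P : Measure Ω}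
  {M : Set (E N) → Ω → ℂ}

/-! ### Almost sure growth of a family of random variables -/

theorem exp_neg_le_pow (p : ℕ) {y : ℝ} (hy : 0 < y) : Real.exp (-y) ≤ p.factorial * (y ^ p)⁻¹ := by
  have h := Real.pow_div_factorial_le_exp y hy.le p
  rw [Real.exp_neg, ← div_eq_mul_inv, inv_le_comm₀ (Real.exp_pos _) (by positivity), inv_div]
  exact h

/-- The integer points of `[-q, q]^N`. -/
def intBox (N q : ℕ) : Finset (Fin N → ℤ) := Fintype.piFinset fun _ => Finset.Icc (-(q : ℤ)) q

theorem mem_intBox {q : ℕ} {K : Fin N → ℤ} : K ∈ intBox N q ↔ ∀ l, (K l).natAbs ≤ q := by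
  simp only [intBox, Fintype.mem_piFinset, Finset.mem_Icc]
  exact forall_congr' fun l => by omega

theorem card_intBox (q : ℕ) : (intBox N q).card = (2 * q + 1) ^ N := by
  simp only [intBox, Fintype.card_piFinset, Int.card_Icc, Finset.prod_const, Finset.card_univ,
    Fintype.card_fin]
  congr 1
  omega

/-- These are the Borel-Cantelli probabilities for |J| ≤ m, |K| ≤ 2^m, level 2^(ηm) and truncation
2^(ηm/2). The power term is geometric in m, and exp(-2^(ηm/2)/8) beats the number of K; the number
of J is only polynomial in m. -/
theorem summable_growth_bound (hα0 : 0 < α) (N : ℕ) {η : ℝ} (hη : 0 < η) (A : ℝ) :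
    Summable fun m : ℕ => (2 * (m : ℝ) + 1) ^ N * (A * (((2 : ℝ) ^ (η / 2 * m)) ^ (-α) +
      (2 * 2 ^ m + 1) ^ N * Real.exp (-((2 : ℝ) ^ (η * m) / (8 * (2 : ℝ) ^ (η / 2 * m)))))) := by
  -- With this p, the bound exp(-y) ≤ p! y^(-p) gives a factor 2^(-(N+1)m): N powers cancel the
  -- count of K, and one is left for summation.
  obtain ⟨p, hp⟩ := exists_nat_ge ((N + 1) / (η / 2))
  have hp' : (N : ℝ) + 1 ≤ η / 2 * p := by
    rw [div_le_iff₀ (by positivity)] at hp; linarith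
  set r : ℝ := max ((2 : ℝ) ^ (-(η / 2 * α))) (1 / 2)
  have hr0 : 0 < r := lt_max_of_lt_right (by norm_num)
  have hr1 : r < 1 := max_lt
    (Real.rpow_lt_one_of_one_lt_of_neg (by norm_num) (by nlinarith)) (by norm_num)
  set C : ℝ := 3 ^ N * (p.factorial * 8 ^ p)
  have hC : 0 ≤ C := by positivity
  have hs : Summable fun m : ℕ => 2 ^ N * (|A| * (1 + C) * r⁻¹) *
      (((m + 1 : ℕ) : ℝ) ^ N * r ^ (m + 1)) := by
    refine Summable.mul_left _ ?_
    have h0 : Summable fun m : ℕ => (m : ℝ) ^ N * r ^ m :=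
      summable_pow_mul_geometric_of_norm_lt_one N (by rwa [Real.norm_eq_abs, abs_of_pos hr0])
    exact (summable_nat_add_iff (f := fun m : ℕ => (m : ℝ) ^ N * r ^ m) 1).2 h0
  refine Summable.of_norm_bounded hs fun m => ?_
  have h1 : ((2 : ℝ) ^ (η / 2 * m)) ^ (-α) ≤ r ^ m := by
    rw [← Real.rpow_mul (by norm_num), show η / 2 * m * -α = -(η / 2 * α) * m by ring,
      Real.rpow_mul (by norm_num), Real.rpow_natCast]
    exact pow_le_pow_left₀ (by positivity) (le_max_left _ _) m
  have h2 : (2 * 2 ^ m + 1 : ℝ) ^ N ≤ 3 ^ N * 2 ^ (m * N) := by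
    rw [pow_mul, ← mul_pow]
    gcongr
    have : (1 : ℝ) ≤ 2 ^ m := one_le_pow₀ (by norm_num)
    linarith
  have h3 : Real.exp (-((2 : ℝ) ^ (η * m) / (8 * (2 : ℝ) ^ (η / 2 * m)))) ≤
      p.factorial * 8 ^ p * (2 ^ ((N + 1) * m))⁻¹ := by
    have h4 : (2 : ℝ) ^ (η * m) / (8 * (2 : ℝ) ^ (η / 2 * m)) = 2 ^ (η / 2 * m) / 8 := by
      rw [show η * m = η / 2 * m + η / 2 * m by ring, Real.rpow_add (by norm_num)]
      field_simp
    rw [h4]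
    refine (exp_neg_le_pow p (by positivity)).trans ?_
    rw [div_pow, inv_div, mul_assoc, div_eq_mul_inv]
    gcongr
    rw [← Real.rpow_natCast, ← Real.rpow_natCast, ← Real.rpow_mul (by norm_num)]
    refine Real.rpow_le_rpow_of_exponent_le (by norm_num) ?_
    push_cast
    calc ((N : ℝ) + 1) * m ≤ η / 2 * p * m := by gcongr
      _ = _ := by ring
  have h5 : (2 * 2 ^ m + 1 : ℝ) ^ N *
      Real.exp (-((2 : ℝ) ^ (η * m) / (8 * (2 : ℝ) ^ (η / 2 * m)))) ≤ C * r ^ m := by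
    calc _ ≤ ((3 : ℝ) ^ N * 2 ^ (m * N)) * (p.factorial * 8 ^ p * (2 ^ ((N + 1) * m))⁻¹) := by gcongr
      _ = C * (1 / 2) ^ m := by
        simp only [C]
        rw [add_mul, one_mul, pow_add, mul_comm m N, one_div, inv_pow]
        field_simp
      _ ≤ C * r ^ m := by gcongr; exact le_max_right _ _
  have h6 : (2 * (m : ℝ) + 1) ^ N ≤ 2 ^ N * ((m + 1 : ℕ) : ℝ) ^ N := by
    rw [← mul_pow]
    gcongr
    push_cast
    linarith
  rw [norm_mul, norm_mul, Real.norm_eq_abs A]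
  rw [Real.norm_of_nonneg (by positivity), Real.norm_of_nonneg (by positivity)]
  calc _ ≤ (2 ^ N * ((m + 1 : ℕ) : ℝ) ^ N) * (|A| * (r ^ m + C * r ^ m)) := by gcongr
    _ = _ := by
      rw [pow_succ r m]
      field_simp

theorem ae_exists_bound_of_tail [IsProbabilityMeasure P] (hα0 : 0 < α)
    {Y : (Fin N → ℤ) → (Fin N → ℤ) → Ω → ℂ} {A : ℝ}
    (hY : ∀ (J : Fin N → ℤ) (F : Finset (Fin N → ℤ)) (τ x : ℝ), 1 ≤ τ → 0 < x →
      P.real {ω | ∃ K ∈ F, x < ‖Y J K ω‖} ≤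
        A * (τ ^ (-α) + F.card * Real.exp (-(x / (8 * τ))))) {η : ℝ} (hη : 0 < η) :
    ∀ᵐ ω ∂P, ∃ C : ℝ, 0 ≤ C ∧ ∀ J K, ‖Y J K ω‖ ≤
      C * ∏ l, ((2 : ℝ) ^ (η * |(J l : ℝ)|) * (1 + |(K l : ℝ)|) ^ η) := by
  set B : ℕ → Set Ω := fun m => ⋃ J ∈ intBox N m,
    {ω | ∃ K ∈ intBox N (2 ^ m), (2 : ℝ) ^ (η * m) < ‖Y J K ω‖}
  have hB : ∀ m, P (B m) ≤ ENNReal.ofReal ((2 * (m : ℝ) + 1) ^ N *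
      (A * (((2 : ℝ) ^ (η / 2 * m)) ^ (-α) + (2 * 2 ^ m + 1) ^ N *
        Real.exp (-((2 : ℝ) ^ (η * m) / (8 * (2 : ℝ) ^ (η / 2 * m))))))) := by
    intro m
    rw [← ENNReal.ofReal_toReal (measure_ne_top P _)]
    refine ENNReal.ofReal_le_ofReal ?_
    change P.real (B m) ≤ _
    refine (measureReal_biUnion_finset_le _ _).trans ?_
    refine (Finset.sum_le_sum fun J _ => hY J (intBox N (2 ^ m)) ((2 : ℝ) ^ (η / 2 * m))
      ((2 : ℝ) ^ (η * m)) (Real.one_le_rpow (by norm_num) (by positivity)) (by positivity)).trans ?_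
    rw [Finset.sum_const, card_intBox, card_intBox, nsmul_eq_mul]
    push_cast
    exact le_rfl
  have hsum : ∑' m, P (B m) ≠ ∞ := ne_top_of_le_ne_top
    (summable_growth_bound hα0 N hη A).tsum_ofReal_ne_top (ENNReal.tsum_le_tsum hB)
  filter_upwards [ae_eventually_notMem hsum] with ω hω
  obtain ⟨m₀, hm₀⟩ := eventually_atTop.1 hω
  -- For given (J, K) the bound is read off at a level m past m₀ that is large enough for every
  -- coordinate. Taking the sum rather than the maximum over l makes 2^(ηm) a product over the
  -- coordinates; the N in the constant collects the +1 in each `s l`.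
  refine ⟨2 ^ (η * (m₀ + N)), by positivity, fun J K => ?_⟩
  set s : Fin N → ℕ := fun l => (J l).natAbs + (Nat.log 2 ((K l).natAbs + 1) + 1)
  set m := m₀ + ∑ l, s l
  have hsl : ∀ l, s l ≤ m := fun l =>
    (Finset.single_le_sum (fun i _ => Nat.zero_le (s i)) (Finset.mem_univ l)).trans
      (Nat.le_add_left _ _)
  have h1 : ‖Y J K ω‖ ≤ (2 : ℝ) ^ (η * m) := by
    have h2 := hm₀ m (Nat.le_add_right _ _)
    simp only [B, Set.mem_iUnion, Set.mem_ofPred_eq, not_exists, not_and, not_lt] at h2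
    refine h2 J (mem_intBox.2 fun l => ?_) K (mem_intBox.2 fun l => ?_)
    · exact (Nat.le_add_right _ _).trans (hsl l)
    · have h3 := (Nat.lt_pow_succ_log_self (b := 2) (by norm_num) ((K l).natAbs + 1)).le
      have h4 : 2 ^ (Nat.log 2 ((K l).natAbs + 1) + 1) ≤ 2 ^ m :=
        Nat.pow_le_pow_right (by norm_num) ((Nat.le_add_left _ _).trans (hsl l))
      omega
  refine h1.trans ?_
  have h5 : (2 : ℝ) ^ (η * m) = 2 ^ (η * m₀) * ∏ l, (2 : ℝ) ^ (η * s l) := by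
    rw [← Real.rpow_sum_of_pos (by norm_num), ← Real.rpow_add (by norm_num)]
    congr 1
    simp only [m]
    push_cast
    rw [mul_add, Finset.mul_sum]
  have h6 : (2 : ℝ) ^ (η * ((m₀ : ℝ) + N)) = 2 ^ (η * m₀) * ∏ _l : Fin N, (2 : ℝ) ^ η := by
    rw [Finset.prod_const, Finset.card_univ, Fintype.card_fin, ← Real.rpow_natCast,
      ← Real.rpow_mul (by norm_num), ← Real.rpow_add (by norm_num), mul_add]
  rw [h5, h6, mul_assoc, ← Finset.prod_mul_distrib]
  gcongr with l _
  have h7 : (((K l).natAbs : ℕ) : ℝ) = |(K l : ℝ)| := by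
    rw [Nat.cast_natAbs, Int.cast_abs]
  have h8 : (((J l).natAbs : ℕ) : ℝ) = |(J l : ℝ)| := by
    rw [Nat.cast_natAbs, Int.cast_abs]
  have h9 : (2 : ℝ) ^ Nat.log 2 ((K l).natAbs + 1) ≤ 1 + |(K l : ℝ)| := by
    rw [← h7, add_comm 1]
    exact_mod_cast Nat.pow_log_le_self 2 (Nat.succ_ne_zero (K l).natAbs)
  calc (2 : ℝ) ^ (η * s l) = 2 ^ η * (2 ^ (η * |(J l : ℝ)|) *
        ((2 : ℝ) ^ Nat.log 2 ((K l).natAbs + 1)) ^ η) := by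
        rw [← Real.rpow_natCast, ← Real.rpow_mul (by norm_num), ← Real.rpow_add (by norm_num),
          ← Real.rpow_add (by norm_num)]
        congr 1
        simp only [s]
        push_cast [h8]
        ring
    _ ≤ _ := by gcongr

end
end HFSS

namespace HFSS
noncomputable section

variable {N : ℕ} {Ω : Type*} [MeasurableSpace Ω] {α : ℝ} {P : Measure Ω}
  {M : Set (E N) → Ω → ℂ}

/-! ### The Fourier transform of the wavelet and the coefficients -/

open scoped FourierTransform SchwartzMap

/-- The mother wavelet as a complex-valued Schwartz function. -/
def cpx (ψ : SchwartzMap ℝ ℝ) : 𝓢(ℝ, ℂ) := SchwartzMap.postcompCLM (𝕜 := ℝ) Complex.ofRealCLM ψ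

theorem cpx_apply (ψ : SchwartzMap ℝ ℝ) (x : ℝ) : cpx ψ x = (ψ x : ℂ) := rfl

/-- The transform `𝓕` has the phase exp(-2πi s ξ), so the two conventions differ by a dilation by 2π
and a constant. -/
theorem hat_eq_fourier (ψ : SchwartzMap ℝ ℝ) (ξ : ℝ) :
    hat ψ ξ = ((Real.sqrt (2 * Real.pi))⁻¹ : ℂ) * (𝓕 (cpx ψ)) ((2 * Real.pi)⁻¹ * ξ) := by
  rw [hat, SchwartzMap.fourier_coe, Real.fourier_real_eq_integral_exp_smul]
  congr 1
  refine integral_congr_ae (Eventually.of_forall fun s => ?_)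
  simp only [cpx_apply, smul_eq_mul]
  congr 2
  push_cast
  field_simp [Real.pi_ne_zero]

theorem contDiff_hat (ψ : SchwartzMap ℝ ℝ) : ContDiff ℝ (⊤ : ℕ∞) (hat ψ) := by
  have : hat ψ = fun ξ => ((Real.sqrt (2 * Real.pi))⁻¹ : ℂ) *
      (𝓕 (cpx ψ)) ((2 * Real.pi)⁻¹ * ξ) := funext (hat_eq_fourier ψ)
  rw [this]
  exact contDiff_const.mul ((SchwartzMap.smooth (𝓕 (cpx ψ)) ⊤).comp (contDiff_const.mul contDiff_id))

theorem continuous_hat (ψ : SchwartzMap ℝ ℝ) : Continuous (hat ψ) := (contDiff_hat ψ).continuous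

theorem hasCompactSupport_hat {ψ : SchwartzMap ℝ ℝ} (hψ : IsLemarieMeyer ψ) :
    HasCompactSupport (hat ψ) := by
  refine HasCompactSupport.intro (isCompact_closedBall (0 : ℝ) (8 * Real.pi / 3)) fun ξ hξ => ?_
  by_contra h
  exact hξ (by simpa using (hψ.support_hat ξ h).2)

theorem exists_hat_bound {ψ : SchwartzMap ℝ ℝ} (hψ : IsLemarieMeyer ψ) :
    ∃ B : ℝ, 0 < B ∧ ∀ ξ, ‖hat ψ ξ‖ ≤ B := by
  obtain ⟨C, hC⟩ := (continuous_hat ψ).bounded_above_of_compact_support (hasCompactSupport_hat hψ)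
  exact ⟨max C 1, by positivity, fun ξ => (hC ξ).trans (le_max_left _ _)⟩

theorem norm_exp_neg_I_mul (x : ℝ) : ‖Complex.exp (-(Complex.I * (x : ℂ)))‖ = 1 := by
  rw [show -(Complex.I * (x : ℂ)) = ((-x : ℝ) : ℂ) * Complex.I by push_cast; ring,
    Complex.norm_exp_ofReal_mul_I]

theorem norm_exp_I_mul (x : ℝ) : ‖Complex.exp (Complex.I * (x : ℂ))‖ = 1 := by
  rw [mul_comm, Complex.norm_exp_ofReal_mul_I]

theorem norm_hatNormalized (ψ : SchwartzMap ℝ ℝ) (j k : ℤ) (ξ : ℝ) :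
    ‖hatNormalized α ψ j k ξ‖ = (2 : ℝ) ^ (-((j : ℝ) / α)) * ‖hat ψ ((2 : ℝ) ^ (-j) * ξ)‖ := by
  rw [hatNormalized, norm_mul, norm_mul, norm_exp_neg_I_mul, mul_one, Complex.norm_real,
    Real.norm_of_nonneg (by positivity)]

theorem continuous_hatNormalized (ψ : SchwartzMap ℝ ℝ) (j k : ℤ) :
    Continuous (hatNormalized α ψ j k) := by
  unfold hatNormalized
  have := continuous_hat ψ
  fun_prop

/-- The integrand that defines `coeff`. -/
def coeffFun (α : ℝ) (ψ : SchwartzMap ℝ ℝ) (J K : Fin N → ℤ) (x : E N) : ℂ :=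
  starRingEnd ℂ (∏ l, hatNormalized α ψ (J l) (K l) (x l))

theorem continuous_coeffFun (ψ : SchwartzMap ℝ ℝ) (J K : Fin N → ℤ) :
    Continuous (coeffFun α ψ J K) := by
  unfold coeffFun
  refine Complex.continuous_conj.comp (continuous_finsetProd _ fun l _ => ?_)
  exact (continuous_hatNormalized ψ (J l) (K l)).comp (by fun_prop)

/-- A box that contains the support of `coeffFun α ψ J K`. -/
def freqBox (J : Fin N → ℤ) : Set (E N) := {x | ∀ l, x l ∈ Set.Icc (-(9 * (2 : ℝ) ^ J l)) (9 * 2 ^ J l)}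

theorem volume_freqBox (J : Fin N → ℤ) :
    volume (freqBox J) = ENNReal.ofReal (∏ l, (18 * (2 : ℝ) ^ J l)) := by
  have h : freqBox J = (MeasurableEquiv.toLp 2 (Fin N → ℝ)).symm ⁻¹'
      (Set.univ.pi fun l => Set.Icc (-(9 * (2 : ℝ) ^ J l)) (9 * 2 ^ J l)) := by
    ext x
    simp only [freqBox, Set.mem_ofPred_eq, Set.mem_preimage, Set.mem_univ_pi]
    rfl
  rw [h, (EuclideanSpace.volume_preserving_symm_measurableEquiv_toLp (Fin N)).measure_preimage
    (MeasurableSet.univ_pi fun _ => measurableSet_Icc).nullMeasurableSet,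
    volume_pi_pi, ENNReal.ofReal_prod_of_nonneg (fun l _ => by positivity)]
  refine Finset.prod_congr rfl fun l _ => ?_
  rw [Real.volume_Icc]
  congr 1
  ring

theorem hatNormalized_eq_zero {ψ : SchwartzMap ℝ ℝ} (hψ : IsLemarieMeyer ψ) (j k : ℤ) {ξ : ℝ}
    (hξ : ξ ∉ Set.Icc (-(9 * (2 : ℝ) ^ j)) (9 * 2 ^ j)) : hatNormalized α ψ j k ξ = 0 := by
  rw [← norm_eq_zero, norm_hatNormalized]
  suffices h : hat ψ ((2 : ℝ) ^ (-j) * ξ) = 0 by rw [h, norm_zero, mul_zero]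
  by_contra h
  have h1 := (hψ.support_hat _ h).2
  have h2 : (0 : ℝ) < 2 ^ j := by positivity
  rw [abs_mul, abs_of_pos (by positivity), zpow_neg, inv_mul_le_iff₀ h2] at h1
  refine hξ (abs_le.1 ?_)
  -- The 9 in the box is a rational bound for 8π/3.
  nlinarith [Real.pi_lt_d2]

theorem coeffFun_eq_zero {ψ : SchwartzMap ℝ ℝ} (hψ : IsLemarieMeyer ψ) (J K : Fin N → ℤ) {x : E N}
    (hx : x ∉ freqBox J) : coeffFun α ψ J K x = 0 := by
  simp only [freqBox, Set.mem_ofPred_eq, not_forall] at hx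
  obtain ⟨l, hl⟩ := hx
  rw [coeffFun, Finset.prod_eq_zero (Finset.mem_univ l) (hatNormalized_eq_zero hψ _ _ hl), map_zero]

theorem norm_coeffFun_le {ψ : SchwartzMap ℝ ℝ} {B : ℝ} (hB : ∀ ξ, ‖hat ψ ξ‖ ≤ B)
    (J K : Fin N → ℤ) (x : E N) :
    ‖coeffFun α ψ J K x‖ ≤ ∏ l, ((2 : ℝ) ^ (-((J l : ℝ) / α)) * B) := by
  rw [coeffFun, Complex.norm_conj, norm_prod]
  refine Finset.prod_le_prod (fun _ _ => norm_nonneg _) fun l _ => ?_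
  rw [norm_hatNormalized]
  gcongr
  exact hB _

theorem memLp_coeffFun {ψ : SchwartzMap ℝ ℝ} (hψ : IsLemarieMeyer ψ) (J K : Fin N → ℤ) (p : ℝ≥0∞) :
    MemLp (coeffFun α ψ J K) p (volume : Measure (E N)) := by
  obtain ⟨B, -, hB⟩ := exists_hat_bound hψ
  refine (continuous_coeffFun ψ J K).memLp_of_hasCompactSupport ?_
  refine HasCompactSupport.intro (K := closure (freqBox J)) ?_ fun x hx =>
    coeffFun_eq_zero hψ J K fun h => hx (subset_closure h)
  refine Bornology.IsBounded.isCompact_closure ?_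
  refine (PiLp.antilipschitzWith_ofLp 2 (fun _ : Fin N => ℝ)).isBounded_preimage
    (s := Set.univ.pi fun l => Set.Icc (-(9 * (2 : ℝ) ^ J l)) (9 * 2 ^ J l))
    (Bornology.IsBounded.pi fun l => Metric.isBounded_Icc _ _) |>.subset fun x hx => ?_
  exact Set.mem_univ_pi.2 hx

variable [IsProbabilityMeasure P]

theorem isStableIntegral_coeff (hM : IsIsotropicStableMeasure α P M) (hα0 : 0 < α) (hα2 : α < 2)
    {ψ : SchwartzMap ℝ ℝ} (hψ : IsLemarieMeyer ψ) (J K : Fin N → ℤ) :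
    IsStableIntegral α P M (coeffFun α ψ J K) (coeff α ψ P M J K) :=
  isStableIntegral_stableIntegral hM hα0 hα2 (memLp_coeffFun hψ J K _)

/-- The L^α normalization makes the bound uniform in J: the integrands are bounded by a multiple b
of 2^(-ΣJ/α), their box has volume proportional to 2^(ΣJ), and volume times b^α is the constant (18
B^α)^N. Accordingly the truncation is at τ / b. -/
theorem measureReal_exists_coeff_gt_le (hM : IsIsotropicStableMeasure α P M) (hα0 : 0 < α)
    (hα2 : α < 2) {ψ : SchwartzMap ℝ ℝ} (hψ : IsLemarieMeyer ψ) :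
    ∃ A : ℝ, ∀ (J : Fin N → ℤ) (F : Finset (Fin N → ℤ)) (τ x : ℝ), 1 ≤ τ → 0 < x →
      P.real {ω | ∃ K ∈ F, x < ‖coeff α ψ P M J K ω‖} ≤
        A * (τ ^ (-α) + F.card * Real.exp (-(x / (8 * τ)))) := by
  obtain ⟨B, hB0, hB⟩ := exists_hat_bound hψ
  have hα' : 0 < 2 - α := by linarith
  set C : ℝ := (18 * B ^ α) ^ N
  have hC : 0 < C := by positivity
  set D := 4 * Real.exp (128 / (2 - α) * C)
  refine ⟨max (64 * C) D, fun J F τ x hτ hx => ?_⟩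
  have hτ0 : 0 < τ := by linarith
  set b := ∏ l, ((2 : ℝ) ^ (-((J l : ℝ) / α)) * B)
  have hb : 0 < b := Finset.prod_pos fun l _ => by positivity
  have h1 := measureReal_exists_isStableIntegral_gt_le hM hα0 hα2 (κ := F)
    (f := fun K => coeffFun α ψ J K) (X := fun K => coeff α ψ P M J K)
    (fun K => (continuous_coeffFun ψ J K).measurable)
    (fun K => isStableIntegral_coeff hM hα0 hα2 hψ J K) hb (div_pos hτ0 hb)
    (fun K y => norm_coeffFun_le hB J K y) (S := freqBox J)
    (by rw [volume_freqBox]; exact ENNReal.ofReal_lt_top)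
    (fun K y hy => coeffFun_eq_zero hψ J K hy) hx
  have hV : (volume (freqBox J)).toReal * (τ / b) ^ (-α) = C * τ ^ (-α) := by
    rw [volume_freqBox, ENNReal.toReal_ofReal (Finset.prod_nonneg fun l _ => by positivity),
      Real.div_rpow hτ0.le hb.le, Real.rpow_neg hb.le, div_inv_eq_mul, ← mul_assoc,
      mul_right_comm]
    congr 1
    simp only [b, C]
    rw [← Real.finsetProd_rpow _ _ (fun l _ => by positivity), ← Finset.prod_mul_distrib]
    refine (Finset.prod_congr rfl fun l _ => ?_).trans
      ((Finset.prod_const (18 * B ^ α)).trans (by rw [Finset.card_univ, Fintype.card_fin]))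
    rw [Real.mul_rpow (by positivity) hB0.le, ← Real.rpow_mul (by norm_num),
      show -((J l : ℝ) / α) * α = -(J l : ℝ) by field_simp, Real.rpow_neg (by norm_num),
      Real.rpow_intCast]
    field_simp
  have hV' : 64 * (volume (freqBox J)).toReal * (τ / b) ^ (-α) = 64 * C * τ ^ (-α) := by
    rw [mul_assoc, hV, mul_assoc]
  have hV'' : 128 / (2 - α) * (volume (freqBox J)).toReal * (τ / b) ^ (-α) =
      128 / (2 - α) * C * τ ^ (-α) := by
    rw [mul_assoc, hV, mul_assoc]
  have hx' : x / (8 * b * (τ / b)) = x / (8 * τ) := by field_simp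
  rw [hV', hV'', hx'] at h1
  have hset : {ω | ∃ K ∈ F, x < ‖coeff α ψ P M J K ω‖} =
      {ω | ∃ K : F, x < ‖coeff α ψ P M J K ω‖} := by
    ext ω
    simp
  rw [hset]
  refine h1.trans ?_
  rw [Fintype.card_coe, mul_add]
  refine add_le_add ?_ ?_
  · gcongr
    exact le_max_left _ _
  · have h2 : τ ^ (-α) ≤ 1 := Real.rpow_le_one_of_one_le_of_nonpos hτ (by linarith)
    have h3 : Real.exp (128 / (2 - α) * C * τ ^ (-α)) ≤ Real.exp (128 / (2 - α) * C) := by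
      refine Real.exp_le_exp.2 (mul_le_of_le_one_right (by positivity) h2)
    calc _ = 4 * Real.exp (128 / (2 - α) * C * τ ^ (-α)) *
          (F.card * Real.exp (-(x / (8 * τ)))) := by rw [Real.exp_add]; ring
      _ ≤ 4 * Real.exp (128 / (2 - α) * C) * (F.card * Real.exp (-(x / (8 * τ)))) := by gcongr
      _ ≤ _ := by gcongr; exact le_max_right _ _

theorem ae_exists_coeff_bound (hM : IsIsotropicStableMeasure α P M) (hα0 : 0 < α)
    (hα2 : α < 2) {ψ : SchwartzMap ℝ ℝ} (hψ : IsLemarieMeyer ψ) {η : ℝ} (hη : 0 < η) :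
    ∀ᵐ ω ∂P, ∃ C : ℝ, 0 ≤ C ∧ ∀ J K, ‖coeff α ψ P M J K ω‖ ≤
      C * ∏ l, ((2 : ℝ) ^ (η * |(J l : ℝ)|) * (1 + |(K l : ℝ)|) ^ η) := by
  obtain ⟨A, hA⟩ := measureReal_exists_coeff_gt_le hM hα0 hα2 hψ
  exact ae_exists_bound_of_tail hα0 hA hη

end
end HFSS

namespace HFSS
noncomputable section

variable {N : ℕ} {α : ℝ}

/-! ### Decay of the fractional primitives of the wavelet -/

open scoped FourierTransform SchwartzMap

/-- The only singularity of |η|^(-s) is at 0, and the numerator vanishes in a neighbourhood of 0. -/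
theorem contDiff_hat_div {ψ : SchwartzMap ℝ ℝ} (hψ : IsLemarieMeyer ψ) (s : ℝ) :
    ContDiff ℝ (⊤ : ℕ∞) fun η : ℝ => hat ψ η / ((|η| ^ s : ℝ) : ℂ) := by
  refine contDiff_iff_contDiffAt.2 fun η => ?_
  rcases eq_or_ne η 0 with rfl | hη
  · refine contDiffAt_const (c := (0 : ℂ)) |>.congr_of_eventuallyEq ?_
    filter_upwards [Metric.ball_mem_nhds (0 : ℝ) (ε := 1) one_pos] with η hη
    have h : hat ψ η = 0 := by
      by_contra h
      have h1 := (hψ.support_hat η h).1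
      rw [mem_ball_zero_iff, Real.norm_eq_abs] at hη
      linarith [Real.pi_gt_three]
    rw [h, zero_div]
  · simp only [div_eq_mul_inv]
    refine (contDiff_hat ψ).contDiffAt.mul (ContDiffAt.inv ?_ ?_)
    · exact Complex.ofRealCLM.contDiff.contDiffAt.comp η
        ((contDiffAt_abs hη).rpow_const_of_ne (abs_ne_zero.2 hη))
    · exact_mod_cast (Real.rpow_pos_of_pos (abs_pos.2 hη) s).ne'

/-- Up to dilation by 2π, ψ^v is the inverse Fourier transform of a smooth compactly supported
function. -/
theorem exists_schwartzMap_eq_fracPrim {ψ : SchwartzMap ℝ ℝ} (hψ : IsLemarieMeyer ψ) (v : ℝ) :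
    ∃ Φ : 𝓢(ℝ, ℂ), ∀ y, fracPrim α ψ v y = Φ y := by
  have hc : HasCompactSupport fun η : ℝ => hat ψ η / ((|η| ^ (v + 1 / α) : ℝ) : ℂ) := by
    simp only [div_eq_mul_inv]
    exact (hasCompactSupport_hat hψ).mul_right
  set g : 𝓢(ℝ, ℂ) := hc.toSchwartzMap (contDiff_hat_div hψ _)
  have h2π : (2 * Real.pi)⁻¹ ≠ 0 := inv_ne_zero (by positivity)
  refine ⟨SchwartzMap.compCLMOfContinuousLinearEquiv ℝ
    (ContinuousLinearEquiv.smulLeft (R₁ := ℝ) (M₁ := ℝ) (Units.mk0 _ h2π)) (𝓕⁻ g), fun y => ?_⟩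
  change _ = (𝓕⁻ g) ((2 * Real.pi)⁻¹ * y)
  rw [SchwartzMap.fourierInv_coe, Real.fourierInv_eq', fracPrim]
  refine integral_congr_ae (Eventually.of_forall fun η => ?_)
  simp only [smul_eq_mul, RCLike.inner_apply, conj_trivial]
  congr 2
  push_cast
  field_simp

/-- A polynomially decaying kernel. -/
def decay (p : ℕ) (z : ℝ) : ℝ := ((1 + |z|) ^ p)⁻¹

theorem decay_nonneg (p : ℕ) (z : ℝ) : 0 ≤ decay p z := by unfold decay; positivity

theorem exists_schwartz_decay (Φ : 𝓢(ℝ, ℂ)) (p : ℕ) : ∃ C : ℝ, 0 ≤ C ∧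
    ∀ z, ‖Φ z‖ ≤ C * decay p z ∧ ‖deriv Φ z‖ ≤ C * decay p z := by
  set C : ℝ := 2 ^ p * ((Finset.Iic (p, 1)).sup fun m => SchwartzMap.seminorm ℝ m.1 m.2) Φ
  have h : ∀ n ≤ 1, ∀ z : ℝ, (1 + |z|) ^ p * ‖iteratedFDeriv ℝ n Φ z‖ ≤ C := fun n hn z =>
    SchwartzMap.one_add_le_sup_seminorm_apply (𝕜 := ℝ) (m := (p, 1)) le_rfl hn Φ z
  refine ⟨C, (by positivity : (0 : ℝ) ≤ _).trans (h 0 (by norm_num) 0), fun z => ⟨?_, ?_⟩⟩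
  · have h0 := h 0 (by norm_num) z
    rw [norm_iteratedFDeriv_zero] at h0
    rw [decay, ← div_eq_mul_inv, le_div_iff₀ (by positivity)]
    linarith
  · have h1 := h 1 le_rfl z
    rw [norm_iteratedFDeriv_one, ← norm_deriv_eq_norm_fderiv] at h1
    rw [decay, ← div_eq_mul_inv, le_div_iff₀ (by positivity)]
    linarith

theorem decay_le_of_abs_sub_le_one (p : ℕ) {u z : ℝ} (h : |u - z| ≤ 1) :
    decay p z ≤ 2 ^ p * decay p u := by
  unfold decay
  rw [← div_eq_mul_inv, le_div_iff₀ (by positivity), ← div_eq_inv_mul, div_le_iff₀ (by positivity),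
    ← mul_pow]
  gcongr
  have := abs_sub_abs_le_abs_sub u z
  linarith [abs_nonneg z]

/-- For distant points the triangle inequality suffices; for points within distance 1 the mean value
inequality does, since decay changes by at most the factor 2^p along the segment. -/
theorem exists_schwartz_increment (Φ : 𝓢(ℝ, ℂ)) (p : ℕ) : ∃ C : ℝ, 0 ≤ C ∧
    ∀ u v, ‖Φ u - Φ v‖ ≤ C * min 1 |u - v| * (decay p u + decay p v) := by
  obtain ⟨C, hC, h⟩ := exists_schwartz_decay Φ p
  refine ⟨2 ^ p * C, by positivity, fun u v => ?_⟩
  have h2 : (1 : ℝ) ≤ 2 ^ p := one_le_pow₀ (by norm_num)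
  have hu := decay_nonneg p u
  have hv := decay_nonneg p v
  rcases le_total 1 |u - v| with h1 | h1
  · rw [min_eq_left h1, mul_one]
    calc ‖Φ u - Φ v‖ ≤ ‖Φ u‖ + ‖Φ v‖ := norm_sub_le _ _
      _ ≤ C * decay p u + C * decay p v := add_le_add (h u).1 (h v).1
      _ = 1 * C * (decay p u + decay p v) := by ring
      _ ≤ _ := by gcongr
  · rw [min_eq_right h1]
    have h3 := Convex.norm_image_sub_le_of_norm_deriv_le (𝕜 := ℝ) (f := Φ) (s := Set.uIcc v u)
      (C := C * (2 ^ p * decay p u)) (fun z _ => Φ.differentiableAt) (fun z hz => ?_)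
      (convex_uIcc v u) Set.left_mem_uIcc Set.right_mem_uIcc
    · refine h3.trans ?_
      rw [Real.norm_eq_abs]
      calc C * (2 ^ p * decay p u) * |u - v| = 2 ^ p * C * |u - v| * (decay p u + 0) := by ring
        _ ≤ _ := by gcongr
    · refine (h z).2.trans ?_
      gcongr
      refine decay_le_of_abs_sub_le_one p ?_
      exact (Set.abs_sub_right_of_mem_uIcc hz).trans (by rwa [abs_sub_comm] at h1 ⊢)

/-! ### Sums over dyadic scales and integer translates -/

theorem summable_int_decay_two : Summable fun k : ℤ => decay 2 k := by
  have h : Summable fun n : ℕ => decay 2 ((n : ℝ)) := by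
    have h1 := (summable_nat_add_iff (f := fun n : ℕ => 1 / (n : ℝ) ^ 2) 1).2
      (Real.summable_one_div_nat_pow.2 (by norm_num))
    refine h1.congr fun n => ?_
    rw [decay, abs_of_nonneg (by positivity)]
    push_cast
    rw [one_div, add_comm]
  refine Summable.of_nat_of_neg ?_ ?_
  · simpa using h
  · refine h.congr fun n => ?_
    simp [decay]

theorem exists_sum_decay_le : ∃ C : ℝ, 0 ≤ C ∧ ∀ (z : ℝ) (F : Finset ℤ),
    ∑ k ∈ F, decay 2 (z - k) ≤ C := by
  refine ⟨2 ^ 2 * ∑' k : ℤ, decay 2 k, mul_nonneg (by norm_num)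
    (tsum_nonneg fun k => decay_nonneg _ _), fun z F => ?_⟩
  have h1 : ∀ k ∈ F, decay 2 (z - k) ≤ 2 ^ 2 * decay 2 (((⌊z⌋ - k : ℤ) : ℤ) : ℝ) := fun k _ => by
    refine decay_le_of_abs_sub_le_one 2 ?_
    push_cast
    rw [sub_sub_sub_cancel_right, abs_sub_comm, abs_of_nonneg (by linarith [Int.floor_le z])]
    linarith [Int.lt_floor_add_one z]
  refine (Finset.sum_le_sum h1).trans ?_
  rw [← Finset.mul_sum]
  gcongr
  rw [← Finset.sum_image (f := fun k : ℤ => decay 2 (k : ℝ)) (g := fun k => ⌊z⌋ - k)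
    (fun a _ b _ hab => by simpa using hab)]
  exact summable_int_decay_two.sum_le_tsum _ (fun k _ => decay_nonneg _ _)

theorem summable_int_two_rpow_neg {δ : ℝ} (hδ : 0 < δ) :
    Summable fun j : ℤ => (2 : ℝ) ^ (-(δ * |(j : ℝ)|)) := by
  have h : Summable fun n : ℕ => (2 : ℝ) ^ (-(δ * |(n : ℝ)|)) := by
    refine (summable_geometric_of_lt_one (r := (2 : ℝ) ^ (-δ)) (by positivity)
      (Real.rpow_lt_one_of_one_lt_of_neg (by norm_num) (by linarith))).congr fun n => ?_
    rw [← Real.rpow_natCast, ← Real.rpow_mul (by norm_num), abs_of_nonneg (by positivity), neg_mul]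
  refine Summable.of_nat_of_neg ?_ ?_
  · simpa using h
  · simpa using h

theorem exists_sum_dyadic_decay_le {δ : ℝ} (hδ : 0 < δ) : ∃ C : ℝ, 0 ≤ C ∧
    ∀ (x : ℝ) (F : Finset (ℤ × ℤ)),
      ∑ q ∈ F, (2 : ℝ) ^ (-(δ * |(q.1 : ℝ)|)) * decay 2 ((2 : ℝ) ^ q.1 * x - q.2) ≤ C := by
  classical
  obtain ⟨C, hC, h⟩ := exists_sum_decay_le
  have hs := summable_int_two_rpow_neg hδ
  refine ⟨(∑' j : ℤ, (2 : ℝ) ^ (-(δ * |(j : ℝ)|))) * C,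
    mul_nonneg (tsum_nonneg fun j => by positivity) hC, fun x F => ?_⟩
  calc _ ≤ ∑ q ∈ F.image Prod.fst ×ˢ F.image Prod.snd,
        (2 : ℝ) ^ (-(δ * |(q.1 : ℝ)|)) * decay 2 ((2 : ℝ) ^ q.1 * x - q.2) := by
        refine Finset.sum_le_sum_of_subset_of_nonneg (fun q hq => ?_) fun q _ _ =>
          mul_nonneg (by positivity) (decay_nonneg _ _)
        exact Finset.mem_product.2 ⟨Finset.mem_image_of_mem _ hq, Finset.mem_image_of_mem _ hq⟩
    _ = ∑ j ∈ F.image Prod.fst, (2 : ℝ) ^ (-(δ * |(j : ℝ)|)) *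
        ∑ k ∈ F.image Prod.snd, decay 2 ((2 : ℝ) ^ j * x - k) := by
        rw [Finset.sum_product]
        simp only [Finset.mul_sum]
    _ ≤ ∑ j ∈ F.image Prod.fst, (2 : ℝ) ^ (-(δ * |(j : ℝ)|)) * C := by
        gcongr
        exact h _ _
    _ ≤ _ := by
        rw [← Finset.sum_mul]
        gcongr
        exact hs.sum_le_tsum _ (fun j _ => by positivity)

/-- The one-dimensional index set: `|j| ≤ n` and `|k| ≤ R 2^(n+1)`. -/
def indexSet₁ (n : ℕ) (R : ℝ) : Finset (ℤ × ℤ) :=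
  Finset.Icc (-(n : ℤ)) n ×ˢ Finset.Icc (-⌊R * 2 ^ (n + 1)⌋) ⌊R * 2 ^ (n + 1)⌋

theorem mem_indexSet₁ {n : ℕ} {R : ℝ} {q : ℤ × ℤ} :
    q ∈ indexSet₁ n R ↔ |(q.1 : ℝ)| ≤ n ∧ |(q.2 : ℝ)| ≤ R * 2 ^ (n + 1) := by
  rw [indexSet₁, Finset.mem_product, Finset.mem_Icc, Finset.mem_Icc, ← abs_le, ← abs_le,
    Int.le_floor, Int.cast_abs]
  refine and_congr ?_ Iff.rfl
  exact_mod_cast Iff.rfl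

/-- A bound for the terms outside `indexSet₁ n R`. -/
def tailFactor (δ R : ℝ) (n : ℕ) : ℝ := (2 : ℝ) ^ (-(δ * n)) + (R * 2 ^ n)⁻¹

theorem tendsto_tailFactor {δ R : ℝ} (hδ : 0 < δ) :
    Tendsto (tailFactor δ R) atTop (𝓝 0) := by
  have h1 : Tendsto (fun n : ℕ => (2 : ℝ) ^ (-(δ * n))) atTop (𝓝 0) := by
    have : (fun n : ℕ => (2 : ℝ) ^ (-(δ * n))) = fun n : ℕ => ((2 : ℝ) ^ (-δ)) ^ n := by
      funext n
      rw [← Real.rpow_natCast, ← Real.rpow_mul (by norm_num), neg_mul]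
    rw [this]
    exact tendsto_pow_atTop_nhds_zero_of_lt_one (by positivity)
      (Real.rpow_lt_one_of_one_lt_of_neg (by norm_num) (by linarith))
  have h2 : Tendsto (fun n : ℕ => (R * 2 ^ n)⁻¹) atTop (𝓝 0) := by
    have h3 := (tendsto_pow_atTop_nhds_zero_of_lt_one (r := (1 / 2 : ℝ)) (by norm_num)
      (by norm_num)).const_mul R⁻¹
    rw [mul_zero] at h3
    refine h3.congr fun n => ?_
    rw [mul_inv, one_div, inv_pow]
  rw [← add_zero (0 : ℝ)]
  exact h1.add h2

/-- Half of the exponent and one power of decay are given up for smallness. If |j| > n, the former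
gives 2^(-δn). Otherwise |k| > R 2^(n+1) while |2^j x| ≤ R 2^n, so the argument of decay is at least
R 2^n in modulus. -/
theorem term_le_tailFactor_mul {δ R : ℝ} (hδ : 0 < δ) (hR : 0 < R) {n : ℕ} {q : ℤ × ℤ}
    (hq : q ∉ indexSet₁ n R) {x : ℝ} (hx : |x| ≤ R) :
    (2 : ℝ) ^ (-(2 * δ * |(q.1 : ℝ)|)) * decay 3 ((2 : ℝ) ^ q.1 * x - q.2) ≤
      tailFactor δ R n *
        ((2 : ℝ) ^ (-(δ * |(q.1 : ℝ)|)) * decay 2 ((2 : ℝ) ^ q.1 * x - q.2)) := by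
  set u := (2 : ℝ) ^ q.1 * x - q.2
  have hd : decay 3 u = (1 + |u|)⁻¹ * decay 2 u := by
    unfold decay; rw [pow_succ (1 + |u|) 2, mul_inv, mul_comm]
  have hd2 := decay_nonneg 2 u
  have hsplit : (2 : ℝ) ^ (-(2 * δ * |(q.1 : ℝ)|)) =
      (2 : ℝ) ^ (-(δ * |(q.1 : ℝ)|)) * (2 : ℝ) ^ (-(δ * |(q.1 : ℝ)|)) := by
    rw [← Real.rpow_add (by norm_num)]; congr 1; ring
  rw [hd, hsplit, show (2 : ℝ) ^ (-(δ * |(q.1 : ℝ)|)) * (2 : ℝ) ^ (-(δ * |(q.1 : ℝ)|)) *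
    ((1 + |u|)⁻¹ * decay 2 u) = ((2 : ℝ) ^ (-(δ * |(q.1 : ℝ)|)) * (1 + |u|)⁻¹) *
      ((2 : ℝ) ^ (-(δ * |(q.1 : ℝ)|)) * decay 2 u) by ring]
  gcongr
  have hinv : (1 + |u|)⁻¹ ≤ 1 := inv_le_one_of_one_le₀ (by linarith [abs_nonneg u])
  have hpow : (2 : ℝ) ^ (-(δ * |(q.1 : ℝ)|)) ≤ 1 :=
    Real.rpow_le_one_of_one_le_of_nonpos (by norm_num) (by
      have : 0 ≤ δ * |(q.1 : ℝ)| := by positivity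
      linarith)
  by_cases hj : |(q.1 : ℝ)| ≤ n
  · have hk : R * 2 ^ (n + 1) < |(q.2 : ℝ)| := by
      by_contra hk
      exact hq (mem_indexSet₁.2 ⟨hj, not_lt.1 hk⟩)
    have h1 : |(2 : ℝ) ^ q.1 * x| ≤ 2 ^ n * R := by
      rw [abs_mul, abs_of_pos (by positivity)]
      gcongr
      rw [← zpow_natCast]
      refine zpow_le_zpow_right₀ (by norm_num) ?_
      exact_mod_cast (le_abs_self _).trans hj
    have h2 : R * 2 ^ n ≤ 1 + |u| := by
      have h3 := abs_sub_abs_le_abs_sub (q.2 : ℝ) ((2 : ℝ) ^ q.1 * x)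
      rw [abs_sub_comm] at h3
      rw [pow_succ] at hk
      linarith
    calc _ ≤ 1 * (R * 2 ^ n)⁻¹ := by gcongr
      _ ≤ tailFactor δ R n := by
        rw [one_mul, tailFactor]; linarith [Real.rpow_pos_of_pos two_pos (-(δ * (n : ℝ)))]
  · calc _ ≤ (2 : ℝ) ^ (-(δ * n)) * 1 := by
          gcongr
          · norm_num
          · exact (not_le.1 hj).le
      _ ≤ tailFactor δ R n := by
        rw [mul_one, tailFactor]
        have : 0 ≤ (R * 2 ^ n)⁻¹ := by positivity
        linarith

end
end HFSS

namespace HFSS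
noncomputable section

variable {N : ℕ} {α : ℝ}

open scoped FourierTransform SchwartzMap

/-! ### A majorant for the one-dimensional terms of the series -/

/-- Since k = 2^j x - u with |x| ≤ R, one has 1 + |k| ≤ (1 + |u|)(1 + R) 2^|j|. One power of decay
absorbs 1 + |u|, and the growth in k becomes growth 2^(η|j|) in the scale. -/
theorem one_add_abs_rpow_mul_decay_le {η R : ℝ} (hη0 : 0 ≤ η) (hη1 : η ≤ 1) (hR : 0 ≤ R)
    (j k : ℤ) {x : ℝ} (hx : |x| ≤ R) :
    (1 + |(k : ℝ)|) ^ η * decay 4 ((2 : ℝ) ^ j * x - k) ≤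
      (1 + R) * (2 : ℝ) ^ (η * |(j : ℝ)|) * decay 3 ((2 : ℝ) ^ j * x - k) := by
  set u := (2 : ℝ) ^ j * x - k
  have hd : decay 4 u = (1 + |u|)⁻¹ * decay 3 u := by
    unfold decay; rw [pow_succ (1 + |u|) 3, mul_inv, mul_comm]
  have hd3 := decay_nonneg 3 u
  rw [hd, ← mul_assoc]
  refine mul_le_mul_of_nonneg_right ?_ hd3
  rw [← div_eq_mul_inv, div_le_iff₀ (by positivity)]
  have h2j : (2 : ℝ) ^ j ≤ 2 ^ |(j : ℝ)| := by
    rw [← Real.rpow_intCast]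
    exact Real.rpow_le_rpow_of_exponent_le (by norm_num) (le_abs_self _)
  have h2j' : (1 : ℝ) ≤ 2 ^ |(j : ℝ)| := Real.one_le_rpow (by norm_num) (abs_nonneg _)
  have h1 : 1 + |(k : ℝ)| ≤ (1 + |u|) * ((1 + R) * 2 ^ |(j : ℝ)|) := by
    have h3 : |(k : ℝ)| ≤ |u| + 2 ^ |(j : ℝ)| * R := by
      have h4 : (k : ℝ) = (2 : ℝ) ^ j * x - u := by simp only [u]; ring
      rw [h4]
      refine (abs_sub _ _).trans ?_
      rw [abs_mul, abs_of_pos (by positivity : (0 : ℝ) < 2 ^ j), add_comm]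
      gcongr
    have h5 : 0 ≤ |u| * R * 2 ^ |(j : ℝ)| := by positivity
    nlinarith [abs_nonneg u, mul_le_mul_of_nonneg_left h2j' (abs_nonneg u)]
  have hrp : ∀ y : ℝ, 1 ≤ y → y ^ η ≤ y := fun y hy => by
    calc y ^ η ≤ y ^ (1 : ℝ) := Real.rpow_le_rpow_of_exponent_le hy hη1
      _ = y := Real.rpow_one y
  calc (1 + |(k : ℝ)|) ^ η ≤ ((1 + |u|) * ((1 + R) * 2 ^ |(j : ℝ)|)) ^ η := by gcongr
    _ = (1 + |u|) ^ η * ((1 + R) ^ η * (2 : ℝ) ^ (η * |(j : ℝ)|)) := by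
      rw [Real.mul_rpow (by positivity) (by positivity), Real.mul_rpow (by positivity)
        (by positivity), ← Real.rpow_mul (by norm_num), mul_comm η]
    _ ≤ (1 + |u|) * ((1 + R) * (2 : ℝ) ^ (η * |(j : ℝ)|)) := by
      gcongr
      · exact hrp _ (by linarith [abs_nonneg u])
      · exact hrp _ (by linarith)
    _ = _ := by ring

/-- For j ≥ 0, min(1, y) ≤ y^γ leaves the exponent -(H - γ - 2η)j. For j ≤ 0, min(1, y) ≤ y and d ≤
(1 + 2R) d^γ leave -(1 - H - 2η)|j|. The two hypotheses make both at most -δ|j|. -/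
theorem two_rpow_mul_min_le {H γ η δ R : ℝ} (hγ : 0 < γ) (hγ1 : γ ≤ 1) (hR : 0 ≤ R)
    (h1 : γ + 2 * η + δ ≤ H) (h2 : H + 2 * η + δ ≤ 1) (j : ℤ) {d : ℝ} (hd : 0 < d)
    (hdR : d ≤ 2 * R) :
    (2 : ℝ) ^ (-((j : ℝ) * H)) * (2 : ℝ) ^ (2 * η * |(j : ℝ)|) * min 1 ((2 : ℝ) ^ j * d) ≤
      (1 + 2 * R) * (2 : ℝ) ^ (-(δ * |(j : ℝ)|)) * d ^ γ := by
  have hj2 : (2 : ℝ) ^ j = (2 : ℝ) ^ (j : ℝ) := (Real.rpow_intCast 2 j).symm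
  rcases le_total 0 j with hj | hj
  · have hj' : (0 : ℝ) ≤ j := by exact_mod_cast hj
    rw [abs_of_nonneg hj']
    have h3 : min 1 ((2 : ℝ) ^ j * d) ≤ ((2 : ℝ) ^ j * d) ^ γ := by
      rcases le_total 1 ((2 : ℝ) ^ j * d) with h | h
      · exact (min_le_left _ _).trans (Real.one_le_rpow h hγ.le)
      · refine (min_le_right _ _).trans ?_
        calc (2 : ℝ) ^ j * d = ((2 : ℝ) ^ j * d) ^ (1 : ℝ) := (Real.rpow_one _).symm
          _ ≤ _ := Real.rpow_le_rpow_of_exponent_ge (by positivity) h hγ1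
    calc _ ≤ (2 : ℝ) ^ (-((j : ℝ) * H)) * (2 : ℝ) ^ (2 * η * j) * ((2 : ℝ) ^ j * d) ^ γ := by
          gcongr
      _ = (2 : ℝ) ^ (-((j : ℝ) * H) + 2 * η * j + j * γ) * d ^ γ := by
          rw [Real.mul_rpow (by positivity) hd.le, hj2, ← Real.rpow_mul (by norm_num),
            Real.rpow_add (by norm_num), Real.rpow_add (by norm_num)]
          ring
      _ ≤ (2 : ℝ) ^ (-(δ * j)) * d ^ γ := by
          gcongr
          · norm_num
          · nlinarith
      _ ≤ _ := by
          gcongr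
          have : (0 : ℝ) < (2 : ℝ) ^ (-(δ * (j : ℝ))) := by positivity
          nlinarith
  · have hj' : (j : ℝ) ≤ 0 := by exact_mod_cast hj
    rw [abs_of_nonpos hj']
    have h4 : d ≤ (1 + 2 * R) * d ^ γ := by
      have h5 : d ^ (1 - γ) ≤ 1 + 2 * R := by
        rcases le_total 1 d with h | h
        · calc d ^ (1 - γ) ≤ d ^ (1 : ℝ) := Real.rpow_le_rpow_of_exponent_le h (by linarith)
            _ ≤ 1 + 2 * R := by rw [Real.rpow_one]; linarith
        · exact (Real.rpow_le_one hd.le h (by linarith)).trans (by linarith)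
      calc d = d ^ (1 - γ) * d ^ γ := by
            rw [← Real.rpow_add hd, sub_add_cancel, Real.rpow_one]
        _ ≤ _ := by gcongr
    calc _ ≤ (2 : ℝ) ^ (-((j : ℝ) * H)) * (2 : ℝ) ^ (2 * η * -j) *
          ((2 : ℝ) ^ j * ((1 + 2 * R) * d ^ γ)) := by
          gcongr
          exact (min_le_right _ _).trans (by gcongr)
      _ = (1 + 2 * R) * (2 : ℝ) ^ (-((j : ℝ) * H) + 2 * η * -j + j) * d ^ γ := by
          rw [hj2, Real.rpow_add (by norm_num), Real.rpow_add (by norm_num)]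
          ring
      _ ≤ _ := by
          gcongr
          · norm_num
          · nlinarith

/-- The growth factor of the coefficients together with the scaling factor of the series. -/
def weight (H η : ℝ) (q : ℤ × ℤ) : ℝ :=
  (2 : ℝ) ^ (-((q.1 : ℝ) * H)) * ((2 : ℝ) ^ (η * |(q.1 : ℝ)|) * (1 + |(q.2 : ℝ)|) ^ η)

theorem weight_nonneg (H η : ℝ) (q : ℤ × ℤ) : 0 ≤ weight H η q := by unfold weight; positivity

/-- The increment `Φ(2^j x - k) - Φ(-k)`. -/
def waveInc (Φ : ℝ → ℂ) (q : ℤ × ℤ) (x : ℝ) : ℂ :=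
  Φ ((2 : ℝ) ^ q.1 * x - q.2) - Φ (-(q.2 : ℝ))

theorem waveInc_zero (Φ : ℝ → ℂ) (q : ℤ × ℤ) : waveInc Φ q 0 = 0 := by simp [waveInc]

/-- Of four powers of decay, one is spent on the growth in k. Of the three left, one will serve the
tail outside the index set and two the sum over k. The factor 2^(η|j|) occurs twice, from the weight
and from absorbing k, hence 2η in the hypotheses. -/
theorem exists_weight_mul_increment_le (Φ : 𝓢(ℝ, ℂ)) {H γ η δ R : ℝ} (hγ : 0 < γ) (hη : 0 < η)
    (hδ : 0 < δ) (hR : 0 < R) (h1 : γ + 2 * η + δ ≤ H) (h2 : H + 2 * η + δ ≤ 1) :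
    ∃ C : ℝ, 0 ≤ C ∧ ∀ (q : ℤ × ℤ) (x y : ℝ), |x| ≤ R → |y| ≤ R →
      weight H η q * ‖waveInc Φ q x - waveInc Φ q y‖ ≤ C * (2 : ℝ) ^ (-(δ * |(q.1 : ℝ)|)) *
        (decay 3 ((2 : ℝ) ^ q.1 * x - q.2) + decay 3 ((2 : ℝ) ^ q.1 * y - q.2)) * |x - y| ^ γ := by
  obtain ⟨C, hC, h⟩ := exists_schwartz_increment Φ 4
  refine ⟨C * (1 + R) * (1 + 2 * R), by positivity, fun q x y hx hy => ?_⟩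
  obtain ⟨j, k⟩ := q
  simp only
  rcases eq_or_ne x y with rfl | hxy
  · simp [hγ.ne']
  have hd : 0 < |x - y| := abs_pos.2 (sub_ne_zero.2 hxy)
  have hdR : |x - y| ≤ 2 * R := (abs_sub _ _).trans (by linarith)
  set u := (2 : ℝ) ^ j * x - k
  set v := (2 : ℝ) ^ j * y - k
  have huv : |u - v| = (2 : ℝ) ^ j * |x - y| := by
    rw [show u - v = (2 : ℝ) ^ j * (x - y) by simp only [u, v]; ring, abs_mul,
      abs_of_pos (by positivity : (0 : ℝ) < 2 ^ j)]
  have h3 : ‖waveInc Φ (j, k) x - waveInc Φ (j, k) y‖ ≤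
      C * min 1 ((2 : ℝ) ^ j * |x - y|) * (decay 4 u + decay 4 v) := by
    rw [waveInc, waveInc, sub_sub_sub_cancel_right, ← huv]
    exact h u v
  have hu4 := one_add_abs_rpow_mul_decay_le hη.le (by linarith : η ≤ 1) hR.le j k hx
  have hv4 := one_add_abs_rpow_mul_decay_le hη.le (by linarith : η ≤ 1) hR.le j k hy
  have h5 := two_rpow_mul_min_le hγ (by linarith) hR.le h1 h2 j hd hdR
  have hu3 := decay_nonneg 3 u
  have hv3 := decay_nonneg 3 v
  have hmin : 0 ≤ min 1 ((2 : ℝ) ^ j * |x - y|) := le_min zero_le_one (by positivity)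
  have hsq : (2 : ℝ) ^ (η * |(j : ℝ)|) * (2 : ℝ) ^ (η * |(j : ℝ)|) =
      (2 : ℝ) ^ (2 * η * |(j : ℝ)|) := by
    rw [← Real.rpow_add (by norm_num)]; congr 1; ring
  calc weight H η (j, k) * ‖waveInc Φ (j, k) x - waveInc Φ (j, k) y‖
      ≤ weight H η (j, k) * (C * min 1 ((2 : ℝ) ^ j * |x - y|) * (decay 4 u + decay 4 v)) :=
        mul_le_mul_of_nonneg_left h3 (weight_nonneg _ _ _)
    _ = C * ((2 : ℝ) ^ (-((j : ℝ) * H)) * (2 : ℝ) ^ (η * |(j : ℝ)|) *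
        min 1 ((2 : ℝ) ^ j * |x - y|)) *
        ((1 + |(k : ℝ)|) ^ η * decay 4 u + (1 + |(k : ℝ)|) ^ η * decay 4 v) := by
        simp only [weight]; ring
    _ ≤ C * ((2 : ℝ) ^ (-((j : ℝ) * H)) * (2 : ℝ) ^ (η * |(j : ℝ)|) *
        min 1 ((2 : ℝ) ^ j * |x - y|)) *
        ((1 + R) * (2 : ℝ) ^ (η * |(j : ℝ)|) * decay 3 u +
          (1 + R) * (2 : ℝ) ^ (η * |(j : ℝ)|) * decay 3 v) := by gcongr
    _ = C * (1 + R) * ((2 : ℝ) ^ (-((j : ℝ) * H)) *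
        ((2 : ℝ) ^ (η * |(j : ℝ)|) * (2 : ℝ) ^ (η * |(j : ℝ)|)) *
        min 1 ((2 : ℝ) ^ j * |x - y|)) * (decay 3 u + decay 3 v) := by ring
    _ ≤ C * (1 + R) * ((1 + 2 * R) * (2 : ℝ) ^ (-(δ * |(j : ℝ)|)) * |x - y| ^ γ) *
        (decay 3 u + decay 3 v) := by
        rw [hsq]; gcongr
    _ = _ := by ring

/-- One majorant serves the values at x and y and the increment, as telescoping of products
requires. It depends on x and y, but its sums and tails are bounded uniformly. -/
theorem exists_majorant (Φ : 𝓢(ℝ, ℂ)) {H γ η R : ℝ} (hγ : 0 < γ) (hη : 0 < η)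
    (hR : 0 < R) (h1 : γ + 2 * η < H) (h2 : H + 2 * η < 1) :
    ∃ (b : ℝ → ℝ → ℤ × ℤ → ℝ) (S : ℝ) (ε : ℕ → ℝ), Tendsto ε atTop (𝓝 0) ∧
      (∀ x y q, 0 ≤ b x y q) ∧
      ∀ x y, |x| ≤ R → |y| ≤ R →
        (∀ q, weight H η q * ‖waveInc Φ q x‖ ≤ b x y q ∧ weight H η q * ‖waveInc Φ q y‖ ≤ b x y q ∧
          weight H η q * ‖waveInc Φ q x - waveInc Φ q y‖ ≤ b x y q * |x - y| ^ γ) ∧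
        (∀ F : Finset (ℤ × ℤ), ∑ q ∈ F, b x y q ≤ S) ∧
        ∀ (n : ℕ) (F : Finset (ℤ × ℤ)), (∀ q ∈ F, q ∉ indexSet₁ n R) → ∑ q ∈ F, b x y q ≤ ε n := by
  -- The available decay is 2δ: one δ makes the sum over j converge, the other gives smallness of
  -- the tail.
  set δ := min (H - (γ + 2 * η)) (1 - (H + 2 * η)) / 2
  have hδ : 0 < δ := half_pos (lt_min (by linarith) (by linarith))
  have hδ1 : 2 * δ ≤ H - (γ + 2 * η) := by
    simp only [δ]; linarith [min_le_left (H - (γ + 2 * η)) (1 - (H + 2 * η))]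
  have hδ2 : 2 * δ ≤ 1 - (H + 2 * η) := by
    simp only [δ]; linarith [min_le_right (H - (γ + 2 * η)) (1 - (H + 2 * η))]
  obtain ⟨C, hC, h⟩ := exists_weight_mul_increment_le Φ (H := H) hγ hη (by linarith : 0 < 2 * δ) hR
    (by linarith) (by linarith)
  obtain ⟨D, hD, hsum⟩ := exists_sum_dyadic_decay_le hδ
  set B := C * (1 + R)
  have hB : 0 ≤ B := by positivity
  have hCB : C ≤ B := by simp only [B]; nlinarith
  let g : ℝ → ℤ × ℤ → ℝ := fun x q =>
    (2 : ℝ) ^ (-(2 * δ * |(q.1 : ℝ)|)) * decay 3 ((2 : ℝ) ^ q.1 * x - q.2)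
  have hg : ∀ x q, 0 ≤ g x q := fun x q => mul_nonneg (by positivity) (decay_nonneg _ _)
  have hgs : ∀ x (F : Finset (ℤ × ℤ)), ∑ q ∈ F, g x q ≤ D := fun x F => by
    refine (Finset.sum_le_sum fun q _ => ?_).trans (hsum x F)
    refine mul_le_mul ?_ ?_ (decay_nonneg _ _) (by positivity)
    · refine Real.rpow_le_rpow_of_exponent_le (by norm_num) ?_
      have : 0 ≤ δ * |(q.1 : ℝ)| := by positivity
      linarith
    · unfold decay
      gcongr
      · linarith [abs_nonneg ((2 : ℝ) ^ q.1 * x - q.2)]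
      · norm_num
  have hgt : ∀ x, |x| ≤ R → ∀ (n : ℕ) (F : Finset (ℤ × ℤ)), (∀ q ∈ F, q ∉ indexSet₁ n R) →
      ∑ q ∈ F, g x q ≤ tailFactor δ R n * D := fun x hx n F hF => by
    refine (Finset.sum_le_sum fun q hq => term_le_tailFactor_mul hδ hR (hF q hq) hx).trans ?_
    rw [← Finset.mul_sum]
    have : 0 ≤ tailFactor δ R n := by unfold tailFactor; positivity
    gcongr
    exact hsum x F
  have hx0 : |(0 : ℝ)| ≤ R := by simpa using hR.le
  have hpt : ∀ x, |x| ≤ R → ∀ q, weight H η q * ‖waveInc Φ q x‖ ≤ B * (g x q + g 0 q) := by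
    intro x hx q
    have h3 := h q x 0 hx hx0
    rw [waveInc_zero, sub_zero, sub_zero] at h3
    have h4 : |x| ^ γ ≤ 1 + R := by
      calc |x| ^ γ ≤ (1 + R) ^ γ := by gcongr; linarith
        _ ≤ (1 + R) ^ (1 : ℝ) := Real.rpow_le_rpow_of_exponent_le (by linarith) (by linarith)
        _ = _ := Real.rpow_one _
    refine h3.trans ?_
    calc _ ≤ C * (2 : ℝ) ^ (-(2 * δ * |(q.1 : ℝ)|)) *
        (decay 3 ((2 : ℝ) ^ q.1 * x - q.2) + decay 3 ((2 : ℝ) ^ q.1 * 0 - q.2)) * (1 + R) := by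
          have := decay_nonneg 3 ((2 : ℝ) ^ q.1 * x - q.2)
          have := decay_nonneg 3 ((2 : ℝ) ^ q.1 * 0 - q.2)
          gcongr
      _ = _ := by simp only [B, g]; ring
  -- The term at 0 appears because a value is estimated as an increment from 0, where `waveInc`
  -- vanishes.
  refine ⟨fun x y q => B * (g x q + g y q + g 0 q), B * (D + D + D),
    fun n => B * (tailFactor δ R n * D + tailFactor δ R n * D + tailFactor δ R n * D), ?_, ?_, ?_⟩
  · have ht := (tendsto_tailFactor (R := R) hδ).mul_const D
    have := ((ht.add ht).add ht).const_mul B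
    simpa using this
  · exact fun x y q => mul_nonneg hB (add_nonneg (add_nonneg (hg _ _) (hg _ _)) (hg _ _))
  · intro x y hx hy
    refine ⟨fun q => ⟨?_, ?_, ?_⟩, fun F => ?_, fun n F hF => ?_⟩
    · exact (hpt x hx q).trans (mul_le_mul_of_nonneg_left (by linarith [hg y q]) hB)
    · exact (hpt y hy q).trans (mul_le_mul_of_nonneg_left (by linarith [hg x q]) hB)
    · refine (h q x y hx hy).trans (mul_le_mul_of_nonneg_right ?_ (by positivity))
      calc _ = C * (g x q + g y q) := by simp only [g]; ring
        _ ≤ B * (g x q + g y q + g 0 q) := by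
          have := hg x q
          have := hg y q
          exact mul_le_mul hCB (by linarith [hg 0 q]) (by linarith) hB
    · rw [← Finset.mul_sum, Finset.sum_add_distrib, Finset.sum_add_distrib]
      exact mul_le_mul_of_nonneg_left
        (add_le_add (add_le_add (hgs _ _) (hgs _ _)) (hgs _ _)) hB
    · rw [← Finset.mul_sum, Finset.sum_add_distrib, Finset.sum_add_distrib]
      exact mul_le_mul_of_nonneg_left (add_le_add (add_le_add (hgt x hx n F hF)
        (hgt y hy n F hF)) (hgt 0 hx0 n F hF)) hB

/-! ### Products over the coordinates -/

theorem sum_indexSet_prod {A : Type*} [CommSemiring A] (n : ℕ) (R : ℝ) (f : Fin N → ℤ × ℤ → A) :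
    ∑ p ∈ indexSet N n R, ∏ l, f l (p.1 l, p.2 l) = ∏ l, ∑ q ∈ indexSet₁ n R, f l q := by
  rw [Finset.prod_univ_sum]
  refine Finset.sum_bij' (fun p _ l => (p.1 l, p.2 l)) (fun q _ => (fun l => (q l).1, fun l => (q l).2))
    ?_ ?_ ?_ ?_ ?_
  · intro p hp
    simp only [indexSet, Finset.mem_product, Fintype.mem_piFinset] at hp
    simp only [indexSet₁, Finset.mem_product, Fintype.mem_piFinset]
    exact fun l => ⟨hp.1 l, hp.2 l⟩
  · intro q hq
    simp only [indexSet₁, Finset.mem_product, Fintype.mem_piFinset] at hq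
    simp only [indexSet, Finset.mem_product, Fintype.mem_piFinset]
    exact ⟨fun l => (hq l).1, fun l => (hq l).2⟩
  all_goals simp

theorem indexSet₁_mono {R : ℝ} (hR : 0 ≤ R) {m n : ℕ} (h : n ≤ m) :
    indexSet₁ n R ⊆ indexSet₁ m R := by
  intro q hq
  rw [mem_indexSet₁] at *
  refine ⟨hq.1.trans (by exact_mod_cast h), hq.2.trans ?_⟩
  gcongr
  norm_num

theorem indexSet_mono {R : ℝ} (hR : 0 ≤ R) {m n : ℕ} (h : n ≤ m) :
    indexSet N n R ⊆ indexSet N m R := by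
  intro p hp
  rw [mem_indexSet] at *
  refine fun l => ⟨(hp l).1.trans (by exact_mod_cast h), (hp l).2.trans ?_⟩
  gcongr
  norm_num

/-- Telescoping, one factor at a time. It bounds the sum over the difference of two index sets,
which is not a product set but whose sum is a difference of two products. -/
theorem prod_sub_prod_le {ι : Type*} (s : Finset ι) {x y : ι → ℝ} {S ε : ℝ} (hS : 1 ≤ S)
    (hε : 0 ≤ ε) (hy : ∀ i, 0 ≤ y i) (hyx : ∀ i, y i ≤ x i) (hx : ∀ i, x i ≤ S)
    (hxy : ∀ i, x i - y i ≤ ε) : ∏ i ∈ s, x i - ∏ i ∈ s, y i ≤ s.card * ε * S ^ s.card := by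
  classical
  induction s using Finset.induction_on with
  | empty => simp
  | insert a s ha ih =>
    rw [Finset.prod_insert ha, Finset.prod_insert ha, Finset.card_insert_of_notMem ha]
    have h1 : ∏ i ∈ s, x i ≤ S ^ s.card := by
      rw [← Finset.prod_const]
      exact Finset.prod_le_prod (fun i _ => (hy i).trans (hyx i)) fun i _ => hx i
    have h1' : 0 ≤ ∏ i ∈ s, x i := Finset.prod_nonneg fun i _ => (hy i).trans (hyx i)
    have h2 : 0 ≤ ∏ i ∈ s, x i - ∏ i ∈ s, y i :=
      sub_nonneg.2 (Finset.prod_le_prod (fun i _ => hy i) fun i _ => hyx i)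
    have h3 : S ^ s.card ≤ S ^ (s.card + 1) := pow_le_pow_right₀ hS (by omega)
    calc x a * ∏ i ∈ s, x i - y a * ∏ i ∈ s, y i
        = (x a - y a) * ∏ i ∈ s, x i + y a * (∏ i ∈ s, x i - ∏ i ∈ s, y i) := by ring
      _ ≤ ε * S ^ (s.card + 1) + S * (s.card * ε * S ^ s.card) := by
        gcongr
        · exact hxy a
        · exact h1.trans h3
        · exact (hyx a).trans (hx a)
      _ = _ := by push_cast; ring

theorem norm_prod_sub_prod_le {ι : Type*} (s : Finset ι) {x y : ι → ℂ} {b : ι → ℝ} {D : ℝ}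
    (hD : 0 ≤ D) (hx : ∀ i, ‖x i‖ ≤ b i) (hy : ∀ i, ‖y i‖ ≤ b i)
    (hxy : ∀ i, ‖x i - y i‖ ≤ b i * D) :
    ‖∏ i ∈ s, x i - ∏ i ∈ s, y i‖ ≤ s.card * D * ∏ i ∈ s, b i := by
  classical
  have hb : ∀ i, 0 ≤ b i := fun i => (norm_nonneg _).trans (hx i)
  induction s using Finset.induction_on with
  | empty => simp
  | insert a s ha ih =>
    rw [Finset.prod_insert ha, Finset.prod_insert ha, Finset.card_insert_of_notMem ha,
      Finset.prod_insert ha]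
    have h1 : ‖∏ i ∈ s, x i‖ ≤ ∏ i ∈ s, b i := by
      rw [norm_prod]
      exact Finset.prod_le_prod (fun i _ => norm_nonneg _) fun i _ => hx i
    have hpb : 0 ≤ ∏ i ∈ s, b i := Finset.prod_nonneg fun i _ => hb i
    have hba := hb a
    calc ‖x a * ∏ i ∈ s, x i - y a * ∏ i ∈ s, y i‖
        = ‖(x a - y a) * ∏ i ∈ s, x i + y a * (∏ i ∈ s, x i - ∏ i ∈ s, y i)‖ := by
          congr 1; ring
      _ ≤ ‖x a - y a‖ * ‖∏ i ∈ s, x i‖ + ‖y a‖ * ‖∏ i ∈ s, x i - ∏ i ∈ s, y i‖ := by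
          rw [← norm_mul, ← norm_mul]; exact norm_add_le _ _
      _ ≤ (b a * D) * ∏ i ∈ s, b i + b a * (s.card * D * ∏ i ∈ s, b i) := by
          gcongr
          · exact hxy a
          · exact hy a
      _ = _ := by push_cast; ring

end
end HFSS

namespace HFSS
noncomputable section

variable {N : ℕ} {α : ℝ}

open scoped FourierTransform SchwartzMap

/-! ### Uniform convergence of the series in Hölder norm -/

/-- The finite wavelet sum with coefficients `c` over the index set `F`. -/
def waveSum (Φ : Fin N → ℝ → ℂ) (H : Fin N → ℝ) (c : (Fin N → ℤ) → (Fin N → ℤ) → ℂ)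
    (F : Finset ((Fin N → ℤ) × (Fin N → ℤ))) (t : E N) : ℂ :=
  ∑ p ∈ F, (((2 : ℝ) ^ (-(∑ l, (p.1 l : ℝ) * H l)) : ℝ) : ℂ) * c p.1 p.2 *
    ∏ l, waveInc (Φ l) (p.1 l, p.2 l) (t l)

theorem norm_mul_le_prod_weight {H : Fin N → ℝ} {η C : ℝ} {c : ℂ} {J K : Fin N → ℤ}
    (hc : ‖c‖ ≤ C * ∏ l, ((2 : ℝ) ^ (η * |(J l : ℝ)|) * (1 + |(K l : ℝ)|) ^ η)) :
    ‖(((2 : ℝ) ^ (-(∑ l, (J l : ℝ) * H l)) : ℝ) : ℂ) * c‖ ≤ C * ∏ l, weight (H l) η (J l, K l) := by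
  have h1 : ∏ l, weight (H l) η (J l, K l) = (2 : ℝ) ^ (-(∑ l, (J l : ℝ) * H l)) *
      ∏ l, ((2 : ℝ) ^ (η * |(J l : ℝ)|) * (1 + |(K l : ℝ)|) ^ η) := by
    rw [← Finset.sum_neg_distrib, Real.rpow_sum_of_pos (by norm_num), ← Finset.prod_mul_distrib]
    rfl
  rw [norm_mul, Complex.norm_real, Real.norm_of_nonneg (by positivity), h1, mul_left_comm]
  gcongr

theorem norm_waveSum_le {Φ : Fin N → ℝ → ℂ} {H : Fin N → ℝ} {η C γ : ℝ} (hC : 0 ≤ C) (hγ : 0 < γ)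
    {c : (Fin N → ℤ) → (Fin N → ℤ) → ℂ}
    (hc : ∀ J K, ‖c J K‖ ≤ C * ∏ l, ((2 : ℝ) ^ (η * |(J l : ℝ)|) * (1 + |(K l : ℝ)|) ^ η))
    {t s : E N} {b : Fin N → ℤ × ℤ → ℝ}
    (hb : ∀ l q, weight (H l) η q * ‖waveInc (Φ l) q (t l)‖ ≤ b l q ∧
      weight (H l) η q * ‖waveInc (Φ l) q (s l)‖ ≤ b l q ∧
      weight (H l) η q * ‖waveInc (Φ l) q (t l) - waveInc (Φ l) q (s l)‖ ≤
        b l q * |t l - s l| ^ γ) (F : Finset ((Fin N → ℤ) × (Fin N → ℤ))) :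
    ‖waveSum Φ H c F t‖ ≤ C * ∑ p ∈ F, ∏ l, b l (p.1 l, p.2 l) ∧
    ‖waveSum Φ H c F t - waveSum Φ H c F s‖ ≤
      (C * N * ∑ p ∈ F, ∏ l, b l (p.1 l, p.2 l)) * ‖t - s‖ ^ γ := by
  have hw : ∀ l q, ‖((weight (H l) η q : ℝ) : ℂ)‖ = weight (H l) η q := fun l q => by
    rw [Complex.norm_real, Real.norm_of_nonneg (weight_nonneg _ _ _)]
  constructor
  · rw [waveSum, Finset.mul_sum]
    refine norm_sum_le_of_le _ fun p _ => ?_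
    rw [norm_mul, norm_prod]
    calc _ ≤ (C * ∏ l, weight (H l) η (p.1 l, p.2 l)) *
          ∏ l, ‖waveInc (Φ l) (p.1 l, p.2 l) (t l)‖ := by
          gcongr
          exact norm_mul_le_prod_weight (hc _ _)
      _ = C * ∏ l, (weight (H l) η (p.1 l, p.2 l) *
          ‖waveInc (Φ l) (p.1 l, p.2 l) (t l)‖) := by rw [Finset.prod_mul_distrib, mul_assoc]
      _ ≤ _ := by
          gcongr with l _
          · exact fun l _ => mul_nonneg (weight_nonneg _ _ _) (norm_nonneg _)
          · exact (hb l _).1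
  · rw [waveSum, waveSum, ← Finset.sum_sub_distrib, Finset.mul_sum, Finset.sum_mul]
    refine norm_sum_le_of_le _ fun p _ => ?_
    rw [← mul_sub, norm_mul]
    have h1 := norm_prod_sub_prod_le (Finset.univ : Finset (Fin N)) (D := ‖t - s‖ ^ γ)
      (x := fun l => ((weight (H l) η (p.1 l, p.2 l) : ℝ) : ℂ) *
        waveInc (Φ l) (p.1 l, p.2 l) (t l))
      (y := fun l => ((weight (H l) η (p.1 l, p.2 l) : ℝ) : ℂ) *
        waveInc (Φ l) (p.1 l, p.2 l) (s l))
      (b := fun l => b l (p.1 l, p.2 l)) (by positivity)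
      (fun l => by rw [norm_mul, hw]; exact (hb l _).1)
      (fun l => by rw [norm_mul, hw]; exact (hb l _).2.1)
      (fun l => by
        rw [← mul_sub, norm_mul, hw]
        have h0 : 0 ≤ b l (p.1 l, p.2 l) :=
          (mul_nonneg (weight_nonneg _ _ _) (norm_nonneg _)).trans (hb l _).1
        refine (hb l _).2.2.trans (mul_le_mul_of_nonneg_left ?_ h0)
        have h3 := PiLp.norm_apply_le (t - s) l
        rw [PiLp.sub_apply, Real.norm_eq_abs] at h3
        gcongr)
    rw [Finset.prod_mul_distrib, Finset.prod_mul_distrib, ← mul_sub, norm_mul, norm_prod] at h1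
    simp only [hw, Finset.card_univ, Fintype.card_fin] at h1
    calc _ ≤ (C * ∏ l, weight (H l) η (p.1 l, p.2 l)) *
          ‖∏ l, waveInc (Φ l) (p.1 l, p.2 l) (t l) -
            ∏ l, waveInc (Φ l) (p.1 l, p.2 l) (s l)‖ := by
          gcongr
          exact norm_mul_le_prod_weight (hc _ _)
      _ = C * ((∏ l, weight (H l) η (p.1 l, p.2 l)) *
          ‖∏ l, waveInc (Φ l) (p.1 l, p.2 l) (t l) -
            ∏ l, waveInc (Φ l) (p.1 l, p.2 l) (s l)‖) := mul_assoc _ _ _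
      _ ≤ C * (N * ‖t - s‖ ^ γ * ∏ l, b l (p.1 l, p.2 l)) := by gcongr
      _ = _ := by ring

/-- Each term is at most a product of one-dimensional majorants, times N‖t - s‖^γ for increments.
Sums over the index sets then factor, and the tail is small as soon as every one-dimensional tail
is. -/
theorem exists_waveSum_bounds (Φ : Fin N → 𝓢(ℝ, ℂ)) {H : Fin N → ℝ} {η C γ R : ℝ} (hC : 0 ≤ C)
    (hγ : 0 < γ) (hη : 0 < η) (hR : 0 < R) (h1 : ∀ l, γ + 2 * η < H l) (h2 : ∀ l, H l + 2 * η < 1)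
    {c : (Fin N → ℤ) → (Fin N → ℤ) → ℂ}
    (hc : ∀ J K, ‖c J K‖ ≤ C * ∏ l, ((2 : ℝ) ^ (η * |(J l : ℝ)|) * (1 + |(K l : ℝ)|) ^ η)) :
    ∃ (S : ℝ) (ε : ℕ → ℝ), 0 ≤ S ∧ (∀ n, 0 ≤ ε n) ∧ Tendsto ε atTop (𝓝 0) ∧
      ∀ t ∈ cube N R, ∀ s ∈ cube N R, ∀ n,
        (‖waveSum (fun l => Φ l) H c (indexSet N n R) t‖ ≤ S ∧
          ‖waveSum (fun l => Φ l) H c (indexSet N n R) t -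
            waveSum (fun l => Φ l) H c (indexSet N n R) s‖ ≤ S * ‖t - s‖ ^ γ) ∧
        ∀ m, n ≤ m →
          ‖waveSum (fun l => Φ l) H c (indexSet N m R) t -
            waveSum (fun l => Φ l) H c (indexSet N n R) t‖ ≤ ε n ∧
          ‖(waveSum (fun l => Φ l) H c (indexSet N m R) t -
            waveSum (fun l => Φ l) H c (indexSet N n R) t) -
            (waveSum (fun l => Φ l) H c (indexSet N m R) s -
            waveSum (fun l => Φ l) H c (indexSet N n R) s)‖ ≤ ε n * ‖t - s‖ ^ γ := by
  choose b S ε hε hb0 hb using fun l => exists_majorant (Φ l) hγ hη hR (h1 l) (h2 l)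
  set T : ℝ := 1 + ∑ l, |S l|
  have hT : 1 ≤ T := by
    simp only [T]; linarith [Finset.sum_nonneg fun l (_ : l ∈ Finset.univ) => abs_nonneg (S l)]
  have hST : ∀ l, S l ≤ T := fun l => by
    have := Finset.single_le_sum (fun i _ => abs_nonneg (S i)) (Finset.mem_univ l)
    simp only [T]; linarith [le_abs_self (S l)]
  set e : ℕ → ℝ := fun n => ∑ l, |ε l n|
  have he0 : ∀ n, 0 ≤ e n := fun n => Finset.sum_nonneg fun l _ => abs_nonneg _
  have hεe : ∀ l n, ε l n ≤ e n := fun l n =>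
    (le_abs_self _).trans (Finset.single_le_sum (f := fun i => |ε i n|)
      (fun i _ => abs_nonneg (ε i n)) (Finset.mem_univ l))
  have he : Tendsto e atTop (𝓝 0) := by
    have := tendsto_finsetSum (Finset.univ : Finset (Fin N)) fun l _ => (hε l).abs
    simpa using this
  have hsub : ∀ {m n : ℕ}, n ≤ m → ∀ u, waveSum (fun l => Φ l) H c (indexSet N m R) u -
      waveSum (fun l => Φ l) H c (indexSet N n R) u =
      waveSum (fun l => Φ l) H c (indexSet N m R \ indexSet N n R) u := by
    intro m n hnm u
    rw [sub_eq_iff_eq_add]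
    exact (Finset.sum_sdiff (indexSet_mono hR.le hnm)).symm
  refine ⟨C * T ^ N + C * N * T ^ N, fun n => C * (N * e n * T ^ N) + C * N * (N * e n * T ^ N),
    by positivity, fun n => by have := he0 n; positivity, ?_, ?_⟩
  · have h3 := ((he.const_mul (N : ℝ)).mul_const (T ^ N))
    have := (h3.const_mul C).add (h3.const_mul (C * N))
    simpa using this
  intro t ht s hs n
  have hbl := fun l => hb l (t l) (s l) (ht l) (hs l)
  have key := norm_waveSum_le (Φ := fun l => ⇑(Φ l)) (H := H) hC hγ hc (t := t) (s := s)
    (b := fun l => b l (t l) (s l)) (fun l q => (hbl l).1 q)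
  have hS0 : ∀ k l, 0 ≤ ∑ q ∈ indexSet₁ k R, b l (t l) (s l) q := fun k l =>
    Finset.sum_nonneg fun q _ => hb0 l _ _ q
  have hsumle : ∀ k l, ∑ q ∈ indexSet₁ k R, b l (t l) (s l) q ≤ T := fun k l =>
    ((hbl l).2.1 _).trans (hST l)
  have hprod : ∀ k, ∑ p ∈ indexSet N k R, ∏ l, b l (t l) (s l) (p.1 l, p.2 l) ≤ T ^ N := by
    intro k
    rw [sum_indexSet_prod k R (fun l => b l (t l) (s l))]
    calc _ ≤ ∏ _l : Fin N, T := Finset.prod_le_prod (fun l _ => hS0 k l) fun l _ => hsumle k l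
      _ = T ^ N := by simp
  have hCT : 0 ≤ C * T ^ N := by positivity
  have hCNT : 0 ≤ C * N * T ^ N := by positivity
  refine ⟨⟨?_, ?_⟩, fun m hnm => ?_⟩
  · refine (key _).1.trans ((mul_le_mul_of_nonneg_left (hprod n) hC).trans (by linarith))
  · refine (key _).2.trans (mul_le_mul_of_nonneg_right ?_ (by positivity))
    exact (mul_le_mul_of_nonneg_left (hprod n) (by positivity)).trans (by linarith)
  · have hdiff : ∑ p ∈ indexSet N m R \ indexSet N n R,
        ∏ l, b l (t l) (s l) (p.1 l, p.2 l) ≤ N * e n * T ^ N := by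
      rw [Finset.sum_sdiff_eq_sub (indexSet_mono hR.le hnm),
        sum_indexSet_prod m R (fun l => b l (t l) (s l)),
        sum_indexSet_prod n R (fun l => b l (t l) (s l))]
      have h3 := prod_sub_prod_le (Finset.univ : Finset (Fin N)) (S := T) (ε := e n)
        (x := fun l => ∑ q ∈ indexSet₁ m R, b l (t l) (s l) q)
        (y := fun l => ∑ q ∈ indexSet₁ n R, b l (t l) (s l) q) hT (he0 n) (hS0 n)
        (fun l => Finset.sum_le_sum_of_subset_of_nonneg (indexSet₁_mono hR.le hnm)
          fun q _ _ => hb0 l _ _ q) (hsumle m)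
        (fun l => by
          rw [← Finset.sum_sdiff_eq_sub (indexSet₁_mono hR.le hnm)]
          exact ((hbl l).2.2 n _ fun q hq => (Finset.mem_sdiff.1 hq).2).trans (hεe l n))
      simpa using h3
    have hen := he0 n
    have h4 : 0 ≤ C * (N * e n * T ^ N) := by positivity
    have h5 : 0 ≤ C * N * (N * e n * T ^ N) := by positivity
    rw [hsub hnm, hsub hnm]
    refine ⟨(key _).1.trans ((mul_le_mul_of_nonneg_left hdiff hC).trans (by linarith)), ?_⟩
    refine (key _).2.trans (mul_le_mul_of_nonneg_right ?_ (by positivity))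
    exact (mul_le_mul_of_nonneg_left hdiff (by positivity)).trans (by linarith)

/-! ### Almost sure Hölder convergence of the random series -/

theorem holderNorm_le {γ : ℝ≥0} {S : Set (E N)} {f : E N → ℝ} {e : ℝ} (he : 0 ≤ e)
    (h1 : ∀ t ∈ S, |f t| ≤ e) (h2 : ∀ t ∈ S, ∀ s ∈ S, |f t - f s| ≤ e * ‖t - s‖ ^ (γ : ℝ)) :
    holderNorm γ S f ≤ ENNReal.ofReal e + ENNReal.ofReal e := by
  refine add_le_add (iSup₂_le fun t ht => ?_) ?_
  · rw [← ofReal_norm]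
    exact ENNReal.ofReal_le_ofReal (h1 t ht)
  · have hH : HolderWith e.toNNReal γ fun t : S => f t := by
      intro t s
      rw [edist_dist, Real.dist_eq, edist_dist, Subtype.dist_eq, dist_eq_norm,
        ENNReal.ofReal_rpow_of_nonneg (norm_nonneg _) γ.coe_nonneg]
      change _ ≤ ENNReal.ofReal e * _
      rw [← ENNReal.ofReal_mul he]
      exact ENNReal.ofReal_le_ofReal (h2 t t.2 s s.2)
    exact hH.eHolderNorm_le

variable {Ω : Type*} [MeasurableSpace Ω] {P : Measure Ω} {M : Set (E N) → Ω → ℂ}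

theorem partialSeries_eq_waveSum (H : Fin N → ℝ) (ψ : SchwartzMap ℝ ℝ) (R : ℝ) (n : ℕ) (t : E N)
    (ω : Ω) : partialSeries α H ψ P M R n t ω = (waveSum (fun l => fracPrim α ψ (H l)) H
      (fun J K => coeff α ψ P M J K ω) (indexSet N n R) t).re := rfl

/-- Choosing η among the numbers 1/(i+1) leaves only countably many coefficient bounds to be
required, so one null set serves all γ at once. -/
theorem exists_nat_gap {γ : ℝ} {H : Fin N → ℝ} (hH : ∀ l, H l < 1) (hγ : ∀ l, γ < H l) :
    ∃ i : ℕ, ∀ l, γ + 2 * (1 / ((i : ℝ) + 1)) < H l ∧ H l + 2 * (1 / ((i : ℝ) + 1)) < 1 := by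
  have h0 : Tendsto (fun i : ℕ => 2 * (1 / ((i : ℝ) + 1))) atTop (𝓝 0) := by
    simpa using (tendsto_one_div_add_atTop_nhds_zero_nat (𝕜 := ℝ)).const_mul 2
  have h : ∀ᶠ i : ℕ in atTop, ∀ l,
      γ + 2 * (1 / ((i : ℝ) + 1)) < H l ∧ H l + 2 * (1 / ((i : ℝ) + 1)) < 1 := by
    refine eventually_all.2 fun l => ?_
    filter_upwards [h0.eventually_lt_const (sub_pos.2 (hγ l)),
      h0.eventually_lt_const (sub_pos.2 (hH l))] with i h1 h2
    exact ⟨by linarith, by linarith⟩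
  exact h.exists

theorem ae_partialSeries_bounds [IsProbabilityMeasure P] (hM : IsIsotropicStableMeasure α P M)
    (hα0 : 0 < α) (hα2 : α < 2) {ψ : SchwartzMap ℝ ℝ} (hψ : IsLemarieMeyer ψ) {H : Fin N → ℝ}
    (hH : ∀ l, H l < 1) {R : ℝ} (hR : 0 < R) :
    ∀ᵐ ω ∂P, ∀ γ : ℝ, 0 < γ → (∀ l, γ < H l) → ∃ (S : ℝ) (ε : ℕ → ℝ), 0 ≤ S ∧ (∀ n, 0 ≤ ε n) ∧
      Tendsto ε atTop (𝓝 0) ∧ ∀ t ∈ cube N R, ∀ s ∈ cube N R, ∀ n,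
        (|partialSeries α H ψ P M R n t ω| ≤ S ∧
          |partialSeries α H ψ P M R n t ω - partialSeries α H ψ P M R n s ω| ≤
            S * ‖t - s‖ ^ γ) ∧
        ∀ m, n ≤ m →
          |partialSeries α H ψ P M R m t ω - partialSeries α H ψ P M R n t ω| ≤ ε n ∧
          |(partialSeries α H ψ P M R m t ω - partialSeries α H ψ P M R n t ω) -
            (partialSeries α H ψ P M R m s ω - partialSeries α H ψ P M R n s ω)| ≤
              ε n * ‖t - s‖ ^ γ := by
  choose Φ hΦ using fun l => exists_schwartzMap_eq_fracPrim (α := α) hψ (H l)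
  have hΦ' : (fun l => fracPrim α ψ (H l)) = fun l => ⇑(Φ l) := funext fun l => funext (hΦ l)
  have h1 : ∀ i : ℕ, ∀ᵐ ω ∂P, ∃ C : ℝ, 0 ≤ C ∧ ∀ J K, ‖coeff α ψ P M J K ω‖ ≤
      C * ∏ l, ((2 : ℝ) ^ (1 / ((i : ℝ) + 1) * |(J l : ℝ)|) *
        (1 + |(K l : ℝ)|) ^ (1 / ((i : ℝ) + 1))) := fun i =>
    ae_exists_coeff_bound hM hα0 hα2 hψ (by positivity)
  filter_upwards [ae_all_iff.2 h1] with ω hω γ hγ hγH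
  obtain ⟨i, hi⟩ := exists_nat_gap hH hγH
  obtain ⟨C, hC, hc⟩ := hω i
  obtain ⟨S, ε, hS, hε, hlim, h⟩ := exists_waveSum_bounds Φ hC hγ (by positivity) hR
    (fun l => (hi l).1) (fun l => (hi l).2) hc
  refine ⟨S, ε, hS, hε, hlim, fun t ht s hs n => ?_⟩
  simp only [partialSeries_eq_waveSum, hΦ', ← Complex.sub_re]
  obtain ⟨⟨h2, h3⟩, h4⟩ := h t ht s hs n
  exact ⟨⟨(Complex.abs_re_le_norm _).trans h2, (Complex.abs_re_le_norm _).trans h3⟩,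
    fun m hnm => ⟨(Complex.abs_re_le_norm _).trans (h4 m hnm).1,
      (Complex.abs_re_le_norm _).trans (h4 m hnm).2⟩⟩

/-- The limit of the truncated series. -/
def limitField (α : ℝ) (H : Fin N → ℝ) (ψ : SchwartzMap ℝ ℝ) (P : Measure Ω)
    (M : Set (E N) → Ω → ℂ) (R : ℝ) (t : E N) (ω : Ω) : ℝ :=
  limsup (fun n => partialSeries α H ψ P M R n t ω) atTop

theorem measurable_partialSeries (H : Fin N → ℝ) (ψ : SchwartzMap ℝ ℝ) (R : ℝ) (n : ℕ) (t : E N) :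
    Measurable (partialSeries α H ψ P M R n t) := by
  refine Complex.measurable_re.comp (Finset.measurable_sum _ fun p _ => ?_)
  exact ((measurable_stableIntegral _).const_mul _).mul_const _

/-- Defining the limit as a limsup makes it measurable with no regard to the null set where the
series may diverge. -/
theorem measurable_limitField (H : Fin N → ℝ) (ψ : SchwartzMap ℝ ℝ) (R : ℝ) (t : E N) :
    Measurable (limitField α H ψ P M R t) :=
  Measurable.limsup fun n => measurable_partialSeries H ψ R n t

theorem ae_tendsto_limitField [IsProbabilityMeasure P] (hM : IsIsotropicStableMeasure α P M)
    (hα0 : 0 < α) (hα2 : α < 2) {ψ : SchwartzMap ℝ ℝ} (hψ : IsLemarieMeyer ψ) {H : Fin N → ℝ}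
    (hH : ∀ l, 0 < H l ∧ H l < 1) {R : ℝ} (hR : 0 < R) :
    ∀ᵐ ω ∂P, ∀ t ∈ cube N R, Tendsto (fun n => partialSeries α H ψ P M R n t ω) atTop
      (𝓝 (limitField α H ψ P M R t ω)) := by
  obtain ⟨i, hi⟩ := exists_nat_gap (fun l => (hH l).2) (fun l => (hH l).1)
  filter_upwards [ae_partialSeries_bounds hM hα0 hα2 hψ (fun l => (hH l).2) hR] with ω hω t ht
  obtain ⟨S, ε, -, -, hlim, h⟩ := hω (1 / ((i : ℝ) + 1)) (by positivity) (fun l => by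
    have : (0 : ℝ) < 1 / ((i : ℝ) + 1) := by positivity
    linarith [(hi l).1])
  have hc : CauchySeq fun n => partialSeries α H ψ P M R n t ω := by
    refine cauchySeq_of_le_tendsto_0 (fun n => ε n + ε n) (fun m n k hm hn => ?_)
      (by simpa using hlim.add hlim)
    have h1 := ((h t ht t ht k).2 m hm).1
    have h2 := ((h t ht t ht k).2 n hn).1
    rw [Real.dist_eq]
    calc _ ≤ _ := abs_sub_le _ (partialSeries α H ψ P M R k t ω) _
      _ ≤ ε k + ε k := add_le_add h1 (by rwa [abs_sub_comm])
  obtain ⟨z, hz⟩ := cauchySeq_tendsto_of_complete hc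
  rw [limitField, hz.limsup_eq]
  exact hz

theorem ae_limitField_holder [IsProbabilityMeasure P] (hM : IsIsotropicStableMeasure α P M)
    (hα0 : 0 < α) (hα2 : α < 2) {ψ : SchwartzMap ℝ ℝ} (hψ : IsLemarieMeyer ψ) {H : Fin N → ℝ}
    (hH : ∀ l, 0 < H l ∧ H l < 1) {R : ℝ} (hR : 0 < R) :
    ∀ᵐ ω ∂P, ∀ γ : ℝ≥0, 0 < γ → (∀ l, (γ : ℝ) < H l) →
      holderNorm γ (cube N R) (fun t => limitField α H ψ P M R t ω) < ∞ ∧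
      Tendsto (fun n => holderNorm γ (cube N R)
        (fun t => partialSeries α H ψ P M R n t ω - limitField α H ψ P M R t ω)) atTop (𝓝 0) := by
  filter_upwards [ae_partialSeries_bounds hM hα0 hα2 hψ (fun l => (hH l).2) hR,
    ae_tendsto_limitField hM hα0 hα2 hψ hH hR] with ω hω hlim γ hγ hγH
  obtain ⟨S, ε, hS, hε, hε0, h⟩ := hω γ (by exact_mod_cast hγ) hγH
  constructor
  · refine (holderNorm_le hS (fun t ht => ?_) (fun t ht s hs => ?_)).trans_lt (by simp)
    · exact le_of_tendsto' (hlim t ht).abs fun n => (h t ht t ht n).1.1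
    · exact le_of_tendsto' ((hlim t ht).sub (hlim s hs)).abs fun n => (h t ht s hs n).1.2
  · have h0 : Tendsto (fun n => ENNReal.ofReal (ε n) + ENNReal.ofReal (ε n)) atTop (𝓝 0) := by
      have := ENNReal.tendsto_ofReal hε0
      rw [ENNReal.ofReal_zero] at this
      simpa using this.add this
    refine tendsto_of_tendsto_of_tendsto_of_le_of_le tendsto_const_nhds h0 (fun _ => zero_le)
      fun n => holderNorm_le (hε n) (fun t ht => ?_) (fun t ht s hs => ?_)
    · rw [abs_sub_comm]
      refine le_of_tendsto ((hlim t ht).sub_const _).abs ?_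
      filter_upwards [eventually_ge_atTop n] with m hm
      exact ((h t ht t ht n).2 m hm).1
    · have h3 : ∀ a b c d : ℝ, |a - b - (c - d)| = |b - a - (d - c)| := fun a b c d => by
        rw [← abs_neg]; congr 1; ring
      rw [h3]
      refine le_of_tendsto (((hlim t ht).sub_const _).sub ((hlim s hs).sub_const _)).abs ?_
      filter_upwards [eventually_ge_atTop n] with m hm
      exact ((h t ht s hs n).2 m hm).2

theorem ae_partialSeries_cauchy [IsProbabilityMeasure P] (hM : IsIsotropicStableMeasure α P M)
    (hα0 : 0 < α) (hα2 : α < 2) {ψ : SchwartzMap ℝ ℝ} (hψ : IsLemarieMeyer ψ) {H : Fin N → ℝ}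
    (hH : ∀ l, 0 < H l ∧ H l < 1) {R : ℝ} (hR : 0 < R) :
    ∀ᵐ ω ∂P, ∀ γ : ℝ≥0, 0 < γ → (∀ l, (γ : ℝ) < H l) →
      (∀ n, holderNorm γ (cube N R) (fun t => partialSeries α H ψ P M R n t ω) < ∞) ∧
      ∀ η : ℝ≥0∞, 0 < η → ∃ n₀ : ℕ, ∀ m n : ℕ, n₀ ≤ m → n₀ ≤ n →
        holderNorm γ (cube N R) (fun t => partialSeries α H ψ P M R m t ω -
          partialSeries α H ψ P M R n t ω) ≤ η := by
  filter_upwards [ae_partialSeries_bounds hM hα0 hα2 hψ (fun l => (hH l).2) hR] with ω hω γ hγ hγH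
  obtain ⟨S, ε, hS, hε, hε0, h⟩ := hω γ (by exact_mod_cast hγ) hγH
  refine ⟨fun n => (holderNorm_le hS (fun t ht => (h t ht t ht n).1.1)
    (fun t ht s hs => (h t ht s hs n).1.2)).trans_lt (by simp), fun η hη => ?_⟩
  have h0 : Tendsto (fun n => ENNReal.ofReal (ε n) + ENNReal.ofReal (ε n)) atTop (𝓝 0) := by
    have := ENNReal.tendsto_ofReal hε0
    rw [ENNReal.ofReal_zero] at this
    simpa using this.add this
  obtain ⟨n₀, hn₀⟩ := eventually_atTop.1 (h0.eventually_lt_const hη)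
  refine ⟨n₀, fun m n hm hn => ?_⟩
  rcases le_total n m with hnm | hnm
  · exact (holderNorm_le (hε n) (fun t ht => ((h t ht t ht n).2 m hnm).1)
      (fun t ht s hs => ((h t ht s hs n).2 m hnm).2)).trans (hn₀ n hn).le
  · refine (holderNorm_le (hε m) (fun t ht => ?_) (fun t ht s hs => ?_)).trans (hn₀ m hm).le
    · rw [abs_sub_comm]
      exact ((h t ht t ht m).2 n hnm).1
    · have h3 : ∀ a b c d : ℝ, |a - b - (c - d)| = |b - a - (d - c)| := fun a b c d => by
        rw [← abs_neg]; congr 1; ring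
      rw [h3]
      exact ((h t ht s hs m).2 n hnm).2

end
end HFSS

namespace HFSS
noncomputable section

variable {α : ℝ}

open scoped FourierTransform SchwartzMap

/-! ### The wavelet expansion of the one-dimensional kernel -/

/-- The wavelet `2^(j/2) ψ(2^j x - k)` as a Schwartz function. -/
def wavelet (ψ : SchwartzMap ℝ ℝ) (q : ℤ × ℤ) : 𝓢(ℝ, ℂ) :=
  (((2 : ℝ) ^ ((q.1 : ℝ) / 2) : ℝ) : ℂ) • SchwartzMap.compCLMOfContinuousLinearEquiv ℂ
    (ContinuousLinearEquiv.smulLeft (R₁ := ℝ) (M₁ := ℝ)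
      (Units.mk0 ((2 : ℝ) ^ q.1) (by positivity)))
    (SchwartzMap.compSubConstCLM ℂ (q.2 : ℝ) (cpx ψ))

theorem wavelet_apply (ψ : SchwartzMap ℝ ℝ) (q : ℤ × ℤ) (x : ℝ) :
    wavelet ψ q x = (((2 : ℝ) ^ ((q.1 : ℝ) / 2) : ℝ) : ℂ) * cpx ψ ((2 : ℝ) ^ q.1 * x - q.2) := rfl

theorem fourier_cpx (ψ : SchwartzMap ℝ ℝ) (μ : ℝ) :
    (𝓕 (cpx ψ)) μ = (Real.sqrt (2 * Real.pi) : ℂ) * hat ψ (2 * Real.pi * μ) := by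
  have h : (Real.sqrt (2 * Real.pi) : ℂ) ≠ 0 := by
    exact_mod_cast (Real.sqrt_pos.2 (by positivity)).ne'
  rw [hat_eq_fourier, ← mul_assoc, mul_inv_cancel₀ h, one_mul]
  congr 1
  field_simp

/-- The normalization between the `L²` and the `L^α` wavelets. -/
def normConst (α : ℝ) (j : ℤ) : ℝ :=
  Real.sqrt (2 * Real.pi) * (2 : ℝ) ^ (-((j : ℝ) / 2)) * (2 : ℝ) ^ ((j : ℝ) / α)

/-- Substitute y = 2^j x - k. `normConst` converts the L² normalization into the L^α one and
restores the factor √(2π) of `hat`. -/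
theorem fourier_wavelet (ψ : SchwartzMap ℝ ℝ) (q : ℤ × ℤ) (ν : ℝ) :
    (𝓕 (wavelet ψ q)) ν =
      (normConst α q.1 : ℂ) * hatNormalized α ψ q.1 q.2 (2 * Real.pi * ν) := by
  obtain ⟨j, k⟩ := q
  have h2j : (0 : ℝ) < 2 ^ j := by positivity
  set F : ℝ → ℂ := fun y => Complex.exp (((-2 * Real.pi * ((2 : ℝ) ^ (-j) * (y + k)) * ν : ℝ) : ℂ) *
    Complex.I) * cpx ψ y
  have h1 : (𝓕 (wavelet ψ (j, k))) ν = (((2 : ℝ) ^ ((j : ℝ) / 2) : ℝ) : ℂ) *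
      ∫ x, F ((2 : ℝ) ^ j * x - k) := by
    rw [SchwartzMap.fourier_coe, Real.fourier_real_eq_integral_exp_smul, ← integral_const_mul]
    refine integral_congr_ae (Eventually.of_forall fun x => ?_)
    simp only [wavelet_apply, F, smul_eq_mul]
    rw [mul_left_comm]
    congr 5
    rw [sub_add_cancel, zpow_neg]
    field_simp
  have h2 : ∫ x, F ((2 : ℝ) ^ j * x - k) = (((2 : ℝ) ^ (-j) : ℝ) : ℂ) * ∫ y, F y := by
    rw [Measure.integral_comp_mul_left (fun y => F (y - k)), integral_sub_right_eq_self F,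
      abs_of_pos (inv_pos.2 h2j), zpow_neg, Complex.real_smul]
  have h3 : ∫ y, F y = Complex.exp (-(Complex.I * ((k : ℝ) * (2 : ℝ) ^ (-j) *
      (2 * Real.pi * ν) : ℝ))) * (𝓕 (cpx ψ)) ((2 : ℝ) ^ (-j) * ν) := by
    rw [SchwartzMap.fourier_coe, Real.fourier_real_eq_integral_exp_smul, ← integral_const_mul]
    refine integral_congr_ae (Eventually.of_forall fun y => ?_)
    simp only [F, smul_eq_mul]
    rw [← mul_assoc (Complex.exp (-(Complex.I * _))) _ (cpx ψ y), ← Complex.exp_add]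
    congr 2
    push_cast
    ring
  rw [h1, h2, h3, fourier_cpx, hatNormalized, normConst]
  have h4 : (2 : ℝ) ^ ((j : ℝ) / 2) * (2 : ℝ) ^ (-j) = (2 : ℝ) ^ (-((j : ℝ) / 2)) := by
    rw [← Real.rpow_intCast, ← Real.rpow_add (by norm_num)]
    congr 1
    push_cast
    ring
  have h5 : (2 : ℝ) ^ ((j : ℝ) / α) * (2 : ℝ) ^ (-((j : ℝ) / α)) = 1 := by
    rw [← Real.rpow_add (by norm_num), add_neg_cancel, Real.rpow_zero]
  have h4' : (((2 : ℝ) ^ ((j : ℝ) / 2) : ℝ) : ℂ) * (((2 : ℝ) ^ (-j) : ℝ) : ℂ) =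
      (((2 : ℝ) ^ (-((j : ℝ) / 2)) : ℝ) : ℂ) := by exact_mod_cast h4
  have h5' : (((2 : ℝ) ^ ((j : ℝ) / α) : ℝ) : ℂ) * (((2 : ℝ) ^ (-((j : ℝ) / α)) : ℝ) : ℂ) = 1 := by
    exact_mod_cast h5
  rw [show 2 * Real.pi * ((2 : ℝ) ^ (-j) * ν) = (2 : ℝ) ^ (-j) * (2 * Real.pi * ν) by ring]
  set e := Complex.exp (-(Complex.I * ((k : ℝ) * (2 : ℝ) ^ (-j) * (2 * Real.pi * ν) : ℝ)))
  set g := hat ψ ((2 : ℝ) ^ (-j) * (2 * Real.pi * ν))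
  push_cast [-Complex.ofReal_zpow] at h4' h5' ⊢
  calc _ = (((2 : ℝ) ^ ((j : ℝ) / 2) : ℝ) : ℂ) * (((2 : ℝ) ^ (-j) : ℝ) : ℂ) *
        (Real.sqrt (2 * Real.pi) : ℂ) * e * g := by push_cast; ring
    _ = (((2 : ℝ) ^ (-((j : ℝ) / 2)) : ℝ) : ℂ) * 1 * (Real.sqrt (2 * Real.pi) : ℂ) * e * g := by
      rw [mul_one]; congr 3
    _ = (((2 : ℝ) ^ (-((j : ℝ) / 2)) : ℝ) : ℂ) * ((((2 : ℝ) ^ ((j : ℝ) / α) : ℝ) : ℂ) *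
        (((2 : ℝ) ^ (-((j : ℝ) / α)) : ℝ) : ℂ)) * (Real.sqrt (2 * Real.pi) : ℂ) * e * g := by
      congr 4; exact_mod_cast h5.symm
    _ = _ := by ring

/-- The one-dimensional kernel of the sheet. -/
def kernel (α v t ξ : ℝ) : ℂ :=
  (Complex.exp (Complex.I * (t * ξ : ℝ)) - 1) / ((|ξ| ^ (v + 1 / α) : ℝ) : ℂ)

theorem measurable_kernel (α v t : ℝ) : Measurable (kernel α v t) := by
  unfold kernel
  fun_prop

theorem norm_kernel_le (v t ξ : ℝ) : ‖kernel α v t ξ‖ ≤ 2 * (|ξ| ^ (v + 1 / α))⁻¹ := by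
  rw [kernel, norm_div, Complex.norm_real, Real.norm_of_nonneg (by positivity), div_eq_mul_inv]
  gcongr
  calc _ ≤ ‖Complex.exp (Complex.I * (t * ξ : ℝ))‖ + ‖(1 : ℂ)‖ := norm_sub_le _ _
    _ = 2 := by rw [norm_exp_I_mul, norm_one]; norm_num

theorem integrable_fracPrim_integrand {ψ : SchwartzMap ℝ ℝ} (hψ : IsLemarieMeyer ψ) (v y : ℝ) :
    Integrable fun η : ℝ => Complex.exp (Complex.I * (y * η : ℝ)) *
      (hat ψ η / ((|η| ^ (v + 1 / α) : ℝ) : ℂ)) := by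
  have hc : HasCompactSupport fun η : ℝ => hat ψ η / ((|η| ^ (v + 1 / α) : ℝ) : ℂ) := by
    simp only [div_eq_mul_inv]
    exact (hasCompactSupport_hat hψ).mul_right
  have h1 := (contDiff_hat_div hψ (v + 1 / α)).continuous
  refine Continuous.integrable_of_hasCompactSupport (by fun_prop) hc.mul_left

/-- Substitute ξ = 2^j η. The exponent collects j from the Jacobian, -j/α from the normalization and
-j(v + 1/α) from the kernel. -/
theorem integral_kernel_mul_hatNormalized {ψ : SchwartzMap ℝ ℝ} (hψ : IsLemarieMeyer ψ)
    (v t : ℝ) (j k : ℤ) :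
    ∫ ξ, kernel α v t ξ * hatNormalized α ψ j k ξ =
      (((2 : ℝ) ^ ((j : ℝ) - 2 * (j / α) - j * v) : ℝ) : ℂ) *
        waveInc (fracPrim α ψ v) (j, k) t := by
  have h2j : (0 : ℝ) < 2 ^ j := by positivity
  have h1 := Measure.integral_comp_mul_left (fun ξ => kernel α v t ξ * hatNormalized α ψ j k ξ)
    ((2 : ℝ) ^ j)
  rw [abs_of_pos (inv_pos.2 h2j), eq_inv_smul_iff₀ h2j.ne'] at h1
  rw [← h1, waveInc, fracPrim, fracPrim, ← integral_sub (integrable_fracPrim_integrand hψ _ _)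
    (integrable_fracPrim_integrand hψ _ _), Complex.real_smul, ← integral_const_mul,
    ← integral_const_mul]
  refine integral_congr_ae (Eventually.of_forall fun η => ?_)
  simp only [kernel, hatNormalized]
  rw [← mul_assoc ((2 : ℝ) ^ (-j)) ((2 : ℝ) ^ j) η, zpow_neg, inv_mul_cancel₀ h2j.ne', one_mul,
    abs_mul, abs_of_pos h2j, Real.mul_rpow h2j.le (abs_nonneg _),
    show (k : ℝ) * ((2 : ℝ) ^ j)⁻¹ * ((2 : ℝ) ^ j * η) = k * η by field_simp,
    show t * ((2 : ℝ) ^ j * η) = (2 : ℝ) ^ j * t * η by ring]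
  have h3 : Complex.exp (Complex.I * (((2 : ℝ) ^ j * t - k) * η : ℝ)) =
      Complex.exp (Complex.I * ((2 : ℝ) ^ j * t * η : ℝ)) *
        Complex.exp (-(Complex.I * (k * η : ℝ))) := by
    rw [← Complex.exp_add]; congr 1; push_cast; ring
  have h4 : Complex.exp (Complex.I * ((-(k : ℝ)) * η : ℝ)) =
      Complex.exp (-(Complex.I * (k * η : ℝ))) := by
    congr 1; push_cast; ring
  rw [h3, h4]
  have h5 : (2 : ℝ) ^ j * (2 : ℝ) ^ (-((j : ℝ) / α)) * (((2 : ℝ) ^ j) ^ (v + 1 / α))⁻¹ =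
      (2 : ℝ) ^ ((j : ℝ) - 2 * (j / α) - j * v) := by
    rw [← Real.rpow_intCast, ← Real.rpow_mul (by norm_num), ← Real.rpow_neg (by norm_num),
      ← Real.rpow_add (by norm_num), ← Real.rpow_add (by norm_num)]
    congr 1
    ring
  rw [← h5]
  push_cast [-Complex.ofReal_zpow]
  rw [div_eq_mul_inv, div_eq_mul_inv, mul_inv]
  ring

/-- The terms of the expansion of the one-dimensional kernel. -/
def kernelTerm (α : ℝ) (ψ : SchwartzMap ℝ ℝ) (v t : ℝ) (q : ℤ × ℤ) (ξ : ℝ) : ℂ :=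
  (((2 : ℝ) ^ (-((q.1 : ℝ) * v)) : ℝ) : ℂ) * waveInc (fracPrim α ψ v) q t *
    starRingEnd ℂ (hatNormalized α ψ q.1 q.2 ξ)

theorem tendsto_indexSet₁ {R : ℝ} (hR : 0 < R) : Tendsto (fun n => indexSet₁ n R) atTop atTop := by
  refine tendsto_atTop_finset_of_monotone (fun n m h => indexSet₁_mono hR.le h) fun q => ?_
  obtain ⟨n, hn⟩ := exists_nat_ge |(q.1 : ℝ)|
  obtain ⟨m, hm⟩ := pow_unbounded_of_one_lt (|(q.2 : ℝ)| / R) (by norm_num : (1 : ℝ) < 2)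
  refine ⟨max n m, mem_indexSet₁.2 ⟨hn.trans (by exact_mod_cast le_max_left n m), ?_⟩⟩
  rw [div_lt_iff₀ hR, mul_comm] at hm
  refine hm.le.trans ?_
  gcongr
  · norm_num
  · exact (le_max_right n m).trans (Nat.le_succ _)

theorem hatNormalized_ne_zero {ψ : SchwartzMap ℝ ℝ} (hψ : IsLemarieMeyer ψ) {j k : ℤ} {ξ : ℝ}
    (h : hatNormalized α ψ j k ξ ≠ 0) :
    (2 : ℝ) ^ j * (2 * Real.pi / 3) ≤ |ξ| ∧ |ξ| ≤ (2 : ℝ) ^ j * (8 * Real.pi / 3) := by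
  have h1 : hat ψ ((2 : ℝ) ^ (-j) * ξ) ≠ 0 := fun h0 => h (by rw [hatNormalized, h0, mul_zero])
  have h2 := hψ.support_hat _ h1
  have h2j : (0 : ℝ) < 2 ^ j := by positivity
  rw [abs_mul, abs_of_pos (by positivity), zpow_neg, inv_mul_le_iff₀ h2j,
    le_inv_mul_iff₀ h2j] at h2
  exact h2

/-- By Plancherel, the expansion of the inverse transform of h in the basis is carried by `𝓕` to an
expansion of h. -/
theorem hasSum_fourier_basis (b : HilbertBasis (ℤ × ℤ) ℂ (Lp ℂ 2 (volume : Measure ℝ)))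
    (h : Lp ℂ 2 (volume : Measure ℝ)) :
    HasSum (fun q => inner ℂ (𝓕 (b q)) h • 𝓕 (b q)) h := by
  have h1 := (b.hasSum_repr (𝓕⁻ h)).mapL
    (Lp.fourierTransformₗᵢ ℝ ℂ).toContinuousLinearEquiv.toContinuousLinearMap
  have h2 : 𝓕 (𝓕⁻ h) = h := FourierTransform.fourier_fourierInv_eq h
  convert h1 using 1
  · funext q
    have h3 : inner ℂ (𝓕 (b q)) h = inner ℂ (b q) (𝓕⁻ h) := by
      rw [← Lp.inner_fourier_eq (b q) (𝓕⁻ h), h2]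
    rw [ContinuousLinearMap.map_smul, b.repr_apply_apply, h3]
    rfl
  · exact h2.symm

end
end HFSS

/-! ### Plancherel coefficients of the cut-off kernel -/

namespace HFSS
noncomputable section

variable {α : ℝ}

open scoped FourierTransform SchwartzMap

theorem fourier_basis_ae {ψ : SchwartzMap ℝ ℝ}
    {b : HilbertBasis (ℤ × ℤ) ℂ (Lp ℂ 2 (volume : Measure ℝ))}
    (hb : ∀ j k : ℤ, (b (j, k) : ℝ → ℂ) =ᵐ[volume]
      fun x => (((2 : ℝ) ^ ((j : ℝ) / 2) * ψ ((2 : ℝ) ^ j * x - k) : ℝ) : ℂ)) (q : ℤ × ℤ) :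
    ((𝓕 (b q) : Lp ℂ 2 (volume : Measure ℝ)) : ℝ → ℂ) =ᵐ[volume]
      fun ν => (normConst α q.1 : ℂ) * hatNormalized α ψ q.1 q.2 (2 * Real.pi * ν) := by
  have h1 : b q = (wavelet ψ q).toLp 2 := by
    refine Lp.ext ?_
    filter_upwards [hb q.1 q.2, (wavelet ψ q).coeFn_toLp 2 volume] with x h h'
    rw [h', wavelet_apply, show b q = b (q.1, q.2) from rfl, h, Complex.ofReal_mul]
    rfl
  rw [h1, SchwartzMap.toLp_fourier_eq]
  filter_upwards [(𝓕 (wavelet ψ q)).coeFn_toLp 2 volume] with ν h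
  rw [h, fourier_wavelet (α := α)]

/-- The frequencies `ν` with `a ≤ |2πν| ≤ A`. -/
def freqRing (a A : ℝ) : Set ℝ := {ν | a ≤ |2 * Real.pi * ν| ∧ |2 * Real.pi * ν| ≤ A}

theorem measurableSet_freqRing (a A : ℝ) : MeasurableSet (freqRing a A) :=
  (measurableSet_le (by fun_prop) (by fun_prop) : MeasurableSet {ν : ℝ | a ≤ |2 * Real.pi * ν|}).inter
    (measurableSet_le (by fun_prop) (by fun_prop) : MeasurableSet {ν : ℝ | |2 * Real.pi * ν| ≤ A})

theorem volume_freqRing_ne_top (a A : ℝ) : volume (freqRing a A) ≠ ∞ := by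
  refine ((measure_mono (t := Set.Icc (-A) A) fun ν hν => ?_).trans_lt measure_Icc_lt_top).ne
  have h1 : |ν| ≤ |2 * Real.pi * ν| := by
    rw [abs_mul, abs_of_pos (by positivity : 0 < 2 * Real.pi)]
    nlinarith [Real.pi_gt_three, abs_nonneg ν]
  exact abs_le.1 (h1.trans hν.2)

/-- The kernel cut off to a ring, in the variable of the Fourier transform. -/
def cutKernel (α v t a A : ℝ) : ℝ → ℂ :=
  (freqRing a A).indicator fun ν => starRingEnd ℂ (kernel α v t (2 * Real.pi * ν))

/-- The cut is needed because the kernel itself may fail to be square integrable near 0; on the ring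
it is bounded. -/
theorem memLp_cutKernel (v t : ℝ) {a : ℝ} (ha : 0 < a) (A : ℝ) (hv : 0 < v + 1 / α) :
    MemLp (cutKernel α v t a A) 2 volume := by
  have hm : Measurable (fun ν : ℝ => starRingEnd ℂ (kernel α v t (2 * Real.pi * ν))) :=
    Complex.continuous_conj.measurable.comp ((measurable_kernel α v t).comp (by fun_prop))
  have h1 : MemLp (cutKernel α v t a A) ∞ volume := by
    refine memLp_top_of_bound (hm.indicator (measurableSet_freqRing a A)).aestronglyMeasurable
      (2 * (a ^ (v + 1 / α))⁻¹) (Eventually.of_forall fun ν => ?_)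
    by_cases hν : ν ∈ freqRing a A
    · rw [cutKernel, Set.indicator_of_mem hν, RCLike.norm_conj]
      refine (norm_kernel_le v t _).trans ?_
      gcongr
      exact hν.1
    · rw [cutKernel, Set.indicator_of_notMem hν, norm_zero]
      positivity
  exact h1.mono_exponent_of_measure_support_ne_top
    (fun ν hν => Set.indicator_of_notMem hν _) (volume_freqRing_ne_top a A) le_top

theorem inner_fourier_basis {ψ : SchwartzMap ℝ ℝ} (hψ : IsLemarieMeyer ψ)
    {b : HilbertBasis (ℤ × ℤ) ℂ (Lp ℂ 2 (volume : Measure ℝ))}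
    (hb : ∀ j k : ℤ, (b (j, k) : ℝ → ℂ) =ᵐ[volume]
      fun x => (((2 : ℝ) ^ ((j : ℝ) / 2) * ψ ((2 : ℝ) ^ j * x - k) : ℝ) : ℂ)) (q : ℤ × ℤ)
    (v t : ℝ) {a A : ℝ} (h : MemLp (cutKernel α v t a A) 2 volume)
    (ha : a ≤ (2 : ℝ) ^ q.1 * (2 * Real.pi / 3)) (hA : (2 : ℝ) ^ q.1 * (8 * Real.pi / 3) ≤ A) :
    inner ℂ (𝓕 (b q)) (h.toLp _) = starRingEnd ℂ ((normConst α q.1 : ℂ) *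
      (((2 * Real.pi)⁻¹ : ℝ) : ℂ) * ((((2 : ℝ) ^ ((q.1 : ℝ) - 2 * (q.1 / α) - q.1 * v) : ℝ) : ℂ) *
        waveInc (fracPrim α ψ v) q t)) := by
  have h0 : (0 : ℝ) < 2 * Real.pi := by positivity
  rw [← integral_kernel_mul_hatNormalized hψ]
  have h1 := Measure.integral_comp_mul_left
    (fun ξ => kernel α v t ξ * hatNormalized α ψ q.1 q.2 ξ) (2 * Real.pi)
  rw [abs_of_pos (inv_pos.2 h0), Complex.real_smul] at h1
  rw [mul_assoc, ← h1, ← integral_const_mul, ← integral_conj, L2.inner_def]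
  refine integral_congr_ae ?_
  filter_upwards [fourier_basis_ae (α := α) hb q, h.coeFn_toLp] with ν h2 h3
  rw [h2, h3, cutKernel]
  by_cases h4 : hatNormalized α ψ q.1 q.2 (2 * Real.pi * ν) = 0
  · simp [h4]
  · have h5 := hatNormalized_ne_zero hψ h4
    rw [Set.indicator_of_mem (show ν ∈ freqRing a A from ⟨ha.trans h5.1, h5.2.trans hA⟩)]
    simp only [RCLike.inner_apply, map_mul]
    ring

/-- Two factors `normConst` and the (2π)⁻¹ give 2^(-j + 2j/α), which reduces the exponent j - 2j/α -
jv to -jv. The conjugate is there because `coeff` integrates the conjugate of the wavelets. -/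
theorem inner_smul_eq_kernelTerm (ψ : SchwartzMap ℝ ℝ) (v t : ℝ) (q : ℤ × ℤ) (ξ : ℝ) :
    starRingEnd ℂ ((normConst α q.1 : ℂ) *
      (((2 * Real.pi)⁻¹ : ℝ) : ℂ) * ((((2 : ℝ) ^ ((q.1 : ℝ) - 2 * (q.1 / α) - q.1 * v) : ℝ) : ℂ) *
        waveInc (fracPrim α ψ v) q t)) * ((normConst α q.1 : ℂ) * hatNormalized α ψ q.1 q.2 ξ) =
      starRingEnd ℂ (kernelTerm α ψ v t q ξ) := by
  have h1 : normConst α q.1 * (2 * Real.pi)⁻¹ * (2 : ℝ) ^ ((q.1 : ℝ) - 2 * (q.1 / α) - q.1 * v) *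
      normConst α q.1 = (2 : ℝ) ^ (-((q.1 : ℝ) * v)) := by
    have h2 : Real.sqrt (2 * Real.pi) * Real.sqrt (2 * Real.pi) = 2 * Real.pi :=
      Real.mul_self_sqrt (by positivity)
    have h3 : (2 : ℝ) ^ (-((q.1 : ℝ) * v)) = ((2 : ℝ) ^ (-((q.1 : ℝ) / 2)) *
        (2 : ℝ) ^ ((q.1 : ℝ) / α)) * (2 : ℝ) ^ ((q.1 : ℝ) - 2 * (q.1 / α) - q.1 * v) *
        ((2 : ℝ) ^ (-((q.1 : ℝ) / 2)) * (2 : ℝ) ^ ((q.1 : ℝ) / α)) := by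
      rw [← Real.rpow_add (by norm_num), ← Real.rpow_add (by norm_num),
        ← Real.rpow_add (by norm_num)]
      congr 1
      ring
    rw [h3, normConst]
    field_simp
    rw [Real.sq_sqrt (by positivity)]
  rw [kernelTerm, ← h1]
  simp only [map_mul, Complex.conj_ofReal, Complex.conj_conj, Complex.ofReal_mul]
  ring

/-- L² convergence gives almost everywhere convergence along a subsequence. The support ring of a
wavelet has ratio 4, so every wavelet that is nonzero at a frequency between 4a and A/4 lives inside
the ring from a to A, and its coefficient does not see the cut. -/
theorem ae_cutKernel_subseq {ψ : SchwartzMap ℝ ℝ} (hψ : IsLemarieMeyer ψ) {v : ℝ} (t : ℝ)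
    (hv : 0 < v + 1 / α) {R : ℝ} (hR : 0 < R) {a : ℝ} (ha : 0 < a) (A : ℝ) :
    ∃ s : ℕ → ℕ, StrictMono s ∧ ∀ᵐ ν : ℝ, 4 * a ≤ |2 * Real.pi * ν| →
      |2 * Real.pi * ν| ≤ A / 4 →
      Tendsto (fun n => ∑ q ∈ indexSet₁ (s n) R, kernelTerm α ψ v t q (2 * Real.pi * ν)) atTop
        (𝓝 (kernel α v t (2 * Real.pi * ν))) := by
  obtain ⟨b, hb⟩ := hψ.hilbertBasis
  have hL := memLp_cutKernel (α := α) v t ha A hv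
  have h1 := (hasSum_fourier_basis b (hL.toLp _)).comp (tendsto_indexSet₁ hR)
  obtain ⟨s, hs, h2⟩ := (tendstoInMeasure_of_tendsto_Lp h1).exists_seq_tendsto_ae
  refine ⟨s, hs, ?_⟩
  have h3 : ∀ᵐ ν : ℝ, ∀ n, (∑ q ∈ indexSet₁ n R, inner ℂ (𝓕 (b q)) (hL.toLp _) • 𝓕 (b q) :
      Lp ℂ 2 (volume : Measure ℝ)) ν = ∑ q ∈ indexSet₁ n R, inner ℂ (𝓕 (b q)) (hL.toLp _) *
        ((normConst α q.1 : ℂ) * hatNormalized α ψ q.1 q.2 (2 * Real.pi * ν)) := by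
    have h4 : ∀ᵐ ν : ℝ, ∀ q, (inner ℂ (𝓕 (b q)) (hL.toLp _) • 𝓕 (b q) :
        Lp ℂ 2 (volume : Measure ℝ)) ν = inner ℂ (𝓕 (b q)) (hL.toLp _) *
        ((normConst α q.1 : ℂ) * hatNormalized α ψ q.1 q.2 (2 * Real.pi * ν)) := by
      rw [ae_all_iff]
      intro q
      filter_upwards [fourier_basis_ae (α := α) hb q,
        Lp.coeFn_smul (inner ℂ (𝓕 (b q)) (hL.toLp _)) (𝓕 (b q))] with ν h5 h6
      rw [h6, Pi.smul_apply, h5, smul_eq_mul]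
    rw [ae_all_iff]
    intro n
    filter_upwards [h4, Lp.coeFn_fun_finsetSum (indexSet₁ n R)
      (fun q => inner ℂ (𝓕 (b q)) (hL.toLp _) • 𝓕 (b q))] with ν h5 h6
    rw [h6]
    exact Finset.sum_congr rfl fun q _ => h5 q
  filter_upwards [h2, h3, hL.coeFn_toLp] with ν h2 h3 h4 h5 h6
  have h7 : cutKernel α v t a A ν = starRingEnd ℂ (kernel α v t (2 * Real.pi * ν)) := by
    refine Set.indicator_of_mem (show ν ∈ freqRing a A from ⟨?_, ?_⟩) _ <;>
      linarith [abs_nonneg (2 * Real.pi * ν)]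
  rw [h4, h7] at h2
  have h8 := (Complex.continuous_conj.tendsto _).comp h2
  rw [Complex.conj_conj] at h8
  refine h8.congr fun n => ?_
  simp only [Function.comp_apply]
  rw [h3, map_sum]
  refine Finset.sum_congr rfl fun q _ => ?_
  by_cases h9 : hatNormalized α ψ q.1 q.2 (2 * Real.pi * ν) = 0
  · simp [h9, kernelTerm]
  · have h10 := hatNormalized_ne_zero hψ h9
    rw [inner_fourier_basis hψ hb q v t hL (by linarith) (by linarith), inner_smul_eq_kernelTerm,
      Complex.conj_conj]

end
end HFSS

/-! ### Domination and convergence of the kernel expansion -/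

namespace HFSS
noncomputable section

variable {α : ℝ}

open scoped FourierTransform SchwartzMap

/-- The dominating function of the wavelet expansion of the kernel. -/
def kernelBound (s ξ : ℝ) : ℝ := min 1 |ξ| * (|ξ| ^ s)⁻¹

theorem kernelBound_nonneg (s ξ : ℝ) : 0 ≤ kernelBound s ξ := by
  unfold kernelBound; positivity

/-- A nonzero term forces 2^j ≤ |ξ| ≤ 9·2^j < 2^(j+4), so only four scales contribute and 2^j may be
traded for |ξ|. The increment from 0 supplies min(1, 2^j|t|), which becomes min(1, |ξ|). -/
theorem norm_kernelTerm_le {ψ : SchwartzMap ℝ ℝ} (hψ : IsLemarieMeyer ψ) {v : ℝ}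
    (hv : 0 < v + 1 / α) (t : ℝ) : ∃ C : ℝ, 0 ≤ C ∧ ∀ (q : ℤ × ℤ) (ξ : ℝ),
      kernelTerm α ψ v t q ξ ≠ 0 → q.1 ∈ Finset.Icc (Int.log 2 |ξ| - 3) (Int.log 2 |ξ|) ∧
      ‖kernelTerm α ψ v t q ξ‖ ≤ C * kernelBound (v + 1 / α) ξ *
        (decay 2 ((2 : ℝ) ^ q.1 * t - q.2) + decay 2 (0 - q.2)) := by
  obtain ⟨B, hB, hat_le⟩ := exists_hat_bound hψ
  obtain ⟨Φ, hΦ⟩ := exists_schwartzMap_eq_fracPrim (α := α) hψ v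
  obtain ⟨C, hC, hinc⟩ := exists_schwartz_increment Φ 2
  set s := v + 1 / α with hs
  refine ⟨9 ^ s * B * C * (1 + |t|), by positivity, fun q ξ hq => ?_⟩
  have h1 : hatNormalized α ψ q.1 q.2 ξ ≠ 0 := fun h => hq (by simp [kernelTerm, h])
  have h2 := hatNormalized_ne_zero hψ h1
  have h2j : (0 : ℝ) < 2 ^ q.1 := by positivity
  have h3 : (2 : ℝ) ^ q.1 ≤ |ξ| := le_trans (by nlinarith [Real.pi_gt_three]) h2.1
  have h4 : |ξ| ≤ 9 * (2 : ℝ) ^ q.1 := h2.2.trans (by nlinarith [Real.pi_lt_d2])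
  have hξ : 0 < |ξ| := h2j.trans_le h3
  refine ⟨?_, ?_⟩
  · have h5 : q.1 ≤ Int.log 2 |ξ| := (Int.zpow_le_iff_le_log (by norm_num) hξ).1 (by exact_mod_cast h3)
    have h6 : Int.log 2 |ξ| < q.1 + 4 := by
      refine (Int.lt_zpow_iff_log_lt (by norm_num) hξ).1 (h4.trans_lt ?_)
      push_cast
      rw [zpow_add₀ (by norm_num)]
      norm_num
      linarith
    rw [Finset.mem_Icc]
    omega
  have h5 : ‖waveInc (fracPrim α ψ v) q t‖ ≤ C * min 1 ((2 : ℝ) ^ q.1 * |t|) *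
      (decay 2 ((2 : ℝ) ^ q.1 * t - q.2) + decay 2 (0 - q.2)) := by
    rw [waveInc, hΦ, hΦ]
    refine (hinc _ _).trans_eq ?_
    rw [sub_neg_eq_add, sub_add_cancel, abs_mul, abs_of_pos h2j, zero_sub]
  have h6 : min 1 ((2 : ℝ) ^ q.1 * |t|) ≤ (1 + |t|) * min 1 |ξ| := by
    have ht := abs_nonneg t
    rcases le_total 1 |ξ| with h | h
    · rw [min_eq_left h]
      exact (min_le_left _ _).trans (by linarith)
    · rw [min_eq_right h]
      refine (min_le_right _ _).trans ?_
      nlinarith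
  have h7 : (2 : ℝ) ^ (-((q.1 : ℝ) * v)) * (2 : ℝ) ^ (-((q.1 : ℝ) / α)) ≤ 9 ^ s * (|ξ| ^ s)⁻¹ := by
    have h8 : (2 : ℝ) ^ (-((q.1 : ℝ) * v)) * (2 : ℝ) ^ (-((q.1 : ℝ) / α)) =
        (((2 : ℝ) ^ q.1) ^ s)⁻¹ := by
      rw [← Real.rpow_intCast, ← Real.rpow_mul (by norm_num), ← Real.rpow_neg (by norm_num),
        ← Real.rpow_add (by norm_num), hs]
      congr 1
      ring
    rw [h8, ← div_eq_mul_inv, inv_eq_one_div, div_le_div_iff₀ (by positivity) (by positivity),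
      one_mul, ← Real.mul_rpow (by norm_num) h2j.le]
    exact Real.rpow_le_rpow hξ.le h4 hv.le
  have hd : 0 ≤ decay 2 ((2 : ℝ) ^ q.1 * t - q.2) + decay 2 (0 - q.2) :=
    add_nonneg (decay_nonneg _ _) (decay_nonneg _ _)
  rw [kernelTerm, norm_mul, norm_mul, RCLike.norm_conj, norm_hatNormalized, Complex.norm_real,
    Real.norm_of_nonneg (by positivity)]
  set d := decay 2 ((2 : ℝ) ^ q.1 * t - q.2) + decay 2 (0 - q.2)
  calc _ = ((2 : ℝ) ^ (-((q.1 : ℝ) * v)) * (2 : ℝ) ^ (-((q.1 : ℝ) / α))) *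
        ‖waveInc (fracPrim α ψ v) q t‖ * ‖hat ψ ((2 : ℝ) ^ (-q.1) * ξ)‖ := by ring
    _ ≤ (9 ^ s * (|ξ| ^ s)⁻¹) * (C * ((1 + |t|) * min 1 |ξ|) * d) * B := by
      gcongr
      · refine h5.trans ?_
        gcongr
      · exact hat_le _
    _ = _ := by rw [kernelBound]; ring

theorem exists_sum_norm_kernelTerm_le {ψ : SchwartzMap ℝ ℝ} (hψ : IsLemarieMeyer ψ) {v : ℝ}
    (hv : 0 < v + 1 / α) (t : ℝ) : ∃ C : ℝ, 0 ≤ C ∧ ∀ (ξ : ℝ) (F : Finset (ℤ × ℤ)),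
      ∑ q ∈ F, ‖kernelTerm α ψ v t q ξ‖ ≤ C * kernelBound (v + 1 / α) ξ := by
  obtain ⟨C, hC, h⟩ := norm_kernelTerm_le hψ hv t
  obtain ⟨D, hD, hsum⟩ := exists_sum_decay_le
  refine ⟨4 * (C * (D + D)), by positivity, fun ξ F => ?_⟩
  set I := Finset.Icc (Int.log 2 |ξ| - 3) (Int.log 2 |ξ|)
  set G := C * kernelBound (v + 1 / α) ξ
  have hG : 0 ≤ G := mul_nonneg hC (kernelBound_nonneg _ _)
  have hI : (I.card : ℝ) = 4 := by
    rw [Int.card_Icc]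
    rw [show Int.log 2 |ξ| + 1 - (Int.log 2 |ξ| - 3) = 4 by ring]
    exact Nat.cast_ofNat
  calc ∑ q ∈ F, ‖kernelTerm α ψ v t q ξ‖
      ≤ ∑ q ∈ F.filter (fun q => q.1 ∈ I), ‖kernelTerm α ψ v t q ξ‖ := by
        rw [Finset.sum_filter_of_ne]
        exact fun q _ hq => (h q ξ (norm_ne_zero_iff.1 hq)).1
    _ ≤ ∑ q ∈ I ×ˢ F.image Prod.snd, ‖kernelTerm α ψ v t q ξ‖ := by
        refine Finset.sum_le_sum_of_subset_of_nonneg (fun q hq => ?_) fun _ _ _ => norm_nonneg _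
        rw [Finset.mem_filter] at hq
        exact Finset.mem_product.2 ⟨hq.2, Finset.mem_image_of_mem _ hq.1⟩
    _ ≤ ∑ q ∈ I ×ˢ F.image Prod.snd,
          G * (decay 2 ((2 : ℝ) ^ q.1 * t - q.2) + decay 2 (0 - q.2)) := by
        refine Finset.sum_le_sum fun q _ => ?_
        by_cases hq : kernelTerm α ψ v t q ξ = 0
        · rw [hq, norm_zero]
          exact mul_nonneg hG (add_nonneg (decay_nonneg _ _) (decay_nonneg _ _))
        · exact (h q ξ hq).2
    _ = ∑ j ∈ I, G * (∑ k ∈ F.image Prod.snd, decay 2 ((2 : ℝ) ^ j * t - k) +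
          ∑ k ∈ F.image Prod.snd, decay 2 (0 - k)) := by
        rw [Finset.sum_product]
        refine Finset.sum_congr rfl fun j _ => ?_
        rw [← Finset.sum_add_distrib, Finset.mul_sum]
    _ ≤ ∑ j ∈ I, G * (D + D) := by
        gcongr
        · exact hsum _ _
        · exact hsum _ _
    _ = _ := by rw [Finset.sum_const, nsmul_eq_mul, hI]; ring

theorem ae_of_ae_comp_mul_left {a : ℝ} (ha : a ≠ 0) {p : ℝ → Prop} (h : ∀ᵐ ν, p (a * ν)) :
    ∀ᵐ ξ, p ξ := by
  have hq : Measure.QuasiMeasurePreserving (fun ξ : ℝ => a⁻¹ * ξ) volume volume := by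
    refine ⟨by fun_prop, ?_⟩
    rw [Real.map_volume_mul_left (inv_ne_zero ha)]
    exact Measure.smul_absolutelyContinuous
  filter_upwards [hq.ae h] with ξ hξ
  rwa [mul_inv_cancel_left₀ ha] at hξ

/-- The series converges absolutely at every ξ, so the full sequence has a limit; the subsequence on
a ring around |ξ| identifies it. Countably many rings exhaust ξ ≠ 0. -/
theorem ae_tendsto_sum_kernelTerm {ψ : SchwartzMap ℝ ℝ} (hψ : IsLemarieMeyer ψ) {v : ℝ}
    (hv : 0 < v + 1 / α) (t : ℝ) {R : ℝ} (hR : 0 < R) :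
    ∀ᵐ ξ : ℝ, Tendsto (fun n => ∑ q ∈ indexSet₁ n R, kernelTerm α ψ v t q ξ) atTop
      (𝓝 (kernel α v t ξ)) := by
  obtain ⟨C, hC, hbd⟩ := exists_sum_norm_kernelTerm_le hψ hv t
  have h1 : ∀ᵐ ν : ℝ, ∀ m : ℕ, 4 * (1 / ((m : ℝ) + 1)) ≤ |2 * Real.pi * ν| →
      |2 * Real.pi * ν| ≤ 4 * (m : ℝ) / 4 → ∃ s : ℕ → ℕ, StrictMono s ∧
      Tendsto (fun n => ∑ q ∈ indexSet₁ (s n) R, kernelTerm α ψ v t q (2 * Real.pi * ν)) atTop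
        (𝓝 (kernel α v t (2 * Real.pi * ν))) := by
    rw [ae_all_iff]
    intro m
    obtain ⟨s, hs, h⟩ := ae_cutKernel_subseq hψ t hv hR (a := 1 / ((m : ℝ) + 1))
      (by positivity) (4 * (m : ℝ))
    filter_upwards [h] with ν h ha hA
    exact ⟨s, hs, h ha hA⟩
  have h2 := ae_of_ae_comp_mul_left (a := 2 * Real.pi) (by positivity)
    (p := fun ξ => ∀ m : ℕ, 4 * (1 / ((m : ℝ) + 1)) ≤ |ξ| → |ξ| ≤ 4 * (m : ℝ) / 4 →
      ∃ s : ℕ → ℕ, StrictMono s ∧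
      Tendsto (fun n => ∑ q ∈ indexSet₁ (s n) R, kernelTerm α ψ v t q ξ) atTop
        (𝓝 (kernel α v t ξ))) h1
  filter_upwards [h2, Measure.ae_ne volume (0 : ℝ)] with ξ h3 h0
  have hξ : 0 < |ξ| := abs_pos.2 h0
  obtain ⟨m, hm⟩ := exists_nat_ge (max |ξ| (4 / |ξ|))
  obtain ⟨s, hs, h4⟩ := h3 m (by
    have h5 := (le_max_right _ _).trans hm
    rw [div_le_iff₀ hξ] at h5
    rw [mul_one_div, div_le_iff₀ (by positivity)]
    nlinarith) (by
    have h5 := (le_max_left _ _).trans hm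
    linarith)
  have h5 : Summable fun q => kernelTerm α ψ v t q ξ :=
    (summable_of_sum_le (fun _ => norm_nonneg _) (hbd ξ)).of_norm
  have h6 := h5.hasSum.comp (tendsto_indexSet₁ hR)
  have h7 := tendsto_nhds_unique (h6.comp hs.tendsto_atTop) h4
  rw [← h7]
  exact h6

/-- Near 0 the exponent is α(1 - v) - 1 > -1 because v < 1; at infinity it is -(vα + 1) < -1 because
v > 0. -/
theorem integrable_kernelBound_rpow (hα0 : 0 < α) {v : ℝ} (hv0 : 0 < v) (hv1 : v < 1) :
    Integrable fun ξ : ℝ => kernelBound (v + 1 / α) ξ ^ α := by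
  have h0 : ∀ y : ℝ, 0 < y → ((y ^ (v + 1 / α))⁻¹) ^ α = y ^ (-(v * α + 1)) := fun y hy => by
    rw [← Real.rpow_neg hy.le, ← Real.rpow_mul hy.le]
    congr 1
    field_simp
  have h1 : IntegrableOn (fun y : ℝ => (min 1 y * (y ^ (v + 1 / α))⁻¹) ^ α) (Set.Ioi 0) := by
    rw [← Set.Ioc_union_Ioi_eq_Ioi (zero_le_one' ℝ)]
    refine IntegrableOn.union ?_ ?_
    · have h2 : IntegrableOn (fun y : ℝ => y ^ (α - (v * α + 1))) (Set.Ioc 0 1) := by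
        rw [← intervalIntegrable_iff_integrableOn_Ioc_of_le zero_le_one]
        exact intervalIntegral.intervalIntegrable_rpow' (by nlinarith)
      refine h2.congr_fun (fun y hy => ?_) measurableSet_Ioc
      simp only
      rw [min_eq_right hy.2, Real.mul_rpow hy.1.le (by have := hy.1; positivity), h0 y hy.1,
        ← Real.rpow_add hy.1, sub_eq_add_neg]
    · refine (integrableOn_Ioi_rpow_of_lt (a := -(v * α + 1)) (by nlinarith [mul_pos hv0 hα0])
        one_pos).congr_fun (fun y hy => ?_) measurableSet_Ioi
      simp only
      rw [min_eq_left (le_of_lt hy), one_mul, h0 y (one_pos.trans hy)]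
  have h2 := (integrable_fun_norm_addHaar (volume : Measure ℝ)
    (f := fun y : ℝ => (min 1 y * (y ^ (v + 1 / α))⁻¹) ^ α)).2 (by simpa using h1)
  exact h2

theorem tendsto_eLpNorm_sub_of_dominated {X : Type*} [MeasurableSpace X] {μ : Measure X}
    {p : ℝ≥0∞} (hp0 : p ≠ 0) (hp : p ≠ ∞) {f : ℕ → X → ℂ} {g : X → ℂ} {G : X → ℝ}
    (hf : ∀ n, AEStronglyMeasurable (f n) μ) (hg : AEStronglyMeasurable g μ) (hG : MemLp G p μ)
    (hbd : ∀ n, ∀ᵐ x ∂μ, ‖f n x‖ ≤ G x)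
    (hlim : ∀ᵐ x ∂μ, Tendsto (fun n => f n x) atTop (𝓝 (g x))) :
    Tendsto (fun n => eLpNorm (fun x => f n x - g x) p μ) atTop (𝓝 0) := by
  have hpr : 0 < p.toReal := ENNReal.toReal_pos hp0 hp
  have hgG : ∀ᵐ x ∂μ, ‖g x‖ ≤ G x := by
    filter_upwards [hlim, ae_all_iff.2 hbd] with x h1 h2
    exact le_of_tendsto h1.norm (Eventually.of_forall h2)
  have h1 : Tendsto (fun n => ∫⁻ x, ‖f n x - g x‖ₑ ^ p.toReal ∂μ) atTop (𝓝 (∫⁻ _, 0 ∂μ)) := by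
    refine tendsto_lintegral_of_dominated_convergence' (fun x => ‖(2 : ℝ) * G x‖ₑ ^ p.toReal)
      (fun n => ((hf n).sub hg).enorm.pow_const _) (fun n => ?_) ?_ ?_
    · filter_upwards [hbd n, hgG] with x h2 h3
      gcongr
      rw [enorm_le_iff_norm_le]
      refine (norm_sub_le _ _).trans ((add_le_add h2 h3).trans ?_)
      rw [← two_mul]
      exact le_abs_self _
    · exact (lintegral_rpow_enorm_lt_top_of_eLpNorm_lt_top hp0 hp (hG.const_mul 2).2).ne
    · filter_upwards [hlim] with x h2
      have h3 : Tendsto (fun n => ‖f n x - g x‖ₑ) atTop (𝓝 0) := by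
        have h4 := (h2.sub_const (g x)).enorm
        rwa [sub_self, enorm_zero] at h4
      have h4 := (ENNReal.continuous_rpow_const (y := p.toReal)).tendsto 0 |>.comp h3
      rwa [ENNReal.zero_rpow_of_pos hpr] at h4
  rw [lintegral_zero] at h1
  have h2 := (ENNReal.continuous_rpow_const (y := 1 / p.toReal)).tendsto 0 |>.comp h1
  rw [ENNReal.zero_rpow_of_pos (by positivity)] at h2
  refine h2.congr fun n => ?_
  rw [eLpNorm_eq_lintegral_rpow_enorm_toReal hp0 hp]
  rfl

end
end HFSS

/-! ### Identification of the limit with the sheet -/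

namespace HFSS
noncomputable section

variable {N : ℕ} {α : ℝ}

theorem eventually_ae_coord {p : Fin N → ℝ → Prop} (h : ∀ l, ∀ᵐ ξ, p l ξ) :
    ∀ᵐ x : E N, ∀ l, p l (x l) := by
  rw [ae_all_iff]
  intro l
  exact (EuclideanSpace.volume_preserving_symm_measurableEquiv_toLp (Fin N)).quasiMeasurePreserving.ae
    ((Measure.tendsto_eval_ae_ae (μ := fun _ : Fin N => (volume : Measure ℝ)) (i := l)).eventually
      (h l))

theorem memLp_prod_kernelBound (hα0 : 0 < α) {H : Fin N → ℝ} (hH : ∀ l, 0 < H l ∧ H l < 1)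
    (C : Fin N → ℝ) :
    MemLp (fun x : E N => ∏ l, (C l * kernelBound (H l + 1 / α) (x l))) (ENNReal.ofReal α)
      volume := by
  have hm : ∀ s, Measurable (kernelBound s) := fun s => by unfold kernelBound; fun_prop
  have h1 : Integrable (fun x : E N => ∏ l, kernelBound (H l + 1 / α) (x l) ^ α) := by
    have h2 : Integrable (fun x : Fin N → ℝ => ∏ l, kernelBound (H l + 1 / α) (x l) ^ α) :=
      Integrable.fintype_prod (f := fun l ξ => kernelBound (H l + 1 / α) ξ ^ α)
        fun l => integrable_kernelBound_rpow hα0 (hH l).1 (hH l).2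
    exact (EuclideanSpace.volume_preserving_symm_measurableEquiv_toLp (Fin N)).integrable_comp_of_integrable h2
  have h3 : MemLp (fun x : E N => ∏ l, kernelBound (H l + 1 / α) (x l)) (ENNReal.ofReal α)
      volume := by
    rw [← integrable_norm_rpow_iff _ (by simpa using hα0) ENNReal.ofReal_ne_top,
      ENNReal.toReal_ofReal hα0.le]
    · refine h1.congr (Eventually.of_forall fun x => ?_)
      simp only
      rw [Real.norm_of_nonneg (Finset.prod_nonneg fun l _ => kernelBound_nonneg _ _),
        Real.finsetProd_rpow _ _ fun l _ => kernelBound_nonneg _ _]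
    · exact (Finset.measurable_prod _ fun l _ => (hm _).comp (by fun_prop)).aestronglyMeasurable
  simp only [Finset.prod_mul_distrib]
  exact h3.const_mul _

/-- The left side is the integrand whose stochastic integral has the truncated series as its real
part. It factors because the index set is a product. -/
theorem sum_coeffFun_eq_prod (ψ : SchwartzMap ℝ ℝ) (H : Fin N → ℝ) (R : ℝ) (n : ℕ) (t x : E N) :
    ∑ p ∈ indexSet N n R, ((((2 : ℝ) ^ (-(∑ l, (p.1 l : ℝ) * H l)) : ℝ) : ℂ) *
      ∏ l, waveInc (fracPrim α ψ (H l)) (p.1 l, p.2 l) (t l)) * coeffFun α ψ p.1 p.2 x =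
    ∏ l, ∑ q ∈ indexSet₁ n R, kernelTerm α ψ (H l) (t l) q (x l) := by
  rw [← sum_indexSet_prod n R fun l q => kernelTerm α ψ (H l) (t l) q (x l)]
  refine Finset.sum_congr rfl fun p _ => ?_
  simp only [kernelTerm, Finset.prod_mul_distrib, coeffFun, map_prod]
  congr 2
  rw [← Finset.sum_neg_distrib, ← Complex.ofReal_prod]
  congr 1
  exact Real.rpow_sum_of_pos (by norm_num) _ _

variable {Ω : Type*} [MeasurableSpace Ω] {P : Measure Ω} {M : Set (E N) → Ω → ℂ}

theorem tendsto_eLpNorm_sub_kernel (hα0 : 0 < α) {ψ : SchwartzMap ℝ ℝ} (hψ : IsLemarieMeyer ψ)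
    {H : Fin N → ℝ} (hH : ∀ l, 0 < H l ∧ H l < 1) {R : ℝ} (hR : 0 < R) (t : E N) :
    MemLp (fun x : E N => ∏ l, kernel α (H l) (t l) (x l)) (ENNReal.ofReal α) volume ∧
    Tendsto (fun n => eLpNorm (fun x : E N =>
      (∏ l, ∑ q ∈ indexSet₁ n R, kernelTerm α ψ (H l) (t l) q (x l)) -
        ∏ l, kernel α (H l) (t l) (x l)) (ENNReal.ofReal α) volume) atTop (𝓝 0) := by
  have hv : ∀ l, 0 < H l + 1 / α := fun l => add_pos (hH l).1 (by positivity)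
  choose C hC hbd using fun l => exists_sum_norm_kernelTerm_le hψ (hv l) (t l)
  have hG := memLp_prod_kernelBound hα0 hH C
  have hlim : ∀ᵐ x : E N, Tendsto (fun n => ∏ l, ∑ q ∈ indexSet₁ n R,
      kernelTerm α ψ (H l) (t l) q (x l)) atTop (𝓝 (∏ l, kernel α (H l) (t l) (x l))) := by
    filter_upwards [eventually_ae_coord fun l => ae_tendsto_sum_kernelTerm hψ (hv l) (t l) hR]
      with x hx
    exact tendsto_finsetProd _ fun l _ => hx l
  have hle : ∀ (n : ℕ) (x : E N), ‖∏ l, ∑ q ∈ indexSet₁ n R,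
      kernelTerm α ψ (H l) (t l) q (x l)‖ ≤ ∏ l, (C l * kernelBound (H l + 1 / α) (x l)) := by
    intro n x
    rw [norm_prod]
    exact Finset.prod_le_prod (fun _ _ => norm_nonneg _) fun l _ =>
      (norm_sum_le _ _).trans (hbd l _ _)
  have hk : AEStronglyMeasurable (fun x : E N => ∏ l, kernel α (H l) (t l) (x l)) volume :=
    (Finset.measurable_prod _ fun l _ => (measurable_kernel _ _ _).comp
      (by fun_prop)).aestronglyMeasurable
  have hkt : ∀ n, AEStronglyMeasurable (fun x : E N => ∏ l, ∑ q ∈ indexSet₁ n R,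
      kernelTerm α ψ (H l) (t l) q (x l)) volume := fun n => by
    refine (continuous_finsetProd _ fun l _ => continuous_finsetSum _ fun q _ => ?_).aestronglyMeasurable
    unfold kernelTerm
    exact continuous_const.mul (Complex.continuous_conj.comp
      ((continuous_hatNormalized ψ q.1 q.2).comp (by fun_prop)))
  refine ⟨hG.of_le hk ?_, tendsto_eLpNorm_sub_of_dominated (by simpa using hα0)
    ENNReal.ofReal_ne_top hkt hk hG (fun n => Eventually.of_forall (hle n)) hlim⟩
  filter_upwards [hlim] with x hx
  exact (le_of_tendsto hx.norm (Eventually.of_forall fun n => hle n x)).trans (le_abs_self _)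

/-- The truncated series is the real part of the integral of the truncated kernel expansion, which
converges in L^α to the kernel. So it tends to the sheet in probability, hence almost surely along a
subsequence, while the full sequence tends almost surely to the limit field. -/
theorem limitField_ae_eq_sheet [IsProbabilityMeasure P] (hM : IsIsotropicStableMeasure α P M)
    (hα0 : 0 < α) (hα2 : α < 2) {ψ : SchwartzMap ℝ ℝ} (hψ : IsLemarieMeyer ψ) {H : Fin N → ℝ}
    (hH : ∀ l, 0 < H l ∧ H l < 1) {R : ℝ} (hR : 0 < R) {t : E N} (ht : t ∈ cube N R) :
    ∀ᵐ ω ∂P, limitField α H ψ P M R t ω = sheet α H P M t ω := by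
  obtain ⟨hmem, hlim⟩ := tendsto_eLpNorm_sub_kernel hα0 hψ hH hR t
  have h1 : ∀ n, IsStableIntegral α P M
      (fun x => ∏ l, ∑ q ∈ indexSet₁ n R, kernelTerm α ψ (H l) (t l) q (x l))
      (fun ω => ∑ p ∈ indexSet N n R, ((((2 : ℝ) ^ (-(∑ l, (p.1 l : ℝ) * H l)) : ℝ) : ℂ) *
        ∏ l, waveInc (fracPrim α ψ (H l)) (p.1 l, p.2 l) (t l)) * coeff α ψ P M p.1 p.2 ω) := by
    intro n
    have h2 := IsStableIntegral.sum hM hα0 hα2 (indexSet N n R)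
      (fun p => (((2 : ℝ) ^ (-(∑ l, (p.1 l : ℝ) * H l)) : ℝ) : ℂ) *
        ∏ l, waveInc (fracPrim α ψ (H l)) (p.1 l, p.2 l) (t l))
      fun p _ => isStableIntegral_coeff hM hα0 hα2 hψ p.1 p.2
    simpa only [sum_coeffFun_eq_prod] using h2
  have h2 := IsStableIntegral.tendstoInMeasure hM hα0 hα2 h1
    (isStableIntegral_stableIntegral hM hα0 hα2 hmem) hlim
  obtain ⟨s, hs, h3⟩ := h2.exists_seq_tendsto_ae
  filter_upwards [h3, ae_tendsto_limitField hM hα0 hα2 hψ hH hR] with ω h4 h5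
  refine tendsto_nhds_unique ((h5 t ht).comp hs.tendsto_atTop)
    (((Complex.continuous_re.tendsto _).comp h4).congr fun n => ?_)
  simp only [Function.comp_apply, partialSeries]
  congr 1
  refine Finset.sum_congr rfl fun p _ => ?_
  rw [mul_right_comm]
  rfl

end
end HFSS

theorem mainTheorem2 {N : ℕ} (hN : 0 < N) (α : ℝ) (hα0 : 0 < α) (hα2 : α < 2)
    (H : Fin N → ℝ) (hH : ∀ l, 0 < H l ∧ H l < 1)
    (ψ : SchwartzMap ℝ ℝ) (hψ : HFSS.IsLemarieMeyer ψ)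
    {Ω : Type*} [MeasurableSpace Ω] (P : Measure Ω) [IsProbabilityMeasure P]
    (M : Set (HFSS.E N) → Ω → ℂ) (hM : HFSS.IsIsotropicStableMeasure α P M)
    (R : ℝ) (hR : 0 < R) :
    -- almost surely, the truncated series form a Cauchy sequence in every `C^γ([-R, R]^N)`
    (∀ᵐ ω ∂P, ∀ γ : ℝ≥0, 0 < γ → (∀ l, (γ : ℝ) < H l) →
      (∀ n, HFSS.holderNorm γ (HFSS.cube N R)
        (fun t => HFSS.partialSeries α H ψ P M R n t ω) < ∞) ∧
      ∀ η : ℝ≥0∞, 0 < η → ∃ n₀ : ℕ, ∀ m n : ℕ, n₀ ≤ m → n₀ ≤ n →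
        HFSS.holderNorm γ (HFSS.cube N R)
          (fun t => HFSS.partialSeries α H ψ P M R m t ω -
            HFSS.partialSeries α H ψ P M R n t ω) ≤ η) ∧
    -- the limit `U` is a random field that is a version of the sheet on `[-R, R]^N`
    ∃ U : HFSS.E N → Ω → ℝ,
      (∀ t ∈ HFSS.cube N R, Measurable (U t)) ∧
      (∀ᵐ ω ∂P, ∀ γ : ℝ≥0, 0 < γ → (∀ l, (γ : ℝ) < H l) →
        HFSS.holderNorm γ (HFSS.cube N R) (fun t => U t ω) < ∞ ∧
        Tendsto (fun n => HFSS.holderNorm γ (HFSS.cube N R)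
          (fun t => HFSS.partialSeries α H ψ P M R n t ω - U t ω)) atTop (𝓝 0)) ∧
      ∀ t ∈ HFSS.cube N R, ∀ᵐ ω ∂P, U t ω = HFSS.sheet α H P M t ω := by
  exact ⟨HFSS.ae_partialSeries_cauchy hM hα0 hα2 hψ hH hR, HFSS.limitField α H ψ P M R,
    fun t _ => HFSS.measurable_limitField H ψ R t,
    HFSS.ae_limitField_holder hM hα0 hα2 hψ hH hR,
    fun t ht => HFSS.limitField_ae_eq_sheet hM hα0 hα2 hψ hH hR ht⟩
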